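/- Let $\mathbf H$ be a separable complex Hilbert space, $\mathrm{Tr}$ the ordinary trace on $B(\mathbf H)$, $A\in B(\mathbf H)$ a self-adjoint operator and $\mathbf q\in B(\mathbf H)$ an orthogonal projection that is minimal or zero. Write $S'$ for the commutant of a set $S$ of bounded operators, $[\,\cdot\,]$ for closed linear span, $E(\Delta)$ for the spectral projections of $A$, and put $\mathfrak A=\{A,\mathbf q\}''$, $\widetilde{\mathbf H}=[\{av: a\in\mathfrak A,\ v\in(\mathrm{Ker}\,A)^\perp\}]$, $\mathbf H_{reg}=\mathbf H\ominus\widetilde{\mathbf H}$, $E_-=E([-1,0[)$. Assume: (a) $\mathrm{Tr}(|A|)\le 1$; (b) if $\mathbf q\ne0$ then $\mathrm{Tr}(\mathbf q)=1$; (c) if $\mathrm{Tr}(|A|)=1$ then $\widetilde{\mathbf H}=\mathbf H$; (d) if $\mathrm{Tr}(|A|)<1$ then $\dim\mathbf H_{reg}=\infty$; (e) $\mathbf q E_-=0$; (f) $\mathbf q v=0$ for all $v\in\mathbf H_{reg}$. Fix matrix units $\{e_{kl}\}_{k,l\in\mathbb S}$ of $B(\mathbf H)$ belonging to an orthonormal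 basis of $\mathbf H$ indexed by the countable set $\mathbb S$, such that $Ae_{ll}=e_{ll}A$ and $e_{ll}\widetilde{\mathbf H}\subset\widetilde{\mathbf H}$ for all $l$; if $\mathrm{Tr}(|A|)<1$, let $n_1,n_2,\dots$ be an enumeration without repetition of $\{l: e_{ll}\mathbf H\subset\mathbf H_{reg}\}$. Let $\psi_k(b)=\mathrm{Tr}(b|A|)+(1-\mathrm{Tr}(|A|))\,\mathrm{Tr}(b\,e_{n_kn_k})$ for $b\in B(\mathbf H)$ (the second term is absent if $\mathrm{Tr}(|A|)=1$). Put $B(\mathbf H)^{\otimes k}=B(\mathbf H^{\otimes k})$, embed $B(\mathbf H)^{\otimes k}$ in $B(\mathbf H)^{\otimes(k+1)}$ by $a\mapsto a\otimes \mathrm I$, and let $B(\mathbf H)^{\otimes\infty}=\bigcup_k B(\mathbf H)^{\otimes k}$. Let $\mathcal H_A^{\mathbf q}$ be the Hilbert space completion of $B(\mathbf H)^{\otimes\infty}$ with respect to $(v,u)=\psi(u^*v)$, where $\psi$ is the product state whose restriction to $B(\mathbf H)^{\otimes k}$ is the normal state $\psi_1\otimes\dots\otimes\psi_k$; let $\xi_0$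 be the vector of the unit, and $\mathfrak L_A$ the representation of $B(\mathbf H)^{\otimes\infty}$ on $\mathcal H_A^{\mathbf q}$ by left multiplication. Let $R_\infty$ be the semigroup of the partial bijections $r$ of $\mathbb N=\{1,2,\dots\}$ with $r(x)=x$ for all but finitely many $x$; let $\epsilon_{\{1\}}\in R_\infty$ be the identity map of $\mathbb N\setminus\{1\}$. Write $a^{(k)}$ for $a\in B(\mathbf H)$ acting on the $k$-th tensor factor. Let $T$ be the homomorphism from $R_\infty$ to $B(\mathbf H)^{\otimes\infty}$ with $T(\epsilon_{\{1\}})=\mathbf q^{(1)}$ and $T((k\;k{+}1))=U_k\sum_{ij}e_{ij}^{(k)}e_{ji}^{(k+1)}$ for all $k$, where $$U_k=(\mathrm I-E_-)^{(k)}(\mathrm I-E_-)^{(k+1)}+E_-^{(k)}(\mathrm I-E_-)^{(k+1)}+(\mathrm I-E_-)^{(k)}E_-^{(k+1)}-E_-^{(k)}E_-^{(k+1)}.$$ Put $\Pi_A=\mathfrak L_A\circ T$ and let $\pi_A^{(0)}$ be the restriction of $\Pi_A$ to $[\Pi_A(R_\infty)\xi_0]$. Then $\xi_0$ is cyclic for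 the commutant $\pi_A^{(0)}(R_\infty)'$, that is, $[\pi_A^{(0)}(R_\infty)'\xi_0]=[\Pi_A(R_\infty)\xi_0]$, if and only if $(\mathrm{Ker}\,A)^\perp=\widetilde{\mathbf H}$. -/

import Mathlib

open scoped InnerProductSpace ENNReal

namespace InfTensor

noncomputable section

/-! ### Operators on `ℓ²(X)` and their matrix coefficients -/

abbrev L2 (X : Type*) : Type _ := lp (fun _ : X => ℂ) 2

variable {X : Type*}

open scoped Classical in
/-- The standard basis vector `e_x` of `ℓ²(X)`. -/
def e (x : X) : L2 X := lp.single 2 x 1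

/-- The matrix coefficient `⟨e_x, a e_y⟩`. -/
def coeff (a : L2 X →L[ℂ] L2 X) (x y : X) : ℂ := a (e y) x

theorem e_apply_self (x : X) : (e x : L2 X) x = 1 := by
  classical
  simp [e]

theorem e_apply_ne {x y : X} (h : y ≠ x) : (e x : L2 X) y = 0 := by
  classical
  simp [e, h]

theorem norm_e (x : X) : ‖(e x : L2 X)‖ = 1 := by
  classical
  simp [e]

theorem inner_e (x : X) (f : L2 X) : ⟪e x, f⟫_ℂ = f x := by
  classical
  simp [e, lp.inner_single_left]

theorem coeff_eq_inner (a : L2 X →L[ℂ] L2 X) (x y : X) : coeff a x y = ⟪e x, a (e y)⟫_ℂ :=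
  (inner_e _ _).symm

theorem hasSum_e (f : L2 X) : HasSum (fun x => f x • (e x : L2 X)) f := by
  classical
  have := lp.hasSum_single (p := 2) (by simp) f
  refine this.congr_fun ?_
  intro x
  ext y
  simp [e, Pi.single_apply]

theorem hasSum_coeff (a : L2 X →L[ℂ] L2 X) (f : L2 X) (x : X) :
    HasSum (fun z => f z * coeff a x z) (a f x) := by
  have h := ((innerSL ℂ (e x)).comp a).hasSum (hasSum_e f)
  simpa [inner_e, coeff] using h

theorem ext_coeff {a b : L2 X →L[ℂ] L2 X} (h : ∀ x y, coeff a x y = coeff b x y) : a = b := by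
  ext f x
  have h1 := hasSum_coeff a f x
  simp_rw [h] at h1
  exact h1.unique (hasSum_coeff b f x)

theorem coeff_mul (a b : L2 X →L[ℂ] L2 X) (x y : X) :
    coeff (a * b) x y = ∑' z, coeff a x z * coeff b z y := by
  have := (hasSum_coeff a (b (e y)) x).tsum_eq
  simp_rw [mul_comm (coeff a x _)]
  exact this.symm

theorem coeff_star (a : L2 X →L[ℂ] L2 X) (x y : X) :
    coeff (star a) x y = star (coeff a y x) := by
  rw [coeff_eq_inner, coeff_eq_inner, ContinuousLinearMap.star_eq_adjoint,
    ContinuousLinearMap.adjoint_inner_right, ← inner_conj_symm]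
  rfl

theorem coeff_one (x y : X) [Decidable (x = y)] :
    coeff (1 : L2 X →L[ℂ] L2 X) x y = if x = y then 1 else 0 := by
  split_ifs with h
  · subst h; exact e_apply_self x
  · exact e_apply_ne h

theorem norm_sq_eq_tsum (f : L2 X) : ‖f‖ ^ 2 = ∑' x, ‖f x‖ ^ 2 := by
  have := lp.norm_rpow_eq_tsum (p := 2) (by simp) f
  simpa using this

theorem summable_sq (f : L2 X) : Summable fun x => ‖f x‖ ^ 2 := by
  have := (lp.memℓp f).summable (by simp)
  simpa using this

theorem memℓp_of_summable_sq {g : X → ℂ} (h : Summable fun x => ‖g x‖ ^ 2) :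
    Memℓp (E := fun _ : X => ℂ) g 2 :=
  memℓp_gen (by simpa using h)

/-! ### The algebra of local operators

Once an orthonormal basis `(b_l)_{l ∈ ι}` of `H` is fixed, the Hilbert space `H^{⊗ n}` is `ℓ²(ιⁿ)`,
with `b_{x₀} ⊗ ⋯ ⊗ b_{x_{n-1}}` corresponding to `e_x`.  All the algebras
`B(H)^{⊗ n} = B(H^{⊗ n})`, embedded in one another by `a ↦ a ⊗ I`, act
faithfully on `ℓ²(ι^ℕ)` as `a ⊗ I ⊗ I ⊗ ⋯`, and their union is `B(H)^{⊗ ∞}`. -/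

variable {ι : Type*}

/-- `a` has the form `a' ⊗ I ⊗ I ⊗ ⋯` with `a'` acting on the first `n` tensor factors:
`⟨e_x, a e_y⟩` vanishes unless `x` and `y` agree from place `n` on, and in that case it depends
only on the first `n` entries of `x` and of `y`. -/
def IsLocal (n : ℕ) (a : L2 (ℕ → ι) →L[ℂ] L2 (ℕ → ι)) : Prop :=
  (∀ x y : ℕ → ι, (∃ k, n ≤ k ∧ x k ≠ y k) → coeff a x y = 0) ∧
  ∀ x y x' y' : ℕ → ι, (∀ k < n, x k = x' k ∧ y k = y' k) →
    (∀ k, n ≤ k → x k = y k ∧ x' k = y' k) → coeff a x y = coeff a x' y'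

theorem IsLocal.mono {n m : ℕ} (h : n ≤ m) {a : L2 (ℕ → ι) →L[ℂ] L2 (ℕ → ι)}
    (ha : IsLocal n a) : IsLocal m a := by
  refine ⟨fun x y ⟨k, hk, hxy⟩ => ha.1 x y ⟨k, h.trans hk, hxy⟩, fun x y x' y' h1 h2 => ?_⟩
  by_cases hxy : ∀ k, n ≤ k → x k = y k
  · refine ha.2 x y x' y' (fun k hk => h1 k (hk.trans_le h)) fun k hk => ⟨hxy k hk, ?_⟩
    rcases lt_or_ge k m with hkm | hkm
    · rw [← (h1 k hkm).1, ← (h1 k hkm).2, hxy k hk]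
    · exact (h2 k hkm).2
  · push Not at hxy
    obtain ⟨k, hk, hne⟩ := hxy
    rw [ha.1 x y ⟨k, hk, hne⟩]
    have hkm : k < m := by
      by_contra hc
      exact hne (h2 k (not_lt.1 hc)).1
    rw [ha.1 x' y' ⟨k, hk, by rwa [← (h1 k hkm).1, ← (h1 k hkm).2]⟩]

theorem IsLocal.add {n : ℕ} {a b : L2 (ℕ → ι) →L[ℂ] L2 (ℕ → ι)}
    (ha : IsLocal n a) (hb : IsLocal n b) : IsLocal n (a + b) := by
  have key : ∀ x y, coeff (a + b) x y = coeff a x y + coeff b x y := fun x y => by simp [coeff]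
  refine ⟨fun x y h => ?_, fun x y x' y' h1 h2 => ?_⟩
  · rw [key, ha.1 x y h, hb.1 x y h, add_zero]
  · rw [key, key, ha.2 x y x' y' h1 h2, hb.2 x y x' y' h1 h2]

theorem IsLocal.star {n : ℕ} {a : L2 (ℕ → ι) →L[ℂ] L2 (ℕ → ι)}
    (ha : IsLocal n a) : IsLocal n (star a) := by
  refine ⟨fun x y ⟨k, hk, hne⟩ => ?_, fun x y x' y' h1 h2 => ?_⟩
  · rw [coeff_star, ha.1 y x ⟨k, hk, hne.symm⟩, star_zero]
  · rw [coeff_star, coeff_star, ha.2 y x y' x' (fun k hk => (h1 k hk).symm)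
      fun k hk => ⟨(h2 k hk).1.symm, (h2 k hk).2.symm⟩]

theorem isLocal_algebraMap (n : ℕ) (c : ℂ) :
    IsLocal n (algebraMap ℂ (L2 (ℕ → ι) →L[ℂ] L2 (ℕ → ι)) c) := by
  classical
  have key : ∀ x y, coeff (algebraMap ℂ (L2 (ℕ → ι) →L[ℂ] L2 (ℕ → ι)) c) x y =
      c * if x = y then 1 else 0 := fun x y => by
    rw [← coeff_one]
    simp [coeff, Algebra.algebraMap_eq_smul_one]
  refine ⟨fun x y ⟨k, hk, hne⟩ => ?_, fun x y x' y' h1 h2 => ?_⟩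
  · rw [key, if_neg (fun h => hne (congrFun h k)), mul_zero]
  · rw [key, key]
    have : x = y ↔ x' = y' := by
      simp only [funext_iff]
      refine forall_congr' fun k => ?_
      rcases lt_or_ge k n with hk | hk
      · rw [(h1 k hk).1, (h1 k hk).2]
      · simp [(h2 k hk).1, (h2 k hk).2]
    simp [this]

theorem IsLocal.mul {n : ℕ} {a b : L2 (ℕ → ι) →L[ℂ] L2 (ℕ → ι)}
    (ha : IsLocal n a) (hb : IsLocal n b) : IsLocal n (a * b) := by
  classical
  refine ⟨fun x y ⟨k, hk, hne⟩ => ?_, fun x y x' y' h1 h2 => ?_⟩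
  · rw [coeff_mul]
    refine (tsum_congr fun z => ?_).trans tsum_zero
    by_cases hz : x k = z k
    · rw [hb.1 z y ⟨k, hk, hz ▸ hne⟩, mul_zero]
    · rw [ha.1 x z ⟨k, hk, hz⟩, zero_mul]
  · rw [coeff_mul, coeff_mul]
    -- change the tail of a sequence into the tail of `t`
    let φ : (ℕ → ι) → (ℕ → ι) → ℕ → ι := fun t z k => if k < n then z k else t k
    have tail : ∀ {u z : ℕ → ι}, coeff a u z ≠ 0 → ∀ k, n ≤ k → u k = z k := by
      intro u z h k hk
      by_contra hne
      exact h (ha.1 u z ⟨k, hk, hne⟩)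
    have val : ∀ (u w u' w' z : ℕ → ι), (∀ k < n, u k = u' k ∧ w k = w' k) →
        (∀ k, n ≤ k → u k = w k ∧ u' k = w' k) → coeff a u z ≠ 0 →
        coeff a u z * coeff b z w = coeff a u' (φ u' z) * coeff b (φ u' z) w' := by
      intro u w u' w' z h3 h4 hz
      rw [ha.2 u z u' (φ u' z), hb.2 z w (φ u' z) w']
      · exact fun k hk => ⟨by simp [φ, hk], (h3 k hk).2⟩
      · exact fun k hk => ⟨by rw [← tail hz k hk, (h4 k hk).1], by simp [φ, hk.not_gt, (h4 k hk).2]⟩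
      · exact fun k hk => ⟨(h3 k hk).1, by simp [φ, hk]⟩
      · exact fun k hk => ⟨tail hz k hk, by simp [φ, hk.not_gt]⟩
    symm
    refine tsum_eq_tsum_of_ne_zero_bij (fun z => φ x' z.1) ?_ ?_ ?_
    · intro z z' h
      have hz := tail (left_ne_zero_of_mul z.2)
      have hz' := tail (left_ne_zero_of_mul z'.2)
      ext k
      rcases lt_or_ge k n with hk | hk
      · simpa [φ, hk] using congrFun h k
      · rw [← hz k hk, ← hz' k hk]
    · intro z hz
      have hz0 := left_ne_zero_of_mul hz
      have h1' : ∀ k < n, x' k = x k ∧ y' k = y k := fun k hk => ⟨(h1 k hk).1.symm, (h1 k hk).2.symm⟩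
      refine ⟨⟨φ x z, ?_⟩, ?_⟩
      · rw [Function.mem_support, ← val x' y' x y z h1' (fun k hk => (h2 k hk).symm) hz0]
        exact hz
      · ext k
        rcases lt_or_ge k n with hk | hk
        · simp [φ, hk]
        · simp [φ, hk.not_gt, tail hz0 k hk]
    · intro z
      exact (val x y x' y' z.1 h1 h2 (left_ne_zero_of_mul z.2)).symm

variable (ι) in
/-- The `⋆`-algebra `B(H)^{⊗ ∞} = ⋃ₙ B(H)^{⊗ n}`. -/
def localAlg : StarSubalgebra ℂ (L2 (ℕ → ι) →L[ℂ] L2 (ℕ → ι)) where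
  carrier := {a | ∃ n, IsLocal n a}
  mul_mem' := by
    rintro a b ⟨n, ha⟩ ⟨m, hb⟩
    exact ⟨max n m, (ha.mono (le_max_left _ _)).mul (hb.mono (le_max_right _ _))⟩
  add_mem' := by
    rintro a b ⟨n, ha⟩ ⟨m, hb⟩
    exact ⟨max n m, (ha.mono (le_max_left _ _)).add (hb.mono (le_max_right _ _))⟩
  algebraMap_mem' c := ⟨0, isLocal_algebraMap 0 c⟩
  star_mem' := by
    rintro a ⟨n, ha⟩
    exact ⟨n, ha.star⟩

/-! ### Operators acting on one tensor factor, and permutation operators -/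

variable {H : Type*} [NormedAddCommGroup H] [InnerProductSpace ℂ H]

/-- The vector of `ℓ²(ι)` got from `f ∈ ℓ²(ι^ℕ)` by freezing all variables of `x` but the `k`-th. -/
def slice (k : ℕ) (f : L2 (ℕ → ι)) (x : ℕ → ι) : L2 ι :=
  ⟨fun l => f (Function.update x k l),
    memℓp_of_summable_sq ((summable_sq f).comp_injective (Function.update_injective x k))⟩

theorem slice_apply (k : ℕ) (f : L2 (ℕ → ι)) (x : ℕ → ι) (l : ι) :
    slice k f x l = f (Function.update x k l) := rfl

theorem slice_update (k : ℕ) (f : L2 (ℕ → ι)) (x : ℕ → ι) (l : ι) :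
    slice k f (Function.update x k l) = slice k f x := by
  ext m; simp [slice_apply]

theorem slice_add (k : ℕ) (f g : L2 (ℕ → ι)) (x : ℕ → ι) :
    slice k (f + g) x = slice k f x + slice k g x := by
  ext m; simp [slice_apply]

theorem slice_smul (k : ℕ) (c : ℂ) (f : L2 (ℕ → ι)) (x : ℕ → ι) :
    slice k (c • f) x = c • slice k f x := by
  ext m; simp [slice_apply]

/-- `(a^{(k)} f)(x)`, where `a` acts on the `k`-th variable of `f`. -/
def siteFun (b : HilbertBasis ι ℂ H) (k : ℕ) (a : H →L[ℂ] H) (f : L2 (ℕ → ι)) (x : ℕ → ι) : ℂ :=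
  ⟪b (x k), a (b.repr.symm (slice k f x))⟫_ℂ

theorem site_bound (b : HilbertBasis ι ℂ H) (k : ℕ) (a : H →L[ℂ] H) (f : L2 (ℕ → ι)) :
    Summable (fun x => ‖siteFun b k a f x‖ ^ 2) ∧
      ∑' x, ‖siteFun b k a f x‖ ^ 2 ≤ ‖a‖ ^ 2 * ‖f‖ ^ 2 := by
  let E : (({ j // j ≠ k } → ι) × ι) ≃ (ℕ → ι) :=
    ((Equiv.funSplitAt k ι).trans (Equiv.prodComm _ _)).symm
  have hEk : ∀ z l, E (z, l) k = l := fun z l => by simp [E, Equiv.funSplitAt, Equiv.piSplitAt]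
  have hEu : ∀ z l m, Function.update (E (z, l)) k m = E (z, m) := fun z l m => by
    ext j
    by_cases hj : j = k
    · subst hj; simp [hEk]
    · simp [hj, E, Equiv.funSplitAt, Equiv.piSplitAt]
  have hf : Summable fun p => ‖f (E p)‖ ^ 2 := (E.summable_iff (f := fun x => ‖f x‖ ^ 2)).2
    (summable_sq f)
  have hf' := (summable_prod_of_nonneg (fun p => by positivity)).1 hf
  let S : ({ j // j ≠ k } → ι) → L2 ι := fun z =>
    ⟨fun l => f (E (z, l)), memℓp_of_summable_sq (hf'.1 z)⟩
  have hS : ∀ z l, slice k f (E (z, l)) = S z := fun z l => by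
    ext m; simp only [slice_apply, hEu]; rfl
  have hval : ∀ z l, siteFun b k a f (E (z, l)) = b.repr (a (b.repr.symm (S z))) l := fun z l => by
    rw [siteFun, hS, hEk, b.repr_apply_apply]
  have hSn : ∀ z, ∑' l, ‖f (E (z, l))‖ ^ 2 = ‖S z‖ ^ 2 := fun z => (norm_sq_eq_tsum (S z)).symm
  have hin : ∀ z, Summable fun l => ‖siteFun b k a f (E (z, l))‖ ^ 2 := fun z => by
    simp_rw [hval]
    exact summable_sq _
  have hle : ∀ z, ∑' l, ‖siteFun b k a f (E (z, l))‖ ^ 2 ≤ ‖a‖ ^ 2 * ‖S z‖ ^ 2 := fun z => by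
    simp_rw [hval]
    rw [← norm_sq_eq_tsum, LinearIsometryEquiv.norm_map, ← mul_pow]
    gcongr
    simpa using a.le_opNorm (b.repr.symm (S z))
  have hSs : Summable fun z => ‖a‖ ^ 2 * ‖S z‖ ^ 2 := by
    have := hf'.2
    simp_rw [hSn] at this
    exact this.mul_left _
  have hout : Summable fun z => ∑' l, ‖siteFun b k a f (E (z, l))‖ ^ 2 :=
    hSs.of_nonneg_of_le (fun z => tsum_nonneg fun l => by positivity) hle
  have hall : Summable fun p => ‖siteFun b k a f (E p)‖ ^ 2 :=
    (summable_prod_of_nonneg (fun p => by positivity)).2 ⟨hin, hout⟩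
  refine ⟨(E.summable_iff (f := fun x => ‖siteFun b k a f x‖ ^ 2)).1 hall, ?_⟩
  rw [← E.tsum_eq (fun x => ‖siteFun b k a f x‖ ^ 2), hall.tsum_prod' hin]
  refine (hout.tsum_le_tsum hle hSs).trans_eq ?_
  rw [tsum_mul_left, norm_sq_eq_tsum f, ← E.tsum_eq (fun x => ‖f x‖ ^ 2), hf.tsum_prod' hf'.1]
  simp_rw [hSn]

/-- The operator `a^{(k)} = I ⊗ ⋯ ⊗ I ⊗ a ⊗ I ⊗ ⋯`, with `a` at the `k`-th place. -/
def siteOp (b : HilbertBasis ι ℂ H) (k : ℕ) (a : H →L[ℂ] H) : L2 (ℕ → ι) →L[ℂ] L2 (ℕ → ι) :=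
  LinearMap.mkContinuous
    { toFun := fun f => ⟨siteFun b k a f, memℓp_of_summable_sq (site_bound b k a f).1⟩
      map_add' := fun f g => by
        ext x; simp [siteFun, slice_add]; rfl
      map_smul' := fun c f => by
        ext x; simp [siteFun, slice_smul] }
    ‖a‖ fun f => by
      rw [← sq_le_sq₀ (by positivity) (by positivity), mul_pow, norm_sq_eq_tsum]
      exact (site_bound b k a f).2

theorem siteOp_apply (b : HilbertBasis ι ℂ H) (k : ℕ) (a : H →L[ℂ] H) (f : L2 (ℕ → ι))
    (x : ℕ → ι) : siteOp b k a f x = ⟪b (x k), a (b.repr.symm (slice k f x))⟫_ℂ := rfl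

theorem slice_e (k : ℕ) (x y : ℕ → ι) (h : ∀ j, j ≠ k → x j = y j) :
    slice k (e y) x = e (y k) := by
  ext l
  rw [slice_apply]
  by_cases hl : l = y k
  · subst hl
    have : Function.update x k (y k) = y := by
      ext j; by_cases hj : j = k
      · subst hj; simp
      · simp [hj, h j hj]
    rw [this, e_apply_self, e_apply_self]
  · rw [e_apply_ne hl, e_apply_ne]
    intro hc
    exact hl (by simpa using congrFun hc k)

theorem slice_e_zero (k : ℕ) (x y : ℕ → ι) (h : ¬ ∀ j, j ≠ k → x j = y j) :
    slice k (e y) x = 0 := by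
  ext l
  rw [slice_apply, e_apply_ne]
  · rfl
  · intro hc
    refine h fun j hj => ?_
    simpa [hj] using congrFun hc j

theorem repr_symm_e (b : HilbertBasis ι ℂ H) (l : ι) : b.repr.symm (e l) = b l := by
  classical
  rw [e]; exact b.repr_symm_single l

open scoped Classical in
theorem coeff_siteOp (b : HilbertBasis ι ℂ H) (k : ℕ) (a : H →L[ℂ] H) (x y : ℕ → ι) :
    coeff (siteOp b k a) x y =
      if ∀ j, j ≠ k → x j = y j then ⟪b (x k), a (b (y k))⟫_ℂ else 0 := by
  rw [coeff, siteOp_apply]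
  split_ifs with h
  · rw [slice_e k x y h, repr_symm_e]
  · rw [slice_e_zero k x y h]; simp

theorem siteOp_mem (b : HilbertBasis ι ℂ H) (k : ℕ) (a : H →L[ℂ] H) :
    siteOp b k a ∈ localAlg ι := by
  classical
  refine ⟨k + 1, fun x y ⟨j, hj, hne⟩ => ?_, fun x y x' y' h1 h2 => ?_⟩
  · rw [coeff_siteOp, if_neg fun h => hne (h j (by omega))]
  · rw [coeff_siteOp, coeff_siteOp, (h1 k (by omega)).1, (h1 k (by omega)).2]
    refine if_congr (forall_congr' fun j => imp_congr_right fun _ => ?_) rfl rfl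
    rcases lt_or_ge j (k + 1) with hj | hj
    · rw [(h1 j hj).1, (h1 j hj).2]
    · simp [(h2 j hj).1, (h2 j hj).2]

theorem slice_siteOp_same (b : HilbertBasis ι ℂ H) (k : ℕ) (a : H →L[ℂ] H) (f : L2 (ℕ → ι))
    (x : ℕ → ι) : slice k (siteOp b k a f) x = b.repr (a (b.repr.symm (slice k f x))) := by
  ext l
  rw [slice_apply, siteOp_apply, slice_update, b.repr_apply_apply]
  simp

theorem siteOp_mul (b : HilbertBasis ι ℂ H) (k : ℕ) (a c : H →L[ℂ] H) :
    siteOp b k (a * c) = siteOp b k a * siteOp b k c := by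
  ext f x
  change _ = siteOp b k a (siteOp b k c f) x
  rw [siteOp_apply, siteOp_apply, slice_siteOp_same]
  simp

theorem siteOp_star (b : HilbertBasis ι ℂ H) [CompleteSpace H] (k : ℕ) (a : H →L[ℂ] H) :
    siteOp b k (star a) = star (siteOp b k a) := by
  classical
  refine ext_coeff fun x y => ?_
  rw [coeff_star, coeff_siteOp, coeff_siteOp]
  simp_rw [eq_comm (a := y _)]
  split_ifs with h
  · rw [ContinuousLinearMap.star_eq_adjoint, ContinuousLinearMap.adjoint_inner_right,
      ← inner_conj_symm]
    rfl
  · simp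

/-- The weighted permutation operator `e_y ↦ c(y) e_{y ∘ s⁻¹}`, where all `c(y)` are signs. -/
def permOp (s : Equiv.Perm ℕ) (c : (ℕ → ι) → ℤˣ) : L2 (ℕ → ι) →L[ℂ] L2 (ℕ → ι) :=
  have hn : ∀ (f : L2 (ℕ → ι)) (x : ℕ → ι),
      ‖((c (x ∘ s) : ℤ) : ℂ) * f (x ∘ s)‖ ^ 2 = ‖f (x ∘ s)‖ ^ 2 := fun f x => by
    rcases Int.units_eq_one_or (c (x ∘ s)) with h | h <;> simp [h]
  let E : (ℕ → ι) ≃ (ℕ → ι) := s.symm.arrowCongr (Equiv.refl ι)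
  LinearMap.mkContinuous
    { toFun := fun f => ⟨fun x => ((c (x ∘ s) : ℤ) : ℂ) * f (x ∘ s),
        memℓp_of_summable_sq (by
          simp_rw [hn]
          exact (E.summable_iff (f := fun x => ‖f x‖ ^ 2)).2 (summable_sq f))⟩
      map_add' := fun f g => by ext x; simp [mul_add]; rfl
      map_smul' := fun r f => by ext x; simp [mul_left_comm] }
    1 fun f => by
      rw [← sq_le_sq₀ (by positivity) (by positivity), one_mul, norm_sq_eq_tsum,
        norm_sq_eq_tsum f, ← E.tsum_eq (fun x => ‖f x‖ ^ 2)]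
      exact (tsum_congr (hn f)).le

theorem permOp_apply (s : Equiv.Perm ℕ) (c : (ℕ → ι) → ℤˣ) (f : L2 (ℕ → ι)) (x : ℕ → ι) :
    permOp s c f x = ((c (x ∘ s) : ℤ) : ℂ) * f (x ∘ s) := rfl

/-! ### The infinite symmetric inverse semigroup -/

/-- `R_∞`: the partial bijections `r` of `ℕ` with `r(x) = x` for all but finitely many `x`. -/
@[ext]
structure RInf where
  map : ℕ ≃. ℕ
  finite : {x | map x ≠ some x}.Finite

namespace RInf

instance : One RInf := ⟨⟨PEquiv.refl ℕ, by simp [PEquiv.refl_apply]⟩⟩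

/-- Composition: `(r * r') x = r (r' x)`, that is, multiplication of `0`-`1`-matrices. -/
instance : Mul RInf := ⟨fun r r' => ⟨r'.map.trans r.map, by
  refine (r.finite.union r'.finite).subset fun x hx => ?_
  by_contra h
  simp only [Set.mem_union, Set.mem_ofPred_eq, not_or, not_not] at h
  exact hx (by simp [PEquiv.trans, h.1, h.2])⟩⟩

theorem mul_map (r r' : RInf) : (r * r').map = r'.map.trans r.map := rfl

theorem one_map : (1 : RInf).map = PEquiv.refl ℕ := rfl

instance : Monoid RInf where
  mul_assoc a b c := RInf.ext (by simp [mul_map, PEquiv.trans_assoc])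
  one_mul a := RInf.ext (by simp [mul_map, one_map])
  mul_one a := RInf.ext (by simp [mul_map, one_map])

/-- A finitary permutation as an element of `R_∞`; these elements form `𝔖_∞`. -/
def ofPerm (s : Equiv.Perm ℕ) (hs : {x | s x ≠ x}.Finite) : RInf :=
  ⟨s.toPEquiv, by simpa [Equiv.toPEquiv_apply] using hs⟩

theorem finite_swap (i j : ℕ) : {x | Equiv.swap i j x ≠ x}.Finite :=
  (Set.toFinite {i, j}).subset fun x hx => by
    by_contra h
    simp only [Set.mem_insert_iff, Set.mem_singleton_iff, not_or] at h
    exact hx (Equiv.swap_apply_of_ne_of_ne h.1 h.2)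

/-- The transposition `(i j)`. -/
def swap (i j : ℕ) : RInf := ofPerm (Equiv.swap i j) (finite_swap i j)

/-- The idempotent `ε_{k}`: the identity of `ℕ \ {k}`. -/
def eps (k : ℕ) : RInf :=
  ⟨PEquiv.ofSet {k}ᶜ, (Set.finite_singleton k).subset fun x hx => by
    by_contra h
    exact hx (PEquiv.mem_ofSet_self_iff.2 h)⟩

/-- The finite set of the points where `r` is not defined. -/
def undef (r : RInf) : Finset ℕ :=
  (r.finite.subset (t := {x | r.map x = none}) fun x hx => by
    rw [Set.mem_ofPred_eq] at hx ⊢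
    simp [hx]).toFinset

theorem mem_undef {r : RInf} {x : ℕ} : x ∈ r.undef ↔ r.map x = none := by
  simp [undef]

theorem exists_extension (r : RInf) :
    ∃ s : Equiv.Perm ℕ, {x | s x ≠ x}.Finite ∧ ∀ i j, r.map i = some j → s i = j := by
  classical
  set F : Finset ℕ := r.finite.toFinset with hF
  have memF : ∀ x, x ∈ F ↔ r.map x ≠ some x := fun x => by simp [hF]
  have stay : ∀ x ∈ F, ∀ y, r.map x = some y → y ∈ F := by
    intro x hx y hy
    by_contra hc
    rw [memF, not_not] at hc
    rw [memF] at hx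
    exact hx (by rw [hy, PEquiv.inj r.map hy hc])
  obtain ⟨g, hg⟩ := Finset.exists_equiv_extend_of_card_eq (α := F) (t := F) (by simp)
    (s := Finset.univ.filter fun x : F => (r.map x).isSome)
    (f := fun x => (r.map x).getD x) (by
      intro y hy
      simp only [Finset.mem_image, Finset.mem_filter, Finset.mem_univ, true_and] at hy
      obtain ⟨x, hx, rfl⟩ := hy
      obtain ⟨y, hy⟩ := Option.isSome_iff_exists.1 hx
      simpa [hy] using stay x x.2 y hy) (by
      intro x hx y hy hxy
      simp only [Finset.coe_filter, Finset.mem_univ, true_and, Set.mem_ofPred_eq] at hx hy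
      obtain ⟨x', hx'⟩ := Option.isSome_iff_exists.1 hx
      obtain ⟨y', hy'⟩ := Option.isSome_iff_exists.1 hy
      simp only [hx', hy', Option.getD_some] at hxy
      subst hxy
      exact Subtype.ext (PEquiv.inj r.map hx' hy'))
  refine ⟨Equiv.Perm.ofSubtype g, F.finite_toSet.subset fun x hx => ?_, fun i j hij => ?_⟩
  · by_contra hc
    exact hx (Equiv.Perm.ofSubtype_apply_of_not_mem g hc)
  · by_cases hi : i ∈ F
    · rw [Equiv.Perm.ofSubtype_apply_of_mem g hi, hg ⟨i, hi⟩ (by simp [hij])]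
      simp [hij]
    · rw [Equiv.Perm.ofSubtype_apply_of_not_mem g hi]
      rw [memF, not_not, hij] at hi
      simpa using hi.symm

/-- A finitary permutation `s` extending `r`, so that `r = s · ε_A` with `A` the complement of the
domain of `r`. -/
def extPerm (r : RInf) : Equiv.Perm ℕ := r.exists_extension.choose

theorem finite_ext (r : RInf) : {x | r.extPerm x ≠ x}.Finite := r.exists_extension.choose_spec.1

theorem ext_apply (r : RInf) {i j : ℕ} (h : r.map i = some j) : r.extPerm i = j :=
  r.exists_extension.choose_spec.2 i j h

end RInf

/-! ### The signs -/

/-- `(-1)` to the number of the inversions of `s` among the elements of `N`. -/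
def invSign (s : Equiv.Perm ℕ) (N : Set ℕ) : ℤˣ :=
  (-1) ^ {p : ℕ × ℕ | p.1 < p.2 ∧ s p.2 < s p.1 ∧ p.1 ∈ N ∧ p.2 ∈ N}.ncard

def pairs (n : ℕ) : Finset (ℕ × ℕ) := (Finset.range n ×ˢ Finset.range n).filter fun p => p.1 < p.2

theorem mem_pairs {n : ℕ} {p : ℕ × ℕ} : p ∈ pairs n ↔ p.1 < p.2 ∧ p.2 < n := by
  simp [pairs]; omega

theorem exists_bound {s : Equiv.Perm ℕ} (hs : {x | s x ≠ x}.Finite) :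
    ∃ n, ∀ i, n ≤ i → s i = i := by
  obtain ⟨n, hn⟩ := hs.bddAbove
  refine ⟨n + 1, fun i hi => ?_⟩
  by_contra h
  have := hn (show i ∈ {x | s x ≠ x} from h)
  omega

theorem perm_lt {s : Equiv.Perm ℕ} {n : ℕ} (hs : ∀ i, n ≤ i → s i = i) {i : ℕ} (hi : i < n) :
    s i < n := by
  by_contra h
  have := s.injective (hs _ (not_lt.1 h))
  omega

theorem inversion_lt {s : Equiv.Perm ℕ} {n : ℕ} (hs : ∀ i, n ≤ i → s i = i) {i j : ℕ}
    (hij : i < j) (h : s j < s i) : j < n := by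
  by_contra hc
  rw [hs j (not_lt.1 hc)] at h
  rcases lt_or_ge i n with hi | hi
  · have := perm_lt hs hi; omega
  · rw [hs i hi] at h; omega

open scoped Classical in
theorem invSign_eq_prod {s : Equiv.Perm ℕ} {n : ℕ} (hs : ∀ i, n ≤ i → s i = i) (N : Set ℕ) :
    invSign s N = ∏ p ∈ pairs n, if s p.2 < s p.1 ∧ p.1 ∈ N ∧ p.2 ∈ N then -1 else 1 := by
  rw [Finset.prod_ite, Finset.prod_const, Finset.prod_const, one_pow, mul_one, invSign,
    ← Set.ncard_coe_finset]
  congr 2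
  ext p
  simp only [Set.mem_ofPred_eq, Finset.coe_filter, mem_pairs]
  constructor
  · rintro ⟨h1, h2, h3⟩
    exact ⟨⟨h1, inversion_lt hs h1 h2⟩, h2, h3⟩
  · rintro ⟨⟨h1, -⟩, h2, h3⟩
    exact ⟨h1, h2, h3⟩

theorem invSign_mul {s t : Equiv.Perm ℕ} (hs : {x | s x ≠ x}.Finite) (ht : {x | t x ≠ x}.Finite)
    {N M : Set ℕ} (h : ∀ i, i ∈ N ↔ t i ∈ M) :
    invSign (s * t) N = invSign s M * invSign t N := by
  classical
  obtain ⟨n₁, h₁⟩ := exists_bound hs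
  obtain ⟨n₂, h₂⟩ := exists_bound ht
  set n := max n₁ n₂
  replace h₁ : ∀ i, n ≤ i → s i = i := fun i hi => h₁ i ((le_max_left _ _).trans hi)
  replace h₂ : ∀ i, n ≤ i → t i = i := fun i hi => h₂ i ((le_max_right _ _).trans hi)
  have h₂' : ∀ i, n ≤ i → t⁻¹ i = i := fun i hi => by
    rw [Equiv.Perm.inv_eq_iff_eq, h₂ i hi]
  have h₃ : ∀ i, n ≤ i → (s * t) i = i := fun i hi => by
    rw [Equiv.Perm.mul_apply, h₂ i hi, h₁ i hi]
  rw [invSign_eq_prod h₁, invSign_eq_prod h₂, invSign_eq_prod h₃]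
  let σ : Equiv.Perm ℕ → ℕ × ℕ → ℕ × ℕ := fun u p =>
    if u p.1 < u p.2 then (u p.1, u p.2) else (u p.2, u p.1)
  have hσ : ∀ u : Equiv.Perm ℕ, (∀ i, n ≤ i → u i = i) → ∀ p ∈ pairs n, σ u p ∈ pairs n := by
    intro u hu p hp
    rw [mem_pairs] at hp
    have a1 := perm_lt hu hp.2
    have a2 := perm_lt hu (hp.1.trans hp.2)
    have a3 : u p.1 ≠ u p.2 := fun hc => hp.1.ne (u.injective hc)
    simp only [σ, mem_pairs]
    split_ifs with hlt
    · exact ⟨hlt, a1⟩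
    · exact ⟨by simp; omega, a2⟩
  have hinv : ∀ u w : Equiv.Perm ℕ, (∀ i, w (u i) = i) → ∀ p ∈ pairs n, σ w (σ u p) = p := by
    intro u w huw p hp
    rw [mem_pairs] at hp
    by_cases hlt : u p.1 < u p.2
    · simp [σ, hlt, huw, hp.1]
    · simp [σ, hlt, huw, hp.1.not_gt]
  have key : ∏ p ∈ pairs n, (if s p.2 < s p.1 ∧ p.1 ∈ M ∧ p.2 ∈ M then (-1 : ℤˣ) else 1) =
      ∏ p ∈ pairs n, (if s (σ t p).2 < s (σ t p).1 ∧ (σ t p).1 ∈ M ∧ (σ t p).2 ∈ M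
        then (-1 : ℤˣ) else 1) := by
    refine Finset.prod_bij' (fun p _ => σ t⁻¹ p) (fun p _ => σ t p) (hσ _ h₂') (hσ _ h₂)
      (hinv t⁻¹ t (by simp)) (hinv t t⁻¹ (by simp)) ?_
    intro p hp
    rw [hinv t⁻¹ t (by simp) p hp]
  rw [key, ← Finset.prod_mul_distrib]
  refine Finset.prod_congr rfl fun p hp => ?_
  rw [mem_pairs] at hp
  have a3 : t p.1 ≠ t p.2 := fun hc => hp.1.ne (t.injective hc)
  have a4 : s (t p.1) ≠ s (t p.2) := fun hc => a3 (s.injective hc)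
  simp only [Equiv.Perm.mul_apply, h, σ]
  by_cases h1 : t p.1 ∈ M <;> by_cases h2 : t p.2 ∈ M <;> rcases lt_or_gt_of_ne a3 with h3 | h3 <;>
    rcases lt_or_gt_of_ne a4 with h4 | h4 <;> simp [h1, h2, h3, h4, h3.not_gt, h4.not_gt]

/-- Fixed points of `s` contribute no sign. -/
theorem invSign_of_fixed {s : Equiv.Perm ℕ} {N : Set ℕ} (h : ∀ i ∈ N, s i = i) :
    invSign s N = 1 := by
  have : {p : ℕ × ℕ | p.1 < p.2 ∧ s p.2 < s p.1 ∧ p.1 ∈ N ∧ p.2 ∈ N} = ∅ := by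
    ext p
    simp only [Set.mem_ofPred_eq, Set.mem_empty_iff_false, iff_false]
    rintro ⟨h1, h2, h3, h4⟩
    rw [h _ h3, h _ h4] at h2
    omega
  rw [invSign, this]
  simp

/-! ### The representation of `R_∞` by local operators -/

/-- The operator `e_y ↦ ± e_{y ∘ s⁻¹}` on `ℓ²(ι^ℕ)`: it permutes the tensor factors by `s`, with a
factor `-1` for each pair of factors in a state `l` with `neg l` that are interchanged. -/
def signedPerm (neg : ι → Prop) (s : Equiv.Perm ℕ) : L2 (ℕ → ι) →L[ℂ] L2 (ℕ → ι) :=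
  permOp s fun y => invSign s {i | neg (y i)}

theorem coeff_signedPerm_mul (neg : ι → Prop) (s : Equiv.Perm ℕ)
    (B : L2 (ℕ → ι) →L[ℂ] L2 (ℕ → ι)) (x y : ℕ → ι) :
    coeff (signedPerm neg s * B) x y =
      ((invSign s {i | neg (x (s i))} : ℤ) : ℂ) * coeff B (x ∘ s) y := rfl

theorem signedPerm_e (neg : ι → Prop) (s : Equiv.Perm ℕ) (y : ℕ → ι) :
    signedPerm neg s (e y) = ((invSign s {i | neg (y i)} : ℤ) : ℂ) • e (y ∘ s.symm) := by
  ext x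
  rw [signedPerm, permOp_apply]
  by_cases h : x ∘ s = y
  · subst h
    have : x = (x ∘ s) ∘ s.symm := by ext; simp
    rw [e_apply_self, lp.coeFn_smul, Pi.smul_apply, ← this, e_apply_self]
    rfl
  · have : x ≠ y ∘ s.symm := fun hc => h (by rw [hc]; ext; simp)
    rw [e_apply_ne h, lp.coeFn_smul, Pi.smul_apply, e_apply_ne this]
    simp

theorem coeff_mul_signedPerm (neg : ι → Prop) (s : Equiv.Perm ℕ)
    (B : L2 (ℕ → ι) →L[ℂ] L2 (ℕ → ι)) (x y : ℕ → ι) :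
    coeff (B * signedPerm neg s) x y =
      ((invSign s {i | neg (y i)} : ℤ) : ℂ) * coeff B x (y ∘ s.symm) := by
  change B (signedPerm neg s (e y)) x = _
  rw [signedPerm_e, map_smul]
  rfl

theorem signedPerm_mul (neg : ι → Prop) {s t : Equiv.Perm ℕ} (hs : {x | s x ≠ x}.Finite)
    (ht : {x | t x ≠ x}.Finite) :
    signedPerm neg (s * t) = signedPerm neg s * signedPerm neg t := by
  ext f x
  change _ = signedPerm neg s (signedPerm neg t f) x
  simp only [signedPerm, permOp_apply]
  rw [invSign_mul hs ht (M := {i | neg ((x ∘ s) i)}) (by simp)]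
  simp [mul_assoc, Function.comp_assoc]

theorem signedPerm_one (neg : ι → Prop) : signedPerm neg 1 = 1 := by
  ext f x
  rw [signedPerm, permOp_apply, invSign_of_fixed (by simp)]
  simp

theorem signedPerm_mem (neg : ι → Prop) {s : Equiv.Perm ℕ} (hs : {x | s x ≠ x}.Finite) :
    signedPerm neg s ∈ localAlg ι := by
  classical
  obtain ⟨n, hn⟩ := exists_bound hs
  have key : ∀ x y, coeff (signedPerm neg s) x y =
      ((invSign s {i | neg (y i)} : ℤ) : ℂ) * if x = y ∘ s.symm then 1 else 0 := fun x y => by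
    rw [← coeff_one, ← coeff_mul_signedPerm, one_mul]
  have hn' : ∀ k, n ≤ k → s.symm k = k := fun k hk => by rw [Equiv.symm_apply_eq, hn k hk]
  have sgn : ∀ y y' : ℕ → ι, (∀ k < n, y k = y' k) →
      invSign s {i | neg (y i)} = invSign s {i | neg (y' i)} := fun y y' h => by
    rw [invSign_eq_prod hn, invSign_eq_prod hn]
    refine Finset.prod_congr rfl fun p hp => ?_
    rw [mem_pairs] at hp
    simp only [Set.mem_ofPred_eq, h _ hp.2, h _ (hp.1.trans hp.2)]
  refine ⟨n, fun x y ⟨k, hk, hne⟩ => ?_, fun x y x' y' h1 h2 => ?_⟩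
  · rw [key, if_neg, mul_zero]
    intro hc
    exact hne (by simpa [hn' k hk] using congrFun hc k)
  · rw [key, key, sgn y y' fun k hk => (h1 k hk).2]
    have : x = y ∘ s.symm ↔ x' = y' ∘ s.symm := by
      simp only [funext_iff, Function.comp_apply]
      refine forall_congr' fun k => ?_
      rcases lt_or_ge k n with hk | hk
      · have : s.symm k < n := perm_lt hn' hk
        rw [(h1 k hk).1, (h1 _ this).2]
      · rw [hn' k hk]; simp [(h2 k hk).1, (h2 k hk).2]
    simp [this]

open scoped Classical in
theorem coeff_siteOp_mul (b : HilbertBasis ι ℂ H) {j k : ℕ} (hjk : j ≠ k) (a c : H →L[ℂ] H)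
    (x y : ℕ → ι) : coeff (siteOp b j a * siteOp b k c) x y =
      if ∀ i, i ≠ j → i ≠ k → x i = y i then
        ⟪b (x j), a (b (y j))⟫_ℂ * ⟪b (x k), c (b (y k))⟫_ℂ else 0 := by
  rw [coeff_mul, tsum_eq_single (Function.update x j (y j))]
  · rw [coeff_siteOp, coeff_siteOp, if_pos (by intro i hi; simp [hi])]
    by_cases h : ∀ i, i ≠ j → i ≠ k → x i = y i
    · rw [if_pos h, if_pos]
      · simp [hjk.symm]
      · intro i hi
        by_cases hij : i = j
        · subst hij; simp
        · simp [hij, h i hij hi]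
    · rw [if_neg h, if_neg, mul_zero]
      intro hc
      exact h fun i h1 h2 => by simpa [h1] using hc i h2
  · intro z hz
    rw [coeff_siteOp, coeff_siteOp]
    by_cases h1 : ∀ i, i ≠ j → x i = z i
    · by_cases h2 : ∀ i, i ≠ k → z i = y i
      · refine absurd ?_ hz
        ext i
        by_cases hij : i = j
        · subst hij; simp [h2 i hjk]
        · simp [hij, h1 i hij]
      · rw [if_neg h2, mul_zero]
    · rw [if_neg h1, zero_mul]

theorem siteOp_commute (b : HilbertBasis ι ℂ H) {j k : ℕ} (hjk : j ≠ k) (a c : H →L[ℂ] H) :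
    Commute (siteOp b j a) (siteOp b k c) := by
  classical
  refine ext_coeff fun x y => ?_
  rw [coeff_siteOp_mul b hjk, coeff_siteOp_mul b hjk.symm, mul_comm]
  exact if_congr ⟨fun h i h1 h2 => h i h2 h1, fun h i h1 h2 => h i h2 h1⟩ rfl rfl

/-- The product of the commuting operators `a^{(k)}`, `k ∈ F`. -/
def siteProd (b : HilbertBasis ι ℂ H) (a : H →L[ℂ] H) (F : Finset ℕ) :
    L2 (ℕ → ι) →L[ℂ] L2 (ℕ → ι) :=
  F.noncommProd (fun k => siteOp b k a) fun _ _ _ _ h => siteOp_commute b h a a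

theorem siteProd_insert (b : HilbertBasis ι ℂ H) (a : H →L[ℂ] H) {F : Finset ℕ} {k : ℕ}
    (hk : k ∉ F) : siteProd b a (insert k F) = siteOp b k a * siteProd b a F :=
  Finset.noncommProd_insert_of_notMem _ _ _ _ hk

theorem siteProd_empty (b : HilbertBasis ι ℂ H) (a : H →L[ℂ] H) : siteProd b a ∅ = 1 := rfl

theorem siteProd_mem (b : HilbertBasis ι ℂ H) (a : H →L[ℂ] H) (F : Finset ℕ) :
    siteProd b a F ∈ localAlg ι := by
  classical
  induction F using Finset.induction_on with
  | empty => exact one_mem _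
  | insert k F hk ih => rw [siteProd_insert b a hk]; exact mul_mem (siteOp_mem b k a) ih

theorem siteOp_mul_siteProd (b : HilbertBasis ι ℂ H) {a : H →L[ℂ] H} (ha : a * a = a)
    {F : Finset ℕ} {k : ℕ} (hk : k ∈ F) : siteOp b k a * siteProd b a F = siteProd b a F := by
  classical
  rw [← Finset.insert_erase hk, siteProd_insert b a (Finset.notMem_erase k F), ← mul_assoc,
    ← siteOp_mul, ha]

theorem siteProd_mul (b : HilbertBasis ι ℂ H) {a : H →L[ℂ] H} (ha : a * a = a)
    (F G : Finset ℕ) : siteProd b a F * siteProd b a G = siteProd b a (F ∪ G) := by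
  classical
  induction F using Finset.induction_on with
  | empty => simp [siteProd_empty]
  | insert k F hk ih =>
    rw [siteProd_insert b a hk, mul_assoc, ih, Finset.insert_union]
    by_cases h : k ∈ F ∪ G
    · rw [siteOp_mul_siteProd b ha h, Finset.insert_eq_of_mem h]
    · rw [siteProd_insert b a h]

section even

variable (b : HilbertBasis ι ℂ H) (neg : ι → Prop) {q : H →L[ℂ] H} {v : H}

theorem siteOp_mul_signedPerm (hq : q = InnerProductSpace.rankOne ℂ v v)
    (hv : ∀ l, neg l → ⟪b l, v⟫_ℂ = 0) (s : Equiv.Perm ℕ) (k : ℕ) :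
    siteOp b (s k) q * signedPerm neg s = signedPerm neg s * siteOp b k q := by
  classical
  refine ext_coeff fun x y => ?_
  rw [coeff_signedPerm_mul, coeff_mul_signedPerm, coeff_siteOp, coeff_siteOp]
  have hiff : (∀ j, j ≠ s k → x j = (y ∘ s.symm) j) ↔ ∀ j, j ≠ k → (x ∘ s) j = y j := by
    constructor
    · intro h j hj
      simpa using h (s j) (by simpa using hj)
    · intro h j hj
      have := h (s.symm j) (fun hc => hj (by rw [← hc]; simp))
      simpa using this
  by_cases h : ∀ j, j ≠ k → (x ∘ s) j = y j
  · rw [if_pos h, if_pos (hiff.2 h)]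
    simp only [Function.comp_apply, Equiv.symm_apply_apply, hq, InnerProductSpace.rankOne_apply,
      inner_smul_right]
    by_cases h1 : neg (x (s k))
    · simp [hv _ h1]
    · by_cases h2 : neg (y k)
      · rw [← inner_conj_symm v, hv _ h2]; simp
      · have : {i | neg (y i)} = {i | neg (x (s i))} := by
          ext i
          by_cases hi : i = k
          · subst hi; simp [h1, h2]
          · simp [← h i hi]
        rw [this]
  · rw [if_neg h, if_neg (fun hc => h (hiff.1 hc))]; simp

theorem siteProd_mul_signedPerm (hq : q = InnerProductSpace.rankOne ℂ v v)
    (hv : ∀ l, neg l → ⟪b l, v⟫_ℂ = 0) (s : Equiv.Perm ℕ) (F : Finset ℕ) :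
    siteProd b q (F.map s.toEmbedding) * signedPerm neg s =
      signedPerm neg s * siteProd b q F := by
  classical
  induction F using Finset.induction_on with
  | empty => simp [siteProd_empty]
  | insert k F hk ih =>
    rw [Finset.map_insert, siteProd_insert b q (by simpa using hk), mul_assoc, ih, ← mul_assoc,
      siteProd_insert b q hk, ← mul_assoc]
    congr 1
    exact siteOp_mul_signedPerm b neg hq hv s k

theorem signedPerm_swap_mul (hq : q = InnerProductSpace.rankOne ℂ v v)
    (hv : ∀ l, neg l → ⟪b l, v⟫_ℂ = 0) {j k : ℕ} (hjk : j ≠ k) :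
    signedPerm neg (Equiv.swap j k) * (siteOp b j q * siteOp b k q) =
      siteOp b j q * siteOp b k q := by
  classical
  refine ext_coeff fun x y => ?_
  rw [coeff_signedPerm_mul, coeff_siteOp_mul b hjk, coeff_siteOp_mul b hjk]
  have hiff : (∀ i, i ≠ j → i ≠ k → (x ∘ Equiv.swap j k) i = y i) ↔
      ∀ i, i ≠ j → i ≠ k → x i = y i := by
    refine forall_congr' fun i => forall_congr' fun h1 => forall_congr' fun h2 => ?_
    simp [Equiv.swap_apply_of_ne_of_ne h1 h2]
  by_cases h : ∀ i, i ≠ j → i ≠ k → x i = y i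
  · rw [if_pos h, if_pos (hiff.2 h)]
    simp only [Function.comp_apply, hq, InnerProductSpace.rankOne_apply, inner_smul_right,
      Equiv.swap_apply_left, Equiv.swap_apply_right]
    by_cases h1 : neg (x j)
    · simp [hv _ h1]
    · by_cases h2 : neg (x k)
      · simp [hv _ h2]
      · rw [invSign_of_fixed]
        · simp; ring
        · intro i hi
          have hi' : neg (x (Equiv.swap j k i)) := hi
          refine Equiv.swap_apply_of_ne_of_ne ?_ ?_ <;> rintro rfl <;> simp_all
  · rw [if_neg h, if_neg (fun hc => h (hiff.1 hc))]; simp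

theorem signedPerm_mul_siteProd (hq : q = InnerProductSpace.rankOne ℂ v v) (hqq : q * q = q)
    (hv : ∀ l, neg l → ⟪b l, v⟫_ℂ = 0) (F : Finset ℕ) :
    ∀ t : Equiv.Perm ℕ, (∀ i, i ∉ F → t i = i) →
      signedPerm neg t * siteProd b q F = siteProd b q F := by
  classical
  have swp : ∀ (F : Finset ℕ) (j k : ℕ), j ∈ F → k ∈ F →
      signedPerm neg (Equiv.swap j k) * siteProd b q F = siteProd b q F := by
    intro F j k hj hk
    by_cases hjk : j = k
    · subst hjk
      have : Equiv.swap j j = 1 := Equiv.swap_self j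
      rw [this, signedPerm_one, one_mul]
    · rw [← siteOp_mul_siteProd b hqq hk, ← siteOp_mul_siteProd b hqq hj]
      have hc : siteOp b k q * (siteOp b j q * siteProd b q F) =
          siteOp b j q * siteOp b k q * siteProd b q F := by
        rw [← mul_assoc, (siteOp_commute b hjk q q).eq]
      rw [hc, ← mul_assoc, signedPerm_swap_mul b neg hq hv hjk]
  induction F using Finset.induction_on with
  | empty =>
    intro t ht
    have : t = 1 := by ext i; simp [ht i]
    rw [this, signedPerm_one, one_mul]
  | insert a F ha ih =>
    intro t ht
    have hfin : {x | t x ≠ x}.Finite := (insert a F).finite_toSet.subset fun x hx => by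
      by_contra hc
      exact hx (ht x hc)
    set u : Equiv.Perm ℕ := Equiv.swap a (t a) * t with hu
    have hua : u a = a := by simp [hu]
    have hta : t a ∈ insert a F := by
      by_contra hc
      have := t.injective (ht _ hc)
      rw [this] at hc
      simp at hc
    have hu' : ∀ i, i ∉ F → u i = i := by
      intro i hi
      by_cases hia : i = a
      · rw [hia, hua]
      · have h1 : t i = i := ht i (by simp [hi, hia])
        rw [hu, Equiv.Perm.mul_apply, h1]
        refine Equiv.swap_apply_of_ne_of_ne hia fun hc => ?_
        exact hia (t.injective (h1.trans hc))
    have hufin : {x | u x ≠ x}.Finite := F.finite_toSet.subset fun x hx => by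
      by_contra hc
      exact hx (hu' x hc)
    have htu : t = Equiv.swap a (t a) * u := by rw [hu, ← mul_assoc]; simp
    rw [htu, signedPerm_mul neg (RInf.finite_swap _ _) hufin, mul_assoc]
    have : signedPerm neg u * siteProd b q (insert a F) = siteProd b q (insert a F) := by
      rw [siteProd_insert b q ha, ← mul_assoc]
      nth_rewrite 1 [← siteOp_mul_signedPerm b neg hq hv u a]
      rw [hua, mul_assoc, ih u hu']
    rw [this]
    exact swp _ _ _ (Finset.mem_insert_self a F) hta

/-- For `r = s · ε_A` with `s ∈ 𝔖_∞`, the operator `T(r) = T(s) ∏_{k ∈ A} q^{(k)}`. -/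
def T0 (q : H →L[ℂ] H) (r : RInf) : L2 (ℕ → ι) →L[ℂ] L2 (ℕ → ι) :=
  signedPerm neg r.extPerm * siteProd b q r.undef

theorem T0_mem (q : H →L[ℂ] H) (r : RInf) : T0 b neg q r ∈ localAlg ι :=
  mul_mem (signedPerm_mem neg r.finite_ext) (siteProd_mem b q r.undef)

theorem T0_eq (hq : q = InnerProductSpace.rankOne ℂ v v) (hqq : q * q = q)
    (hv : ∀ l, neg l → ⟪b l, v⟫_ℂ = 0) (r : RInf) (s : Equiv.Perm ℕ)
    (hs : {x | s x ≠ x}.Finite) (h : ∀ i j, r.map i = some j → s i = j) :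
    T0 b neg q r = signedPerm neg s * siteProd b q r.undef := by
  set t : Equiv.Perm ℕ := s⁻¹ * r.extPerm with ht
  have htF : ∀ i, i ∉ r.undef → t i = i := by
    intro i hi
    rw [RInf.mem_undef, ← Ne, Option.ne_none_iff_exists'] at hi
    obtain ⟨j, hj⟩ := hi
    rw [ht, Equiv.Perm.mul_apply, r.ext_apply hj, Equiv.Perm.inv_eq_iff_eq, h i j hj]
  have htfin : {x | t x ≠ x}.Finite := r.undef.finite_toSet.subset fun x hx => by
    by_contra hc
    exact hx (htF x hc)
  have : r.extPerm = s * t := by rw [ht]; simp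
  rw [T0, this, signedPerm_mul neg hs htfin, mul_assoc,
    signedPerm_mul_siteProd b neg hq hqq hv _ t htF]

theorem T0_mul (hq : q = InnerProductSpace.rankOne ℂ v v) (hqq : q * q = q)
    (hv : ∀ l, neg l → ⟪b l, v⟫_ℂ = 0) (r r' : RInf) :
    T0 b neg q (r * r') = T0 b neg q r * T0 b neg q r' := by
  classical
  have hfin : {x | (r.extPerm * r'.extPerm) x ≠ x}.Finite :=
    (r.finite_ext.union r'.finite_ext).subset fun x hx => by
      by_contra h
      simp only [Set.mem_union, Set.mem_ofPred_eq, not_or, not_not] at h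
      exact hx (by rw [Equiv.Perm.mul_apply, h.2, h.1])
  rw [T0_eq b neg hq hqq hv (r * r') (r.extPerm * r'.extPerm) hfin]
  · set F : Finset ℕ := r.undef.map r'.extPerm.symm.toEmbedding with hF
    have hF' : r.undef = F.map r'.extPerm.toEmbedding := by
      ext i; simp [hF]
    have hU : (r * r').undef = F ∪ r'.undef := by
      ext i
      simp only [hF, Finset.mem_union, RInf.mem_undef, RInf.mul_map, Finset.mem_map_equiv,
        Equiv.symm_symm]
      cases h : r'.map i with
      | none => simp [PEquiv.trans, h]
      | some j => simp [PEquiv.trans, h, r'.ext_apply h]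
    rw [T0, T0, hU, ← siteProd_mul b hqq, signedPerm_mul neg r.finite_ext r'.finite_ext]
    have := siteProd_mul_signedPerm b neg hq hv r'.extPerm F
    rw [← hF'] at this
    rw [mul_assoc, mul_assoc, ← mul_assoc (siteProd b q r.undef), this, mul_assoc]
  · intro i j hij
    rw [RInf.mul_map] at hij
    cases h : r'.map i with
    | none => simp [PEquiv.trans, h] at hij
    | some k =>
      simp only [PEquiv.trans, PEquiv.coe_mk, h, Option.bind_some] at hij
      rw [Equiv.Perm.mul_apply, r'.ext_apply h, r.ext_apply hij]

theorem T0_one (hq : q = InnerProductSpace.rankOne ℂ v v) (hqq : q * q = q)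
    (hv : ∀ l, neg l → ⟪b l, v⟫_ℂ = 0) : T0 b neg q 1 = 1 := by
  rw [T0_eq b neg hq hqq hv 1 1 (by simp) (by simp [RInf.one_map, PEquiv.refl_apply]), signedPerm_one]
  have : (1 : RInf).undef = ∅ := by
    ext i; simp [RInf.mem_undef, RInf.one_map, PEquiv.refl_apply]
  rw [this, siteProd_empty, one_mul]

end even

/-! ### The parameters -/

section parameters

variable [CompleteSpace H]

/-- `Tr(B)` for a positive operator `B` (it does not depend on the orthonormal basis). -/
def posTrace (b : HilbertBasis ι ℂ H) (B : H →L[ℂ] H) : ℝ≥0∞ :=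
  ∑' l, ENNReal.ofReal (⟪b l, B (b l)⟫_ℂ).re

/-- The matrix units `e_{kl}` belonging to an orthonormal basis: `e_{kl} u = ⟨b_l, u⟩ b_k`. -/
def matUnit (b : HilbertBasis ι ℂ H) (k l : ι) : H →L[ℂ] H :=
  InnerProductSpace.rankOne ℂ (b k) (b l)

/-- `(Ker A)^⊥`. -/
def kerPerp (A : H →L[ℂ] H) : Submodule ℂ H := (LinearMap.ker (A : H →ₗ[ℂ] H))ᗮ

/-- The von Neumann algebra `𝔄 = {A, q}''`. -/
def genAlg (A q : H →L[ℂ] H) : Set (H →L[ℂ] H) := Set.centralizer (Set.centralizer {A, q})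

/-- `H̃`: the closed subspace generated by the vectors `a v` with `a ∈ {A, q}''` and
`v ∈ (Ker A)^⊥`. -/
def Htilde (A q : H →L[ℂ] H) : Submodule ℂ H :=
  (Submodule.span ℂ {w | ∃ a ∈ genAlg A q, ∃ v ∈ kerPerp A, w = a v}).topologicalClosure

/-- `H_reg = H ⊖ H̃`. -/
def Hreg (A q : H →L[ℂ] H) : Submodule ℂ H := (Htilde A q)ᗮ

/-- The range of the spectral projection `E(Δ)` of a self-adjoint operator `A` with finite
`Tr|A|`: the closed linear span of the eigenvectors of `A` with eigenvalue in `Δ`. -/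
def spectralSubspace (A : H →L[ℂ] H) (Δ : Set ℝ) : Submodule ℂ H :=
  (⨆ μ ∈ Δ, Module.End.eigenspace (A : H →ₗ[ℂ] H) (μ : ℂ)).topologicalClosure

instance (A : H →L[ℂ] H) (Δ : Set ℝ) : CompleteSpace (spectralSubspace A Δ) :=
  (Submodule.isClosed_topologicalClosure _).completeSpace_coe

/-- The spectral projection `E(Δ)`. -/
def spectralProj (A : H →L[ℂ] H) (Δ : Set ℝ) : H →L[ℂ] H := (spectralSubspace A Δ).starProjection

variable (ι H) in
/-- The parameters of the representation: the self-adjoint operator `A`, the projection `q`, the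
matrix units (given by an orthonormal basis), the enumeration of `𝕊_reg`, and the conditions on
them. -/
structure Params where
  A : H →L[ℂ] H
  q : H →L[ℂ] H
  basis : HilbertBasis ι ℂ H
  /-- the enumeration `n₀, n₁, …` of `𝕊_reg`; it is irrelevant if `Tr|A| = 1` -/
  reg : ℕ → ι
  selfAdjoint : IsSelfAdjoint A
  q_proj : IsStarProjection q
  /-- `q` is minimal (or zero) -/
  q_minimal : ∀ x : H →L[ℂ] H, ∃ c : ℂ, q * x * q = c • q
  cond_a : posTrace basis (CFC.abs A) ≤ 1
  cond_b : q ≠ 0 → posTrace basis q = 1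
  cond_c : posTrace basis (CFC.abs A) = 1 → Htilde A q = ⊤
  cond_d : posTrace basis (CFC.abs A) < 1 → ¬ FiniteDimensional ℂ (Hreg A q)
  cond_e : q * spectralProj A (Set.Ico (-1) 0) = 0
  cond_f : ∀ v ∈ Hreg A q, q v = 0
  basis_comm : ∀ l, A * matUnit basis l l = matUnit basis l l * A
  basis_Htilde : ∀ l, ∀ v ∈ Htilde A q, matUnit basis l l v ∈ Htilde A q
  reg_bij : posTrace basis (CFC.abs A) < 1 →
    Set.BijOn reg Set.univ {l | ∀ v, matUnit basis l l v ∈ Hreg A q}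

end parameters

namespace Params

variable [CompleteSpace H] (P : Params ι H)

theorem q_idem : P.q * P.q = P.q := P.q_proj.isIdempotentElem

theorem exists_vec : ∃ v : H, P.q = InnerProductSpace.rankOne ℂ v v := by
  by_cases hq : P.q = 0
  · exact ⟨0, by rw [hq]; simp⟩
  obtain ⟨u, hu⟩ : ∃ u, P.q u ≠ 0 := by
    by_contra! h
    exact hq (by ext u; simpa using h u)
  set w := P.q u with hw
  have hqq : ∀ z, P.q (P.q z) = P.q z := fun z => congrArg (fun a => a z) P.q_idem
  have hqw : P.q w = w := hqq u
  have hsa : ∀ y z, ⟪P.q y, z⟫_ℂ = ⟪y, P.q z⟫_ℂ := fun y z => by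
    have := P.q_proj.isSelfAdjoint
    rw [ContinuousLinearMap.isSelfAdjoint_iff'] at this
    conv_lhs => rw [← this]
    exact ContinuousLinearMap.adjoint_inner_left _ _ _
  have hn : (‖w‖ : ℂ) ≠ 0 := by simpa using hu
  have hline : ∀ z, P.q z = ((‖w‖ : ℂ) ^ 2)⁻¹ • ⟪w, z⟫_ℂ • w := by
    intro z
    obtain ⟨c, hc⟩ := P.q_minimal (InnerProductSpace.rankOne ℂ z w)
    have h1 := congrArg (fun a => a w) hc
    simp only [mul_apply_eq_comp, hqw, InnerProductSpace.rankOne_apply,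
      map_smul, smul_apply, inner_self_eq_norm_sq_to_K, Complex.coe_algebraMap] at h1
    have h2 : P.q z = (((‖w‖ : ℂ) ^ 2)⁻¹ * c) • w := by
      rw [mul_smul, ← h1, smul_smul, inv_mul_cancel₀ (pow_ne_zero 2 hn), one_smul]
    have h3 : ⟪w, z⟫_ℂ = c := by
      rw [← hqw, hsa, h2, inner_smul_right, inner_self_eq_norm_sq_to_K]
      simp only [Complex.coe_algebraMap]
      field_simp
    rw [h2, h3, smul_smul]
  refine ⟨(‖w‖ : ℂ)⁻¹ • w, ?_⟩
  ext z
  rw [hline, InnerProductSpace.rankOne_apply, inner_smul_left, smul_smul, smul_smul]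
  congr 1
  simp
  ring

/-- The basis vector `b_l` lies in the range of `E_- = E([-1, 0[)`. -/
def neg (l : ι) : Prop := P.basis l ∈ spectralSubspace P.A (Set.Ico (-1) 0)

theorem q_neg {l : ι} (h : P.neg l) : P.q (P.basis l) = 0 := by
  have := congrArg (fun a => a (P.basis l)) P.cond_e
  simpa [spectralProj, Submodule.starProjection_eq_self_iff.2 h] using this

theorem neg_orthogonal {v : H} (hv : P.q = InnerProductSpace.rankOne ℂ v v) (l : ι)
    (h : P.neg l) : ⟪P.basis l, v⟫_ℂ = 0 := by
  have h1 := P.q_neg h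
  rw [hv, InnerProductSpace.rankOne_apply, smul_eq_zero] at h1
  rcases h1 with h1 | h1
  · rw [← inner_conj_symm, h1]; simp
  · simp [h1]

/-- The homomorphism `T` from `R_∞` to `B(H)^{⊗ ∞}`. -/
def T : RInf →* localAlg ι where
  toFun r := ⟨T0 P.basis P.neg P.q r, T0_mem _ _ _ r⟩
  map_one' := by
    obtain ⟨v, hv⟩ := P.exists_vec
    exact Subtype.ext (T0_one _ _ hv P.q_idem (P.neg_orthogonal hv))
  map_mul' r r' := by
    obtain ⟨v, hv⟩ := P.exists_vec
    exact Subtype.ext (T0_mul _ _ hv P.q_idem (P.neg_orthogonal hv) r r')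

/-- The operator `U_{E_-}^{(k, k+1)}`. -/
def U (k : ℕ) : L2 (ℕ → ι) →L[ℂ] L2 (ℕ → ι) :=
  let E := spectralProj P.A (Set.Ico (-1) 0)
  siteOp P.basis k (1 - E) * siteOp P.basis (k + 1) (1 - E) +
    siteOp P.basis k E * siteOp P.basis (k + 1) (1 - E) +
    siteOp P.basis k (1 - E) * siteOp P.basis (k + 1) E -
    siteOp P.basis k E * siteOp P.basis (k + 1) E

variable (ι) in
/-- The operator `∑_{ij} e_{ij}^{(k)} e_{ji}^{(k+1)}`, which interchanges two tensor factors. -/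
def flipOp (k : ℕ) : L2 (ℕ → ι) →L[ℂ] L2 (ℕ → ι) := permOp (Equiv.swap k (k + 1)) 1

theorem basis_eigen (l : ι) : P.A (P.basis l) = ⟪P.basis l, P.A (P.basis l)⟫_ℂ • P.basis l := by
  have := congrArg (fun a => a (P.basis l)) (P.basis_comm l)
  simpa [matUnit, InnerProductSpace.rankOne_apply,
    inner_self_eq_norm_sq_to_K, P.basis.orthonormal.1 l] using this

theorem spectralProj_basis (l : ι) [Decidable (P.neg l)] :
    spectralProj P.A (Set.Ico (-1) 0) (P.basis l) = if P.neg l then P.basis l else 0 := by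
  split_ifs with h
  · exact Submodule.starProjection_eq_self_iff.2 h
  rw [spectralProj, Submodule.starProjection_apply_eq_zero_iff, spectralSubspace,
    Submodule.orthogonal_closure]
  set c := ⟪P.basis l, P.A (P.basis l)⟫_ℂ with hc
  have hsymm : (P.A : H →ₗ[ℂ] H).IsSymmetric :=
    ContinuousLinearMap.isSelfAdjoint_iff_isSymmetric.1 P.selfAdjoint
  have hmem : P.basis l ∈ Module.End.eigenspace (P.A : H →ₗ[ℂ] H) c :=
    Module.End.mem_eigenspace_iff.2 (P.basis_eigen l)
  rw [Submodule.mem_orthogonal]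
  intro u hu
  refine Submodule.iSup_induction' (motive := fun u _ => ⟪u, P.basis l⟫_ℂ = 0) _ ?_ ?_ ?_ hu
  · intro μ u hu
    by_cases hμ : μ ∈ Set.Ico (-1 : ℝ) 0
    · rw [iSup_pos hμ] at hu
      by_cases hcμ : (μ : ℂ) = c
      · refine absurd (Submodule.le_topologicalClosure _ ?_) h
        refine Submodule.mem_iSup_of_mem μ ?_
        rw [iSup_pos hμ, hcμ]
        exact hmem
      · exact hsymm.orthogonalFamily_eigenspaces hcμ ⟨u, hu⟩ ⟨_, hmem⟩
    · rw [iSup_neg hμ, Submodule.mem_bot] at hu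
      simp [hu]
  · simp
  · intro x y _ _ hx hy
    rw [inner_add_left, hx, hy, add_zero]

theorem siteOp_spectralProj (k : ℕ) (f : L2 (ℕ → ι)) (x : ℕ → ι) [Decidable (P.neg (x k))] :
    siteOp P.basis k (spectralProj P.A (Set.Ico (-1) 0)) f x = if P.neg (x k) then f x else 0 := by
  rw [siteOp_apply, spectralProj, ← Submodule.inner_starProjection_left_eq_right, ← spectralProj,
    P.spectralProj_basis]
  split_ifs with h
  · rw [← HilbertBasis.repr_apply_apply, LinearIsometryEquiv.apply_symm_apply, slice_apply]
    simp
  · simp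

theorem siteOp_sub_spectralProj (k : ℕ) (f : L2 (ℕ → ι)) (x : ℕ → ι) [Decidable (P.neg (x k))] :
    siteOp P.basis k (1 - spectralProj P.A (Set.Ico (-1) 0)) f x =
      if P.neg (x k) then 0 else f x := by
  have h1 : siteOp P.basis k (1 - spectralProj P.A (Set.Ico (-1) 0)) f x =
      f x - siteOp P.basis k (spectralProj P.A (Set.Ico (-1) 0)) f x := by
    rw [siteOp_apply, siteOp_apply, sub_apply, inner_sub_right, one_apply_eq_self,
      ← HilbertBasis.repr_apply_apply, LinearIsometryEquiv.apply_symm_apply, slice_apply]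
    simp
  rw [h1, siteOp_spectralProj]
  split_ifs <;> simp

/-- The values of `T` on the generators `(k k+1)` of `𝔖_∞`. -/
theorem T_swap (k : ℕ) : (P.T (RInf.swap k (k + 1)) : L2 (ℕ → ι) →L[ℂ] L2 (ℕ → ι)) =
    P.U k * flipOp ι k := by
  classical
  obtain ⟨v, hv⟩ := P.exists_vec
  change T0 P.basis P.neg P.q (RInf.swap k (k + 1)) = _
  rw [T0_eq _ _ hv P.q_idem (P.neg_orthogonal hv) _ (Equiv.swap k (k + 1)) (RInf.finite_swap _ _)
    (by simp [RInf.swap, RInf.ofPerm, Equiv.toPEquiv_apply])]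
  have hU : (RInf.swap k (k + 1)).undef = ∅ := by
    ext i; simp [RInf.mem_undef, RInf.swap, RInf.ofPerm, Equiv.toPEquiv_apply]
  rw [hU, siteProd_empty, mul_one]
  ext f x
  have hsgn : invSign (Equiv.swap k (k + 1)) {i | P.neg ((x ∘ Equiv.swap k (k + 1)) i)} =
      if P.neg (x k) ∧ P.neg (x (k + 1)) then -1 else 1 := by
    have hn : ∀ i, k + 2 ≤ i → Equiv.swap k (k + 1) i = i := fun i hi =>
      Equiv.swap_apply_of_ne_of_ne (by omega) (by omega)
    rw [invSign_eq_prod hn, Finset.prod_eq_single (k, k + 1)]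
    · simp [and_comm]
    · intro p hp hne
      rw [mem_pairs] at hp
      refine if_neg fun h => ?_
      have h1 := h.1
      rw [Equiv.swap_apply_def, Equiv.swap_apply_def] at h1
      have : p.1 ≠ k ∨ p.2 ≠ k + 1 := by
        by_contra! hc
        exact hne (Prod.ext hc.1 hc.2)
      split_ifs at h1 <;> omega
    · intro h
      exact absurd (mem_pairs.2 ⟨by simp, by simp⟩) h
  have hflip : flipOp ι k f x = f (x ∘ Equiv.swap k (k + 1)) := by
    rw [flipOp, permOp_apply]; simp
  have hR : (P.U k * flipOp ι k) f x = (if P.neg (x k) ∧ P.neg (x (k + 1)) then -1 else 1) *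
      flipOp ι k f x := by
    simp only [U, mul_apply_eq_comp, add_apply, sub_apply, lp.coeFn_add, lp.coeFn_sub,
      Pi.add_apply, Pi.sub_apply, siteOp_spectralProj, siteOp_sub_spectralProj]
    by_cases h1 : P.neg (x k) <;> by_cases h2 : P.neg (x (k + 1)) <;> simp [h1, h2]
  rw [hR, hflip, signedPerm, permOp_apply, hsgn]
  split_ifs <;> simp

/-- `T(ε_{k}) = q^{(k)}`. -/
theorem T_eps (k : ℕ) : (P.T (RInf.eps k) : L2 (ℕ → ι) →L[ℂ] L2 (ℕ → ι)) =
    siteOp P.basis k P.q := by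
  obtain ⟨v, hv⟩ := P.exists_vec
  change T0 P.basis P.neg P.q (RInf.eps k) = _
  have hmap : ∀ i, (RInf.eps k).map i = if i = k then none else some i := by
    intro i
    simp only [RInf.eps, PEquiv.ofSet, PEquiv.coe_mk]
    by_cases h : i = k <;> simp [h]
  rw [T0_eq _ _ hv P.q_idem (P.neg_orthogonal hv) _ 1 (by simp) (by
    intro i j h
    rw [hmap] at h
    split_ifs at h
    simpa using h), signedPerm_one, one_mul]
  have hU : (RInf.eps k).undef = {k} := by
    ext i; simp [RInf.mem_undef, hmap]
  rw [hU]
  exact Finset.noncommProd_singleton _ _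

/-! ### The product state and the Hilbert space -/

/-- `Tr|A|` as a real number. -/
def traceAbs : ℝ := (posTrace P.basis (CFC.abs P.A)).toReal

/-- The density operator `|A| + (1 - Tr|A|) e_{n_k n_k}` of the state `ψ_k` on `B(H)`. -/
def density (k : ℕ) : H →L[ℂ] H :=
  CFC.abs P.A + ((1 - P.traceAbs : ℝ) : ℂ) • matUnit P.basis (P.reg k) (P.reg k)

/-- The state `ψ_k` on `B(H)`: `ψ_k(b) = Tr(b |A|) + (1 - Tr|A|) Tr(b e_{n_k n_k})`. -/
def siteState (k : ℕ) (a : H →L[ℂ] H) : ℂ :=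
  ∑' l, ⟪P.basis l, a (P.density k (P.basis l))⟫_ℂ

/-- The diagonal entries of the density operator of `ψ_k`; this operator is diagonal, since the
basis consists of eigenvectors of `A`. -/
def weight (k : ℕ) (l : ι) : ℝ := (⟪P.basis l, P.density k (P.basis l)⟫_ℂ).re

/-- The probability measure on `ι` (with the discrete σ-algebra) given by the weights of `ψ_k`. -/
def siteMeasure (k : ℕ) : @MeasureTheory.Measure ι ⊤ :=
  letI : MeasurableSpace ι := ⊤
  MeasureTheory.Measure.sum fun l => ENNReal.ofReal (P.weight k l) • MeasureTheory.Measure.dirac l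

theorem abs_re_nonneg (l : ι) : 0 ≤ (⟪P.basis l, CFC.abs P.A (P.basis l)⟫_ℂ).re := by
  have h : (0 : H →L[ℂ] H) ≤ CFC.abs P.A := CFC.abs_nonneg _
  rw [ContinuousLinearMap.nonneg_iff_isPositive] at h
  exact h.re_inner_nonneg_right (P.basis l)

theorem traceAbs_le : P.traceAbs ≤ 1 :=
  ENNReal.toReal_le_of_le_ofReal zero_le_one (by simpa using P.cond_a)

theorem ofReal_traceAbs : ENNReal.ofReal P.traceAbs = posTrace P.basis (CFC.abs P.A) :=
  ENNReal.ofReal_toReal (P.cond_a.trans_lt ENNReal.one_lt_top).ne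

open scoped Classical in
theorem weight_eq (k : ℕ) (l : ι) : P.weight k l =
    (⟪P.basis l, CFC.abs P.A (P.basis l)⟫_ℂ).re + if l = P.reg k then 1 - P.traceAbs else 0 := by
  have h := (orthonormal_iff_ite.1 P.basis.orthonormal) l (P.reg k)
  have h' := (orthonormal_iff_ite.1 P.basis.orthonormal) (P.reg k) l
  simp only [weight, density, add_apply, smul_apply, matUnit, InnerProductSpace.rankOne_apply,
    inner_add_right, inner_smul_right, h, h', eq_comm (a := P.reg k)]
  split_ifs <;> simp

theorem weight_nonneg (k : ℕ) (l : ι) : 0 ≤ P.weight k l := by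
  classical
  rw [weight_eq]
  have := P.abs_re_nonneg l
  have := P.traceAbs_le
  split_ifs <;> linarith

theorem tsum_weight (k : ℕ) : ∑' l, ENNReal.ofReal (P.weight k l) = 1 := by
  classical
  have h : ∀ l, ENNReal.ofReal (P.weight k l) =
      ENNReal.ofReal (⟪P.basis l, CFC.abs P.A (P.basis l)⟫_ℂ).re +
        if l = P.reg k then ENNReal.ofReal (1 - P.traceAbs) else 0 := by
    intro l
    rw [weight_eq, ENNReal.ofReal_add (P.abs_re_nonneg l)]
    · split_ifs <;> simp
    · have := P.traceAbs_le
      split_ifs <;> linarith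
  simp_rw [h]
  rw [ENNReal.tsum_add, tsum_ite_eq, ← posTrace, ← P.ofReal_traceAbs, ← ENNReal.ofReal_add]
  · simp
  · exact ENNReal.toReal_nonneg
  · linarith [P.traceAbs_le]

instance (k : ℕ) : @MeasureTheory.IsProbabilityMeasure ι ⊤ (P.siteMeasure k) :=
  letI : MeasurableSpace ι := ⊤
  ⟨by simp [siteMeasure, P.tsum_weight k]⟩

/-- The σ-algebra of the infinite product of discrete spaces. -/
abbrev seqMeasurableSpace (ι : Type*) : MeasurableSpace (ℕ → ι) :=
  @MeasurableSpace.pi ℕ (fun _ => ι) fun _ => ⊤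

attribute [local instance] seqMeasurableSpace

/-- The product measure on `ι^ℕ`. -/
def prodMeasure : @MeasureTheory.Measure (ℕ → ι) (seqMeasurableSpace ι) :=
  letI : MeasurableSpace ι := ⊤
  MeasureTheory.Measure.infinitePi P.siteMeasure

instance : @MeasureTheory.IsProbabilityMeasure (ℕ → ι) (seqMeasurableSpace ι) P.prodMeasure :=
  letI : MeasurableSpace ι := ⊤
  inferInstanceAs (MeasureTheory.IsProbabilityMeasure (MeasureTheory.Measure.infinitePi _))

/-- The product state `ψ_0 ⊗ ψ_1 ⊗ ⋯` on `B(H)^{⊗ ∞}`.  As the density operators of all `ψ_k` are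
diagonal, on `B(H)^{⊗ n}` its value at `a` is the sum over `x ∈ ιⁿ` of
`∏_{k < n} weight k (x_k) · ⟨e_x, a e_x⟩`, which is an integral over the product measure. -/
def prodState (a : localAlg ι) : ℂ := ∫ x, coeff a.1 x x ∂P.prodMeasure

theorem norm_coeff_le (a : L2 X →L[ℂ] L2 X) (x y : X) : ‖coeff a x y‖ ≤ ‖a‖ := by
  rw [coeff_eq_inner]
  refine (norm_inner_le_norm _ _).trans ?_
  rw [norm_e, one_mul]
  simpa [norm_e] using a.le_opNorm (e y)

theorem measurable_coeff [Countable ι] (hι : Nonempty ι) (a : localAlg ι) :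
    @Measurable _ _ (seqMeasurableSpace ι) _
      fun x => coeff a.1 x x := by
  let _ : MeasurableSpace ι := ⊤
  obtain ⟨n, hn⟩ := a.2
  let ext : (Fin n → ι) → ℕ → ι := fun h k => if hk : k < n then h ⟨k, hk⟩ else hι.some
  have : (fun x => coeff a.1 x x) =
      (fun h : Fin n → ι => coeff a.1 (ext h) (ext h)) ∘
        fun x i => x i := by
    ext x
    refine hn.2 _ _ _ _ (fun k hk => ?_) (by simp)
    simp [ext, hk]
  rw [this]
  exact (measurable_of_countable _).comp (measurable_pi_lambda _ fun i => measurable_pi_apply _)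

theorem integrable_coeff [Countable ι] (a : localAlg ι) :
    MeasureTheory.Integrable (fun x => coeff a.1 x x)
      P.prodMeasure :=
  MeasureTheory.Integrable.of_bound (measurable_coeff ⟨P.reg 0⟩ a).aestronglyMeasurable
    ‖a.1‖ (Filter.Eventually.of_forall fun x => norm_coeff_le _ x x)

theorem coeff_star_mul (a c : L2 X →L[ℂ] L2 X) (x : X) :
    coeff (star a * c) x x = ⟪a (e x), c (e x)⟫_ℂ := by
  rw [coeff_eq_inner, ContinuousLinearMap.star_eq_adjoint, mul_apply_eq_comp,
    ContinuousLinearMap.adjoint_inner_right]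

theorem coeff_star_mul_self (a : L2 X →L[ℂ] L2 X) (x : X) :
    coeff (star a * a) x x = ((‖a (e x)‖ ^ 2 : ℝ) : ℂ) := by
  rw [coeff_star_mul, inner_self_eq_norm_sq_to_K]
  simp

theorem prodState_star_mul_self (a : localAlg ι) :
    P.prodState (star a * a) =
      ((∫ x, ‖a.1 (e x)‖ ^ 2 ∂P.prodMeasure : ℝ) : ℂ) := by
  rw [← integral_complex_ofReal]
  exact MeasureTheory.integral_congr_ae (Filter.Eventually.of_forall fun x =>
    coeff_star_mul_self _ x)

theorem integrable_norm_sq [Countable ι] (a : localAlg ι) :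
    MeasureTheory.Integrable (fun x => ‖a.1 (e x)‖ ^ 2)
      P.prodMeasure := by
  refine (P.integrable_coeff (star a * a)).re.congr (Filter.Eventually.of_forall fun x => ?_)
  change RCLike.re (coeff (star a.1 * a.1) x x) = _
  rw [coeff_star_mul_self]
  exact Complex.ofReal_re _

theorem density_basis (k : ℕ) (l : ι) :
    P.density k (P.basis l) = (P.weight k l : ℂ) • P.basis l := by
  classical
  have hstar : star (matUnit P.basis l l) = matUnit P.basis l l := by
    rw [matUnit, ContinuousLinearMap.star_eq_adjoint, InnerProductSpace.adjoint_rankOne]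
  have hc : Commute P.A (matUnit P.basis l l) := P.basis_comm l
  have habs := congrArg (fun a => a (P.basis l)) (hc.cfcAbs_left (by rw [hstar]; exact hc)).eq
  have h1 : CFC.abs P.A (P.basis l) =
      ⟪P.basis l, CFC.abs P.A (P.basis l)⟫_ℂ • P.basis l := by
    simpa [matUnit, InnerProductSpace.rankOne_apply, inner_self_eq_norm_sq_to_K,
      P.basis.orthonormal.1 l] using habs
  have h2 : ((⟪P.basis l, CFC.abs P.A (P.basis l)⟫_ℂ).re : ℂ) =
      ⟪P.basis l, CFC.abs P.A (P.basis l)⟫_ℂ := by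
    have h : (0 : H →L[ℂ] H) ≤ CFC.abs P.A := CFC.abs_nonneg _
    rw [ContinuousLinearMap.nonneg_iff_isPositive] at h
    exact (Complex.nonneg_iff.1 (h.inner_nonneg_right (P.basis l))) |> fun h =>
      Complex.ext (by simp) (by simpa using h.2)
  rw [weight_eq, density, add_apply, smul_apply, matUnit, InnerProductSpace.rankOne_apply,
    (orthonormal_iff_ite.1 P.basis.orthonormal) (P.reg k) l]
  push_cast
  rw [h2, add_smul, ← h1]
  congr 1
  by_cases h : l = P.reg k
  · simp [h]
  · simp [h, Ne.symm h]

theorem siteState_eq_integral (k : ℕ) [Countable ι] (a : H →L[ℂ] H) :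
    P.siteState k a = ∫ l, ⟪P.basis l, a (P.basis l)⟫_ℂ ∂(P.siteMeasure k) := by
  let _ : MeasurableSpace ι := ⊤
  have hint : MeasureTheory.Integrable (fun l => ⟪P.basis l, a (P.basis l)⟫_ℂ) (P.siteMeasure k) := by
    refine MeasureTheory.Integrable.of_bound (measurable_of_countable _).aestronglyMeasurable ‖a‖
      (Filter.Eventually.of_forall fun l => ?_)
    refine (norm_inner_le_norm _ _).trans ?_
    rw [P.basis.orthonormal.1 l, one_mul]
    simpa [P.basis.orthonormal.1 l] using a.le_opNorm (P.basis l)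
  rw [siteState, siteMeasure, ← (MeasureTheory.hasSum_integral_measure hint).tsum_eq]
  refine tsum_congr fun l => ?_
  rw [MeasureTheory.integral_smul_measure, MeasureTheory.integral_dirac, density_basis,
    ENNReal.toReal_ofReal (P.weight_nonneg k l), map_smul, inner_smul_right]
  rfl

open scoped Classical in
theorem coeff_prod (c : ℕ → H →L[ℂ] H) (n : ℕ) (x y : ℕ → ι) :
    coeff ((List.range n).map fun k => siteOp P.basis k (c k)).prod x y =
      if ∀ i, n ≤ i → x i = y i then
        ∏ k ∈ Finset.range n, ⟪P.basis (x k), c k (P.basis (y k))⟫_ℂ else 0 := by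
  induction n generalizing x y with
  | zero =>
    simp only [List.range_zero, List.map_nil, List.prod_nil, coeff_one, Finset.range_zero,
      Finset.prod_empty, zero_le, forall_const, funext_iff]
  | succ n ih =>
    rw [List.range_succ, List.map_append, List.prod_append, List.map_singleton, List.prod_singleton,
      coeff_mul, tsum_eq_single (Function.update y n (x n))]
    · rw [coeff_siteOp, if_pos (by intro i hi; simp [hi]), ih, Finset.prod_range_succ]
      by_cases h : ∀ i, n + 1 ≤ i → x i = y i
      · rw [if_pos h, if_pos]
        · congr 1
          · refine Finset.prod_congr rfl fun k hk => ?_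
            rw [Function.update_of_ne (Finset.mem_range.1 hk).ne]
          · simp
        · intro i hi
          by_cases hin : i = n
          · subst hin; simp
          · simp [hin, h i (by omega)]
      · rw [if_neg h, if_neg, zero_mul]
        intro hc
        exact h fun i hi => by simpa [show i ≠ n by omega] using hc i (by omega)
    · intro z hz
      rw [ih, coeff_siteOp]
      by_cases h1 : ∀ i, n ≤ i → x i = z i
      · by_cases h2 : ∀ i, i ≠ n → z i = y i
        · refine absurd ?_ hz
          ext i
          by_cases hin : i = n
          · subst hin; simp [h1 i le_rfl]
          · simp [hin, h2 i hin]
        · rw [if_neg h2, mul_zero]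
      · rw [if_neg h1, zero_mul]

/-- The value of the product state at `c₀ ⊗ ⋯ ⊗ c_{n-1}` is `ψ_0(c₀) ⋯ ψ_{n-1}(c_{n-1})`. -/
theorem prodState_prod [Countable ι] (c : ℕ → H →L[ℂ] H) (n : ℕ) :
    P.prodState ((List.range n).map fun k => ⟨siteOp P.basis k (c k), siteOp_mem _ _ _⟩).prod =
      ∏ k ∈ Finset.range n, P.siteState k (c k) := by
  classical
  let _ : MeasurableSpace ι := ⊤
  have h1 : ∀ x, coeff (((List.range n).map fun k =>
      (⟨siteOp P.basis k (c k), siteOp_mem _ _ _⟩ : localAlg ι)).prod).1 x x =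
      ∏ k : Finset.range n, ⟪P.basis (((Finset.range n).restrict x) k),
        c k (P.basis (((Finset.range n).restrict x) k))⟫_ℂ := by
    intro x
    have : (((List.range n).map fun k =>
      (⟨siteOp P.basis k (c k), siteOp_mem _ _ _⟩ : localAlg ι)).prod).1 =
        ((List.range n).map fun k => siteOp P.basis k (c k)).prod := by
      change (localAlg ι).subtype _ = _
      rw [map_list_prod, List.map_map]
      rfl
    rw [this, coeff_prod, if_pos (by simp), ← Finset.prod_coe_sort]
    rfl
  rw [prodState]
  simp_rw [h1]
  refine (MeasureTheory.integral_restrict_infinitePi (μ := P.siteMeasure) (s := Finset.range n)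
    (f := fun y => ∏ k, ⟪P.basis (y k), c k (P.basis (y k))⟫_ℂ)
    (measurable_of_countable _).aestronglyMeasurable).trans ?_
  rw [MeasureTheory.integral_fintype_prod_eq_prod (f := fun (k : Finset.range n) l =>
      ⟪P.basis l, c k (P.basis l)⟫_ℂ)]
  simp_rw [siteState_eq_integral]
  exact Finset.prod_coe_sort (Finset.range n)
    fun k => ∫ l, ⟪P.basis l, c k (P.basis l)⟫_ℂ ∂(P.siteMeasure k)

/-- `B(H)^{⊗ ∞}` with the scalar product `(v, u) = ψ(u⋆ v)` of the product state. -/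
def PreSpace (_ : Params ι H) : Type _ := localAlg ι

instance : AddCommGroup P.PreSpace := inferInstanceAs (AddCommGroup (localAlg ι))
instance : Module ℂ P.PreSpace := inferInstanceAs (Module ℂ (localAlg ι))

def toPre : localAlg ι ≃ₗ[ℂ] P.PreSpace := LinearEquiv.refl ℂ _

def ofPre : P.PreSpace ≃ₗ[ℂ] localAlg ι := P.toPre.symm

variable [Countable ι]

abbrev preCore : PreInnerProductSpace.Core ℂ P.PreSpace where
  inner u v := P.prodState (star (P.ofPre u) * P.ofPre v)
  conj_inner_symm u v := by
    rw [prodState, prodState, ← integral_conj]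
    refine MeasureTheory.integral_congr_ae (Filter.Eventually.of_forall fun x => ?_)
    change star (coeff (star (P.ofPre v).1 * (P.ofPre u).1) x x) =
      coeff (star (P.ofPre u).1 * (P.ofPre v).1) x x
    rw [← coeff_star]
    simp
  re_inner_nonneg u := by
    rw [prodState_star_mul_self]
    simp only [RCLike.re_to_complex, Complex.ofReal_re]
    exact MeasureTheory.integral_nonneg fun x => by positivity
  add_left u v w := by
    rw [map_add, star_add, add_mul, prodState, prodState, prodState,
      ← MeasureTheory.integral_add (P.integrable_coeff _) (P.integrable_coeff _)]
    rfl
  smul_left u v c := by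
    rw [map_smul, star_smul, smul_mul_assoc, prodState, prodState]
    exact MeasureTheory.integral_const_mul (μ := P.prodMeasure) _ _

instance : SeminormedAddCommGroup P.PreSpace :=
  InnerProductSpace.Core.toSeminormedAddCommGroup (c := P.preCore)
instance : InnerProductSpace ℂ P.PreSpace := InnerProductSpace.ofCore P.preCore

theorem pre_inner (u v : P.PreSpace) :
    ⟪u, v⟫_ℂ = P.prodState (star (P.ofPre u) * P.ofPre v) := rfl

theorem pre_norm_sq (u : P.PreSpace) : ‖u‖ ^ 2 =
    ∫ x, ‖(P.ofPre u).1 (e x)‖ ^ 2 ∂P.prodMeasure := by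
  have h := inner_self_eq_norm_sq_to_K (𝕜 := ℂ) u
  rw [pre_inner, prodState_star_mul_self] at h
  exact Complex.ofReal_injective (by simpa using h.symm)

/-- The Hilbert space `𝓗_A^q`: the completion of `B(H)^{⊗ ∞}`. -/
abbrev Space : Type _ := UniformSpace.Completion P.PreSpace

/-- Left multiplication by `a` on `B(H)^{⊗ ∞}`. -/
def leftMul (a : localAlg ι) : P.PreSpace →L[ℂ] P.PreSpace :=
  (P.toPre.toLinearMap ∘ₗ LinearMap.mulLeft ℂ a ∘ₗ P.ofPre.toLinearMap).mkContinuous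
    ‖a.1‖ fun u => by
      rw [← sq_le_sq₀ (by positivity) (by positivity), mul_pow, pre_norm_sq, pre_norm_sq,
        ← MeasureTheory.integral_const_mul]
      refine MeasureTheory.integral_mono (P.integrable_norm_sq _)
        ((P.integrable_norm_sq _).const_mul _) fun x => ?_
      rw [← mul_pow]
      exact pow_le_pow_left₀ (norm_nonneg _) (a.1.le_opNorm ((P.ofPre u).1 (e x))) 2

theorem leftMul_apply (a : localAlg ι) (u : P.PreSpace) :
    P.leftMul a u = P.toPre (a * P.ofPre u) := rfl

/-- The `⋆`-representation `𝔏_A` of `B(H)^{⊗ ∞}` on `𝓗_A^q` by left multiplication. -/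
def L : localAlg ι →⋆ₐ[ℂ] (P.Space →L[ℂ] P.Space) where
  toFun a := (P.leftMul a).completion
  map_one' := by
    ext u
    induction u using UniformSpace.Completion.induction_on with
    | hp => apply isClosed_eq <;> fun_prop
    | ih u => simp [leftMul_apply]; rfl
  map_mul' a c := by
    ext u
    induction u using UniformSpace.Completion.induction_on with
    | hp => apply isClosed_eq <;> fun_prop
    | ih u => simp [leftMul_apply, mul_assoc]; rfl
  map_zero' := by
    ext u
    induction u using UniformSpace.Completion.induction_on with
    | hp => apply isClosed_eq <;> fun_prop
    | ih u => simp [leftMul_apply]; rfl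
  map_add' a c := by
    ext u
    induction u using UniformSpace.Completion.induction_on with
    | hp => apply isClosed_eq <;> fun_prop
    | ih u => simp [leftMul_apply, add_mul, UniformSpace.Completion.coe_add]
  commutes' c := by
    ext u
    induction u using UniformSpace.Completion.induction_on with
    | hp => apply isClosed_eq <;> fun_prop
    | ih u =>
      simp [leftMul_apply, Algebra.algebraMap_eq_smul_one, ← UniformSpace.Completion.coe_smul]; rfl
  map_star' a := by
    refine (ContinuousLinearMap.eq_adjoint_iff (P.leftMul (star a)).completion
      (P.leftMul a).completion).mpr ?_
    intro u w
    induction u, w using UniformSpace.Completion.induction_on₂ with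
    | hp => apply isClosed_eq <;> fun_prop
    | ih u w =>
      simp only [ContinuousLinearMap.completion_apply_coe, UniformSpace.Completion.inner_coe,
        leftMul_apply, pre_inner]
      change P.prodState (star (star a * P.ofPre u) * P.ofPre w) =
        P.prodState (star (P.ofPre u) * (a * P.ofPre w))
      rw [star_mul, star_star, mul_assoc]

/-- The representation `Π_A` of `R_∞` on `𝓗_A^q`. -/
def Pi : RInf →* (P.Space →L[ℂ] P.Space) := (P.L : localAlg ι →* _).comp P.T

/-- The vector `ξ₀` of `𝓗_A^q` corresponding to the unit of `B(H)^{⊗ ∞}`. -/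
def xi : P.Space := (P.toPre 1 : P.PreSpace)

/-- The subspace `[Π_A(R_∞) ξ₀]`. -/
def cyclicSpace : Submodule ℂ P.Space :=
  (Submodule.span ℂ (Set.range fun r => P.Pi r P.xi)).topologicalClosure

theorem Pi_mem (r : RInf) {u : P.Space} (hu : u ∈ P.cyclicSpace) : P.Pi r u ∈ P.cyclicSpace := by
  have h : Set.MapsTo (P.Pi r) (Submodule.span ℂ (Set.range fun r => P.Pi r P.xi))
      (Submodule.span ℂ (Set.range fun r => P.Pi r P.xi)) := by
    intro u hu
    induction hu using Submodule.span_induction with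
    | mem u hu =>
      obtain ⟨r', rfl⟩ := hu
      refine Submodule.subset_span ⟨r * r', ?_⟩
      simp [map_mul]
    | zero => simp
    | add u w _ _ hu hw => rw [map_add]; exact add_mem hu hw
    | smul c u _ hu => rw [map_smul]; exact Submodule.smul_mem _ c hu
  exact h.closure (P.Pi r).continuous hu

/-- The representation `π_A^{(0)}`: the restriction of `Π_A` to `[Π_A(R_∞) ξ₀]`. -/
def pi0 : RInf →* (P.cyclicSpace →L[ℂ] P.cyclicSpace) where
  toFun r := ((P.Pi r).comp P.cyclicSpace.subtypeL).codRestrict P.cyclicSpace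
    fun u => P.Pi_mem r u.2
  map_one' := by ext u; simp
  map_mul' r r' := by ext u; simp; rfl

/-- `ξ₀` as a vector of `[Π_A(R_∞) ξ₀]`. -/
def xi0 : P.cyclicSpace :=
  ⟨P.xi, Submodule.le_topologicalClosure _ (Submodule.subset_span ⟨1, by simp⟩)⟩

end Params

/-- `ξ` is cyclic for the set `M` of bounded operators on `K`: the closed linear span of
`{B ξ : B ∈ M}` is the whole space. -/
def IsCyclicFor {K : Type*} [NormedAddCommGroup K] [InnerProductSpace ℂ K]
    (M : Set (K →L[ℂ] K)) (ξ : K) : Prop :=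
  (Submodule.span ℂ {w | ∃ B ∈ M, w = B ξ}).topologicalClosure = ⊤

end

end InfTensor

namespace InfTensor

noncomputable section

/-! ### Product measures -/

section measure

open MeasureTheory

variable {X : Type*} [MeasurableSpace X] (ν : ℕ → Measure X) [∀ k, IsProbabilityMeasure (ν k)]

/-! Write `q = ⟨v, ·⟩ v`, and number the tensor factors from 0. Everything depends on how `v` sits
relative to the eigenbasis `b_l` of `A`. If `(Ker A)^⊥ = H̃`, then `v` is orthogonal to every `b_l`
in `Ker A` (`inner_eq_zero_of_eq`). If the two spaces differ, `v` has nonzero components both inside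
and outside `Ker A` (`exists_of_ne`).

Necessity (`eq_of_isCyclicFor`). The transpositions `(0 n)` converge weakly to `A^{(0)}`
(`tendsto_inner_swap`): averaging the `n`-th factor over `ψ_n` leaves its density operator
multiplied by the sign of `A`, which is `A` plus a multiple of the projection onto the `n`-th
regular basis vector, and this last term tends weakly to zero. Hence, on the cyclic space, products
of `q^{(0)}` and powers of `A^{(0)}` commute with the commutant. The operators `(q (1 -
A²)^{2n})^{(0)}` tend to zero on `ξ₀`, because the state of factor 0 charges at most one basis
vector of `Ker A`, and `q` kills that one (`tendsto_oneSubSq_xi`). If `ξ₀` is cyclic for the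
commutant, this convergence spreads to the whole cyclic space. Yet on `q^{(0)} ξ₀` these operators
act as the scalar `‖(1 - A²)^n v‖²`, which is at least `|⟨b_l, v⟩|²` for every `b_l` in `Ker A`; and
`q^{(0)} ξ₀ ≠ 0` once `v` has a component outside `Ker A`.

Sufficiency (`isCyclicFor_of_eq`). Right multiplications commute with `Π_A`. The one by
`e_{ij}^{(k)}` is bounded when `A b_i ≠ 0` (`exists_right_matUnit`), and `q` is a norm limit of
combinations of such `e_{ij}` when `v` has no component in `Ker A` (`siteProd_xi_mem`). Right
multiplication by `T(s)` is not adapted to the norm, since the states `ψ_k` differ in their regular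
vectors; conjugating by a permutation of these vectors repairs this and fixes every `T(r)`
(`exists_right_perm`). Thus each `Π_A(r) ξ₀` is a limit of combinations of vectors `R ξ₀`, with `R`
in the commutant of `Π_A(R_∞)` on the whole space. The projection onto the cyclic space intertwines
`Π_A` with `π_A^{(0)}`, so compressing each `R` gives an operator in the required commutant. -/

theorem measurable_update_pair (k : ℕ) :
    Measurable fun p : (ℕ → X) × X => Function.update p.1 k p.2 := by
  refine measurable_pi_lambda _ fun j => ?_
  by_cases hj : j = k
  · subst hj; simpa using measurable_snd
  · simp only [Function.update_of_ne hj]; fun_prop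

/-- Replacing one coordinate by an independent one with the same law preserves a product
measure. -/
theorem map_update_infinitePi (k : ℕ) :
    ((Measure.infinitePi ν).prod (ν k)).map (fun p => Function.update p.1 k p.2) =
      Measure.infinitePi ν := by
  classical
  refine Measure.eq_infinitePi ν fun s t ht => ?_
  rw [Measure.map_apply (measurable_update_pair k) (.pi s.countable_toSet fun _ _ => ht _)]
  have hpre : (fun p : (ℕ → X) × X => Function.update p.1 k p.2) ⁻¹' (s : Set ℕ).pi t =
      ((s.erase k : Finset ℕ) : Set ℕ).pi t ×ˢ (if k ∈ s then t k else Set.univ) := by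
    ext p
    simp only [Set.mem_preimage, Set.mem_pi, Finset.mem_coe, Set.mem_prod, Finset.mem_erase]
    constructor
    · intro h
      refine ⟨fun i hi => by simpa [hi.1] using h i hi.2, ?_⟩
      split_ifs with hk
      · simpa using h k hk
      · trivial
    · rintro ⟨h1, h2⟩ i hi
      by_cases hik : i = k
      · subst hik; simpa [hi] using h2
      · simpa [hik] using h1 i ⟨hik, hi⟩
  rw [hpre, Measure.prod_prod, Measure.infinitePi_pi _ fun i _ => ht i]
  split_ifs with hk
  · exact Finset.prod_erase_mul s (fun i => ν i (t i)) hk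
  · rw [Finset.erase_eq_of_notMem hk, measure_univ, mul_one]

theorem integrable_update {E : Type*} [NormedAddCommGroup E] (k : ℕ) {f : (ℕ → X) → E}
    (hf : Integrable f (Measure.infinitePi ν)) :
    Integrable (fun p : (ℕ → X) × X => f (Function.update p.1 k p.2))
      ((Measure.infinitePi ν).prod (ν k)) := by
  rw [← map_update_infinitePi ν k] at hf
  exact hf.comp_aemeasurable (measurable_update_pair k).aemeasurable

/-- Fubini after `map_update_infinitePi`: one coordinate may be integrated first with the others
frozen. This isolates the state of a single tensor factor inside the product state. -/
theorem integral_resample {E : Type*} [NormedAddCommGroup E] [NormedSpace ℝ E] (k : ℕ)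
    {f : (ℕ → X) → E} (hf : Integrable f (Measure.infinitePi ν)) :
    ∫ x, f x ∂Measure.infinitePi ν =
      ∫ x, ∫ l, f (Function.update x k l) ∂ν k ∂Measure.infinitePi ν := by
  have h := integral_prod _ (integrable_update ν k hf)
  rw [← h]
  conv_lhs => rw [← map_update_infinitePi ν k]
  rw [← map_update_infinitePi ν k] at hf
  exact integral_map (measurable_update_pair k).aemeasurable hf.aestronglyMeasurable

/-- A permutation of the coordinates, combined with a bijection of the values that carries each
factor to the corresponding one, preserves a product measure. -/
theorem map_relabel_infinitePi (s : Equiv.Perm ℕ) (w : X ≃ᵐ X)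
    (h : ∀ j, (ν (s j)).map w = ν j) :
    (Measure.infinitePi ν).map (fun x j => w (x (s j))) = Measure.infinitePi ν := by
  classical
  have hm : Measurable fun (x : ℕ → X) j => w (x (s j)) :=
    measurable_pi_lambda _ fun j => w.measurable.comp (measurable_pi_apply _)
  refine Measure.eq_infinitePi ν fun S t ht => ?_
  rw [Measure.map_apply hm (.pi S.countable_toSet fun _ _ => ht _)]
  have hpre : (fun (x : ℕ → X) j => w (x (s j))) ⁻¹' (S : Set ℕ).pi t =
      ((S.map s.toEmbedding : Finset ℕ) : Set ℕ).pi fun i => w ⁻¹' t (s.symm i) := by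
    ext x
    simp only [Set.mem_preimage, Set.mem_pi, Finset.mem_coe, Finset.mem_map_equiv]
    exact ⟨fun h i hi => by simpa using h _ hi, fun h i hi => by simpa using h (s i) (by simpa)⟩
  rw [hpre, Measure.infinitePi_pi _ fun i _ => w.measurable (ht _), Finset.prod_map]
  refine Finset.prod_congr rfl fun j _ => ?_
  rw [← h j, Measure.map_apply w.measurable (ht j)]
  simp

end measure

/-! ### Uniformly bounded sequences of operators -/

section bounded

open Filter Topology

variable {E F : Type*} [NormedAddCommGroup E] [NormedSpace ℂ E] [NormedAddCommGroup F]
  [NormedSpace ℂ F]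

/-- The uniform bound makes the maps equicontinuous, so an `ε/2` argument passes convergence to
limits of vectors. -/
theorem isClosed_tendsto_zero {f : ℕ → E →L[ℂ] F} {C : ℝ} (hC : ∀ n u, ‖f n u‖ ≤ C * ‖u‖) :
    IsClosed {u | Tendsto (fun n => f n u) atTop (𝓝 0)} := by
  -- Replacing `C` by `|C| + 1` allows division whatever the sign of `C`.
  have hC0 : 0 < |C| + 1 := by positivity
  refine isClosed_of_closure_subset fun u hu => ?_
  rw [Set.mem_ofPred_eq, Metric.tendsto_atTop]
  intro ε hε
  obtain ⟨w, hw, hd⟩ := Metric.mem_closure_iff.1 hu (ε / (2 * (|C| + 1))) (by positivity)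
  obtain ⟨N, hN⟩ := (Metric.tendsto_atTop.1 hw) (ε / 2) (by positivity)
  refine ⟨N, fun n hn => ?_⟩
  have h1 := hN n hn
  rw [dist_zero_right] at h1 ⊢
  have h2 : ‖f n (u - w)‖ ≤ (|C| + 1) * ‖u - w‖ :=
    (hC n _).trans (by gcongr; linarith [le_abs_self C])
  have h3 : (|C| + 1) * ‖u - w‖ < ε / 2 := by
    rw [dist_eq_norm] at hd
    calc (|C| + 1) * ‖u - w‖ < (|C| + 1) * (ε / (2 * (|C| + 1))) := by gcongr
      _ = ε / 2 := by field_simp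
  calc ‖f n u‖ = ‖f n (u - w) + f n w‖ := by rw [← map_add, sub_add_cancel]
    _ ≤ ‖f n (u - w)‖ + ‖f n w‖ := norm_add_le _ _
    _ < ε := by linarith

/-- A uniformly bounded sequence of operators tends to zero weakly if it does so on a dense
set. -/
theorem tendsto_inner_zero_of_dense {K : Type*} [NormedAddCommGroup K] [InnerProductSpace ℂ K]
    {f : ℕ → K →L[ℂ] K} {C : ℝ} (hC : ∀ n u, ‖f n u‖ ≤ C * ‖u‖) {S : Set K} (hS : Dense S)
    (h : ∀ u ∈ S, ∀ w ∈ S, Tendsto (fun n => ⟪w, f n u⟫_ℂ) atTop (𝓝 0)) (u w : K) :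
    Tendsto (fun n => ⟪w, f n u⟫_ℂ) atTop (𝓝 0) := by
  have hb : ∀ w n u, ‖⟪w, f n u⟫_ℂ‖ ≤ (‖w‖ * C) * ‖u‖ := fun w n u =>
    (norm_inner_le_norm _ _).trans (by rw [mul_assoc]; gcongr; exact hC n u)
  have h1 : ∀ w ∈ S, ∀ u, Tendsto (fun n => ⟪w, f n u⟫_ℂ) atTop (𝓝 0) := fun w hw u =>
    (isClosed_tendsto_zero (f := fun n => (innerSL ℂ w).comp (f n)) (C := ‖w‖ * C)
      (by simpa using hb w)).closure_subset_iff.2 (fun u hu => by simpa using h u hu w hw) (hS u)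
  have h2 : IsClosed {w | Tendsto (fun n => ⟪f n u, w⟫_ℂ) atTop (𝓝 0)} :=
    isClosed_tendsto_zero (f := fun n => innerSL ℂ (f n u)) (C := C * ‖u‖) fun n w => by
      simpa using (norm_inner_le_norm (𝕜 := ℂ) (f n u) w).trans (by gcongr; exact hC n u)
  have h3 : Tendsto (fun n => ⟪f n u, w⟫_ℂ) atTop (𝓝 0) :=
    h2.closure_subset_iff.2 (fun w hw => by
      have := (h1 w hw u).star
      simpa [inner_conj_symm] using this) (hS w)
  simpa [inner_conj_symm] using h3.star

end bounded

/-! ### More on operators acting on one tensor factor -/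

section siteOp

variable {ι H : Type*} [NormedAddCommGroup H] [InnerProductSpace ℂ H] (b : HilbertBasis ι ℂ H)

theorem siteOp_one (k : ℕ) : siteOp b k 1 = 1 := by
  ext f x
  rw [siteOp_apply, one_apply_eq_self, one_apply_eq_self, ← HilbertBasis.repr_apply_apply,
    LinearIsometryEquiv.apply_symm_apply, slice_apply, Function.update_eq_self]

theorem siteOp_add (k : ℕ) (a c : H →L[ℂ] H) :
    siteOp b k (a + c) = siteOp b k a + siteOp b k c := by
  ext f x
  change siteOp b k (a + c) f x = siteOp b k a f x + siteOp b k c f x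
  simp only [siteOp_apply, add_apply, inner_add_right]

theorem siteOp_smul (k : ℕ) (r : ℂ) (a : H →L[ℂ] H) :
    siteOp b k (r • a) = r • siteOp b k a := by
  ext f x
  change siteOp b k (r • a) f x = r * siteOp b k a f x
  simp only [siteOp_apply, smul_apply, inner_smul_right]

theorem norm_siteOp_le (k : ℕ) (a : H →L[ℂ] H) : ‖siteOp b k a‖ ≤ ‖a‖ :=
  LinearMap.mkContinuous_norm_le _ (norm_nonneg _) _

/-- `a ↦ a^{(k)}` as a linear map to the algebra of local operators. -/
def site (k : ℕ) : (H →L[ℂ] H) →ₗ[ℂ] localAlg ι where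
  toFun a := ⟨siteOp b k a, siteOp_mem b k a⟩
  map_add' a c := Subtype.ext (siteOp_add b k a c)
  map_smul' r a := Subtype.ext (siteOp_smul b k r a)

theorem site_one (k : ℕ) : site b k 1 = 1 := Subtype.ext (siteOp_one b k)

theorem site_mul (k : ℕ) (a c : H →L[ℂ] H) : site b k (a * c) = site b k a * site b k c :=
  Subtype.ext (siteOp_mul b k a c)

open scoped Classical in
theorem coeff_siteOp_diagonal_mul {k : ℕ} {D : H →L[ℂ] H} {d : ι → ℂ}
    (hD : ∀ l, D (b l) = d l • b l) (a : L2 (ℕ → ι) →L[ℂ] L2 (ℕ → ι)) (x y : ℕ → ι) :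
    coeff (siteOp b k D * a) x y = d (x k) * coeff a x y := by
  rw [coeff_mul, tsum_eq_single x]
  · rw [coeff_siteOp, if_pos fun _ _ => rfl, hD, inner_smul_right,
      inner_self_eq_norm_sq_to_K, b.orthonormal.1]
    simp
  · intro z hz
    rw [coeff_siteOp]
    split_ifs with h
    · have hk : x k ≠ z k := fun hk => hz <| by
        ext j
        by_cases hj : j = k
        · rw [hj, hk]
        · exact (h j hj).symm
      rw [hD, inner_smul_right, b.orthonormal.2 hk, mul_zero, zero_mul]
    · rw [zero_mul]

theorem norm_matUnit_le (i j : ι) : ‖matUnit b i j‖ ≤ 1 := by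
  rw [matUnit, InnerProductSpace.norm_rankOne, b.orthonormal.1, b.orthonormal.1, one_mul]

theorem matUnit_basis [DecidableEq ι] (i j l : ι) :
    matUnit b i j (b l) = if j = l then b i else 0 := by
  rw [matUnit, InnerProductSpace.rankOne_apply, orthonormal_iff_ite.1 b.orthonormal]
  split_ifs <;> simp

open scoped Classical in
/-- The matrix coefficients of `c D^{(k)} a` for a diagonal operator `D`, as a sum over the diagonal
matrix units. -/
theorem hasSum_coeff_diagonal {k : ℕ} {D : H →L[ℂ] H} {d : ι → ℂ}
    (hD : ∀ l, D (b l) = d l • b l) (c a : L2 (ℕ → ι) →L[ℂ] L2 (ℕ → ι)) (x y : ℕ → ι) :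
    HasSum (fun l => d l * coeff (c * (siteOp b k (matUnit b l l) * a)) x y)
      (coeff (c * (siteOp b k D * a)) x y) := by
  have h1 : HasSum (fun z => coeff c x z * (d (z k) * coeff a z y))
      (coeff (c * (siteOp b k D * a)) x y) := by
    have := hasSum_coeff c ((siteOp b k D * a) (e y)) x
    refine this.congr_fun fun z => ?_
    rw [← coeff_siteOp_diagonal_mul b hD, mul_comm]
    rfl
  -- Intermediate sequences `z` are grouped by their entry at `k`; the fibre over `l` is exactly the
  -- part selected by `e_{ll}^{(k)}`.
  refine (h1.tsum_fiberwise fun z => z k).congr_fun fun l => ?_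
  have hu : ∀ m, matUnit b l l (b m) = (if l = m then (1 : ℂ) else 0) • b m := fun m => by
    rw [matUnit_basis]
    split_ifs with h <;> simp [h]
  rw [tsum_subtype (f := fun z => coeff c x z * (d (z k) * coeff a z y)), coeff_mul,
    ← tsum_mul_left]
  refine tsum_congr fun z => ?_
  rw [coeff_siteOp_diagonal_mul b hu, Set.indicator_apply]
  by_cases h : z k = l
  · subst h; simp; ring
  · simp [h, Ne.symm h]

theorem siteOp_matUnit_e (k : ℕ) (i j : ι) (x : ℕ → ι) [Decidable (x k = j)] :
    siteOp b k (matUnit b i j) (e x) = if x k = j then e (Function.update x k i) else 0 := by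
  classical
  ext z
  change coeff (siteOp b k (matUnit b i j)) z x = _
  rw [coeff_siteOp, matUnit_basis]
  by_cases hj : x k = j
  · rw [if_pos hj, if_pos hj.symm]
    by_cases hz : z = Function.update x k i
    · subst hz
      rw [e_apply_self, if_pos fun l hl => by simp [hl]]
      simp [inner_self_eq_norm_sq_to_K, b.orthonormal.1]
    · rw [e_apply_ne hz]
      split_ifs with h
      · refine b.orthonormal.2 fun hc => hz ?_
        ext l
        by_cases hl : l = k
        · subst hl; simp [hc]
        · simp [hl, h l hl]
      · rfl
  · rw [if_neg hj, if_neg (Ne.symm hj)]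
    simp

end siteOp

/-! ### Relabelling the basis vectors in all tensor factors -/

section relabel

variable {ι : Type*}

/-- The unitary operator `e_x ↦ e_{w ∘ x}` on `ℓ²(ι^ℕ)`. -/
def relabelOp (w : Equiv.Perm ι) : L2 (ℕ → ι) →L[ℂ] L2 (ℕ → ι) :=
  let E : (ℕ → ι) ≃ (ℕ → ι) := (Equiv.refl ℕ).arrowCongr w.symm
  LinearMap.mkContinuous
    { toFun := fun f => ⟨fun x => f (w.symm ∘ x), memℓp_of_summable_sq
        ((E.summable_iff (f := fun x => ‖f x‖ ^ 2)).2 (summable_sq f))⟩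
      map_add' := fun f g => by ext x; rfl
      map_smul' := fun r f => by ext x; rfl }
    1 fun f => by
      rw [← sq_le_sq₀ (by positivity) (by positivity), one_mul, norm_sq_eq_tsum,
        norm_sq_eq_tsum f, ← E.tsum_eq (fun x => ‖f x‖ ^ 2)]
      exact le_rfl

theorem relabelOp_apply (w : Equiv.Perm ι) (f : L2 (ℕ → ι)) (x : ℕ → ι) :
    relabelOp w f x = f (w.symm ∘ x) := rfl

theorem relabelOp_mul_symm (w : Equiv.Perm ι) : relabelOp w * relabelOp w.symm = 1 := by
  ext f x
  have : w.symm.symm ∘ w.symm ∘ x = x := by ext; simp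
  change f (w.symm.symm ∘ w.symm ∘ x) = f x
  rw [this]

theorem relabelOp_symm_mul (w : Equiv.Perm ι) : relabelOp w.symm * relabelOp w = 1 :=
  relabelOp_mul_symm w.symm

theorem norm_relabelOp_apply (w : Equiv.Perm ι) (f : L2 (ℕ → ι)) : ‖relabelOp w f‖ = ‖f‖ := by
  let E : (ℕ → ι) ≃ (ℕ → ι) := (Equiv.refl ℕ).arrowCongr w.symm
  rw [← sq_eq_sq₀ (norm_nonneg _) (norm_nonneg _), norm_sq_eq_tsum, norm_sq_eq_tsum f,
    ← E.tsum_eq (fun x => ‖f x‖ ^ 2)]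
  rfl

theorem relabelOp_e (w : Equiv.Perm ι) (x : ℕ → ι) : relabelOp w (e x) = e (w ∘ x) := by
  ext z
  rw [relabelOp_apply]
  by_cases hz : z = w ∘ x
  · subst hz
    have : w.symm ∘ w ∘ x = x := by ext; simp
    rw [this, e_apply_self, e_apply_self]
  · rw [e_apply_ne hz, e_apply_ne]
    rintro rfl
    exact hz (by ext; simp)

theorem coeff_relabelOp_conj (w : Equiv.Perm ι) (a : L2 (ℕ → ι) →L[ℂ] L2 (ℕ → ι)) (x y : ℕ → ι) :
    coeff (relabelOp w * a * relabelOp w.symm) x y = coeff a (w.symm ∘ x) (w.symm ∘ y) := by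
  change relabelOp w (a (relabelOp w.symm (e y))) x = _
  rw [relabelOp_e, relabelOp_apply]
  rfl

theorem relabelOp_conj_mem (w : Equiv.Perm ι) {a : L2 (ℕ → ι) →L[ℂ] L2 (ℕ → ι)}
    (ha : a ∈ localAlg ι) : relabelOp w * a * relabelOp w.symm ∈ localAlg ι := by
  obtain ⟨n, h1, h2⟩ := ha
  refine ⟨n, fun x y ⟨k, hk, hne⟩ => ?_, fun x y x' y' h3 h4 => ?_⟩
  · rw [coeff_relabelOp_conj]
    exact h1 _ _ ⟨k, hk, by simpa using hne⟩
  · rw [coeff_relabelOp_conj, coeff_relabelOp_conj]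
    exact h2 _ _ _ _ (fun k hk => by simp [h3 k hk]) fun k hk => by simp [h4 k hk]

/-- Conjugation of local operators by `relabelOp w`. -/
def relabelConj (w : Equiv.Perm ι) : localAlg ι →ₗ[ℂ] localAlg ι where
  toFun a := ⟨relabelOp w * a.1 * relabelOp w.symm, relabelOp_conj_mem w a.2⟩
  map_add' a c := Subtype.ext (by simp [mul_add, add_mul])
  map_smul' r a := Subtype.ext (by simp)

theorem coe_relabelConj (w : Equiv.Perm ι) (a : localAlg ι) :
    (relabelConj w a : L2 (ℕ → ι) →L[ℂ] L2 (ℕ → ι)) = relabelOp w * a.1 * relabelOp w.symm := rfl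

theorem relabelConj_mul (w : Equiv.Perm ι) (a c : localAlg ι) :
    relabelConj w (a * c) = relabelConj w a * relabelConj w c := by
  refine Subtype.ext ?_
  simp only [coe_relabelConj, MulMemClass.coe_mul]
  rw [mul_assoc (relabelOp w * a.1), ← mul_assoc (relabelOp w.symm), ← mul_assoc (relabelOp w.symm),
    relabelOp_symm_mul, one_mul]
  simp only [mul_assoc]

theorem relabelConj_one (w : Equiv.Perm ι) : relabelConj w 1 = 1 :=
  Subtype.ext (by simp [coe_relabelConj, relabelOp_mul_symm])

/-- Relabelling acts on values and `s` on places, so only the sign could be affected, and the sign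
sees a label only through `neg`. -/
theorem relabelOp_conj_signedPerm {w : Equiv.Perm ι} {neg : ι → Prop}
    (hw : ∀ l, neg (w l) ↔ neg l) (s : Equiv.Perm ℕ) :
    relabelOp w * signedPerm neg s * relabelOp w.symm = signedPerm neg s := by
  ext f x
  change relabelOp w (signedPerm neg s (relabelOp w.symm f)) x = _
  rw [relabelOp_apply, signedPerm, permOp_apply, permOp_apply, relabelOp_apply]
  have h1 : w.symm.symm ∘ (w.symm ∘ x) ∘ s = x ∘ s := by ext; simp
  have h2 : ∀ i, neg (((w.symm ∘ x) ∘ s) i) ↔ neg ((x ∘ s) i) := fun i => by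
    rw [← hw]; simp
  simp only [h1, h2]

theorem relabelOp_conj_siteOp {H : Type*} [NormedAddCommGroup H] [InnerProductSpace ℂ H]
    (b : HilbertBasis ι ℂ H) {w : Equiv.Perm ι} {q : H →L[ℂ] H}
    (hw : ∀ l m, ⟪b (w l), q (b (w m))⟫_ℂ = ⟪b l, q (b m)⟫_ℂ) (k : ℕ) :
    relabelOp w * siteOp b k q * relabelOp w.symm = siteOp b k q := by
  classical
  refine ext_coeff fun x y => ?_
  rw [coeff_relabelOp_conj, coeff_siteOp, coeff_siteOp]
  refine if_congr (by simp) ?_ rfl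
  rw [← hw]
  simp

end relabel

/-! ### Adjoints -/

section adjoint

variable {ι : Type*}

theorem norm_signedPerm_apply (neg : ι → Prop) (s : Equiv.Perm ℕ) (f : L2 (ℕ → ι)) :
    ‖signedPerm neg s f‖ = ‖f‖ := by
  let E : (ℕ → ι) ≃ (ℕ → ι) := s.symm.arrowCongr (Equiv.refl ι)
  rw [← sq_eq_sq₀ (norm_nonneg _) (norm_nonneg _), norm_sq_eq_tsum, norm_sq_eq_tsum f,
    ← E.tsum_eq (fun x => ‖f x‖ ^ 2)]
  refine tsum_congr fun x => ?_
  rw [signedPerm, permOp_apply]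
  rcases Int.units_eq_one_or (invSign s {i | neg ((x ∘ s) i)}) with h | h <;>
    rw [h] <;> simp <;> rfl

/-- The cocycle rule `invSign_mul` for `s⁻¹ * s = 1` makes the two signs inverse to each other;
being `±1`, they coincide. -/
theorem signedPerm_star (neg : ι → Prop) {s : Equiv.Perm ℕ} (hs : {x | s x ≠ x}.Finite) :
    star (signedPerm neg s) = signedPerm neg s⁻¹ := by
  classical
  have key : ∀ (s : Equiv.Perm ℕ) x y, coeff (signedPerm neg s) x y =
      ((invSign s {i | neg (y i)} : ℤ) : ℂ) * if x = y ∘ s.symm then 1 else 0 := fun s x y => by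
    rw [← coeff_one, ← coeff_mul_signedPerm, one_mul]
  have hs' : {x | s⁻¹ x ≠ x}.Finite := hs.subset fun x hx hc => hx (by
    rw [Equiv.Perm.inv_eq_iff_eq, hc])
  refine ext_coeff fun x y => ?_
  rw [coeff_star, key, key]
  have hiff : y = x ∘ s.symm ↔ x = y ∘ s⁻¹.symm := by
    constructor <;> rintro rfl <;> ext <;> simp [Equiv.Perm.inv_def]
  by_cases h : y = x ∘ s.symm
  · rw [if_pos h, if_pos (hiff.1 h), mul_one, mul_one]
    have h1 := invSign_mul hs' hs (N := {i | neg (x i)}) (M := {i | neg (y i)})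
      (by subst h; simp)
    rw [inv_mul_cancel, invSign_of_fixed (by simp)] at h1
    have h2 : invSign s {i | neg (x i)} = invSign s⁻¹ {i | neg (y i)} := by
      rw [eq_comm, mul_eq_one_iff_eq_inv] at h1
      rw [h1]; exact (Int.units_inv_eq_self _).symm
    rw [h2]
    simp
  · rw [if_neg h, if_neg fun hc => h (hiff.2 hc)]
    simp

end adjoint

/-! ### The subspaces `(Ker A)^⊥` and `H̃`. -/

theorem kerPerp_le_Htilde {H : Type*} [NormedAddCommGroup H] [InnerProductSpace ℂ H]
    (A q : H →L[ℂ] H) : kerPerp A ≤ Htilde A q := fun u hu =>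
  Submodule.le_topologicalClosure _ <| Submodule.subset_span
    ⟨1, fun _ _ => by simp, u, hu, by simp⟩

variable {ι H : Type*} [NormedAddCommGroup H] [InnerProductSpace ℂ H] [CompleteSpace H]

theorem inner_apply_of_isSelfAdjoint {a : H →L[ℂ] H} (ha : IsSelfAdjoint a) (u w : H) :
    ⟪a u, w⟫_ℂ = ⟪u, a w⟫_ℂ :=
  ContinuousLinearMap.isSelfAdjoint_iff_isSymmetric.1 ha u w

theorem kerPerp_orthogonal (A : H →L[ℂ] H) : (kerPerp A)ᗮ = LinearMap.ker (A : H →ₗ[ℂ] H) := by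
  have : CompleteSpace (LinearMap.ker (A : H →ₗ[ℂ] H)) := A.isClosed_ker.completeSpace_coe
  exact Submodule.orthogonal_orthogonal _

theorem apply_mem_kerPerp {A : H →L[ℂ] H} (hA : IsSelfAdjoint A) (u : H) : A u ∈ kerPerp A := by
  rw [kerPerp, Submodule.mem_orthogonal]
  intro z hz
  have hz' : A z = 0 := hz
  rw [← inner_apply_of_isSelfAdjoint hA, hz', inner_zero_left]

instance (A : H →L[ℂ] H) : CompleteSpace (kerPerp A) :=
  (Submodule.isClosed_orthogonal _).completeSpace_coe

/-- If the projection onto `(Ker A)^⊥` commutes with `q`, then `H̃ = (Ker A)^⊥`. -/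
theorem Htilde_eq_kerPerp {A q : H →L[ℂ] H} (hA : IsSelfAdjoint A)
    (hq : Commute (kerPerp A).starProjection q) : kerPerp A = Htilde A q := by
  set p := (kerPerp A).starProjection with hp
  have hpA : p * A = A := by
    ext u
    exact Submodule.starProjection_eq_self_iff.2 (apply_mem_kerPerp hA u)
  have hps : star p = p := (isSelfAdjoint_starProjection (kerPerp A)).star_eq
  have hAp : A * p = A := by
    have := congrArg star hpA
    rwa [star_mul, hps, hA.star_eq] at this
  refine (kerPerp_le_Htilde A q).antisymm ?_
  refine Submodule.topologicalClosure_minimal _ (Submodule.span_le.2 ?_)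
    (Submodule.isClosed_orthogonal _)
  rintro _ ⟨a, ha, u, hu, rfl⟩
  -- Since `p` commutes with both generators, it commutes with all of `{A, q}''`, which therefore
  -- preserves `(Ker A)^⊥`.
  have hc : p ∈ Set.centralizer {A, q} := by
    rintro m (rfl | rfl)
    · rw [hAp, hpA]
    · exact hq.eq.symm
  have h1 := congrArg (fun c => c u) (ha p hc)
  simp only [mul_apply_eq_comp] at h1
  rw [hp, Submodule.starProjection_eq_self_iff.2 hu] at h1
  exact Submodule.starProjection_eq_self_iff.1 h1

/-! ### Eigenvalues of `A`, weights of the states, and relabellings. -/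

namespace Params

variable (P : Params ι H)

/-- The eigenvalue of `A` at the basis vector `b_l`. -/
def ev (l : ι) : ℝ := (⟪P.basis l, P.A (P.basis l)⟫_ℂ).re

theorem A_basis (l : ι) : P.A (P.basis l) = (P.ev l : ℂ) • P.basis l := by
  have h : (P.ev l : ℂ) = ⟪P.basis l, P.A (P.basis l)⟫_ℂ := by
    refine Complex.conj_eq_iff_re.1 ?_
    rw [inner_conj_symm, inner_apply_of_isSelfAdjoint P.selfAdjoint]
  rw [h]
  exact P.basis_eigen l

/-- `|A|` has `b_l` as an eigenvector with some eigenvalue `α ≥ 0`, and `|A|² = A²` forces `α² = (ev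
l)²`. -/
theorem abs_basis_re (l : ι) : (⟪P.basis l, CFC.abs P.A (P.basis l)⟫_ℂ).re = |P.ev l| := by
  classical
  have hn : ⟪P.basis l, P.basis l⟫_ℂ = 1 := by
    simp [inner_self_eq_norm_sq_to_K, P.basis.orthonormal.1 l]
  have hd := density_basis P 0 l
  rw [weight_eq, density, add_apply, smul_apply] at hd
  set α := (⟪P.basis l, CFC.abs P.A (P.basis l)⟫_ℂ).re with hα
  -- The eigenvalue equation for `|A|` follows from the one for the density operator once the
  -- rank-one term is cancelled.
  have h1 : CFC.abs P.A (P.basis l) = (α : ℂ) • P.basis l := by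
    rw [matUnit_basis] at hd
    by_cases h : l = P.reg 0
    · rw [if_pos h, if_pos h.symm, ← h] at hd
      push_cast at hd
      rw [add_smul] at hd
      simpa using hd
    · rw [if_neg h, if_neg (Ne.symm h)] at hd
      simpa using hd
  have h2 := congrArg (fun c => ⟪P.basis l, c (P.basis l)⟫_ℂ) (CFC.abs_mul_abs P.A)
  simp only [P.selfAdjoint.star_eq, mul_apply_eq_comp, h1, A_basis, map_smul, inner_smul_right,
    hn, mul_one] at h2
  have h3 : α * α = P.ev l * P.ev l := by exact_mod_cast h2
  have h4 : 0 ≤ α := P.abs_re_nonneg l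
  rw [← abs_of_nonneg h4]
  exact (mul_self_eq_mul_self_iff.1 h3).elim (fun h => by rw [h]) fun h => by rw [h, abs_neg]

open scoped Classical in
theorem weight_eq_ev (k : ℕ) (l : ι) :
    P.weight k l = |P.ev l| + if l = P.reg k then 1 - P.traceAbs else 0 := by
  rw [weight_eq, abs_basis_re]

theorem abs_ev_le_weight (k : ℕ) (l : ι) : |P.ev l| ≤ P.weight k l := by
  classical
  rw [weight_eq_ev]
  have := P.traceAbs_le
  split_ifs <;> linarith

theorem abs_ev_le_one (l : ι) : |P.ev l| ≤ 1 := by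
  have h := (ENNReal.le_tsum l).trans P.cond_a
  rw [abs_basis_re] at h
  simpa using h

theorem inner_eigenvector {μ : ℝ} {u : H} (hu : P.A u = (μ : ℂ) • u) {l : ι} (h : μ ≠ P.ev l) :
    ⟪u, P.basis l⟫_ℂ = 0 := by
  have h1 := inner_apply_of_isSelfAdjoint P.selfAdjoint u (P.basis l)
  rw [hu, A_basis, inner_smul_left, inner_smul_right, Complex.conj_ofReal] at h1
  by_contra hne
  exact h (by exact_mod_cast mul_right_cancel₀ hne h1)

/-- A basis vector with eigenvalue `≥ 0` is orthogonal to all eigenspaces spanning the range of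
`E_-`. Conversely, `Tr|A| ≤ 1` keeps every negative eigenvalue inside `[-1, 0[`. -/
theorem neg_iff (l : ι) : P.neg l ↔ P.ev l < 0 := by
  classical
  constructor
  · intro h
    by_contra hc
    have hp := P.spectralProj_basis l
    rw [if_pos h] at hp
    have h0 : spectralProj P.A (Set.Ico (-1) 0) (P.basis l) = 0 := by
      rw [spectralProj, Submodule.starProjection_apply_eq_zero_iff, spectralSubspace,
        Submodule.orthogonal_closure, Submodule.mem_orthogonal]
      intro u hu
      refine Submodule.iSup_induction' (motive := fun u _ => ⟪u, P.basis l⟫_ℂ = 0) _ ?_ ?_ ?_ hu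
      · intro μ u hu
        by_cases hμ : μ ∈ Set.Ico (-1 : ℝ) 0
        · rw [iSup_pos hμ] at hu
          exact P.inner_eigenvector (Module.End.mem_eigenspace_iff.1 hu)
            fun hμl => hc (hμl ▸ hμ.2)
        · rw [iSup_neg hμ, Submodule.mem_bot] at hu
          simp [hu]
      · simp
      · intro x y _ _ hx hy
        rw [inner_add_left, hx, hy, add_zero]
    exact P.basis.orthonormal.ne_zero l (hp.symm.trans h0)
  · intro h
    refine Submodule.le_topologicalClosure _ (Submodule.mem_iSup_of_mem (P.ev l) ?_)
    rw [iSup_pos ⟨by linarith [neg_abs_le (P.ev l), P.abs_ev_le_one l], h⟩]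
    exact Module.End.mem_eigenspace_iff.2 (P.A_basis l)

theorem basis_reg_mem (ht : P.traceAbs ≠ 1) (k : ℕ) : P.basis (P.reg k) ∈ Hreg P.A P.q := by
  classical
  have hlt : posTrace P.basis (CFC.abs P.A) < 1 := by
    rw [← P.ofReal_traceAbs, ENNReal.ofReal_lt_one]
    exact lt_of_le_of_ne P.traceAbs_le ht
  have := (P.reg_bij hlt).mapsTo (Set.mem_univ k) (P.basis (P.reg k))
  rwa [matUnit_basis, if_pos rfl] at this

theorem reg_injective (ht : P.traceAbs ≠ 1) : Function.Injective P.reg := by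
  have hlt : posTrace P.basis (CFC.abs P.A) < 1 := by
    rw [← P.ofReal_traceAbs, ENNReal.ofReal_lt_one]
    exact lt_of_le_of_ne P.traceAbs_le ht
  exact Set.injOn_univ.1 (P.reg_bij hlt).injOn

/-- Since `H̃` contains `(Ker A)^⊥`, its complement `H_reg` lies in `Ker A`. -/
theorem ev_reg (ht : P.traceAbs ≠ 1) (k : ℕ) : P.ev (P.reg k) = 0 := by
  have h1 : P.basis (P.reg k) ∈ (kerPerp P.A)ᗮ :=
    Submodule.orthogonal_le (kerPerp_le_Htilde P.A P.q) (P.basis_reg_mem ht k)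
  rw [kerPerp_orthogonal] at h1
  have h2 : P.A (P.basis (P.reg k)) = 0 := h1
  simp [ev, h2]

theorem q_reg (ht : P.traceAbs ≠ 1) (k : ℕ) : P.q (P.basis (P.reg k)) = 0 :=
  P.cond_f _ (P.basis_reg_mem ht k)

theorem q_symm (u w : H) : ⟪P.q u, w⟫_ℂ = ⟪u, P.q w⟫_ℂ :=
  inner_apply_of_isSelfAdjoint P.q_proj.isSelfAdjoint u w

open scoped Classical in
/-- The density operator of `ψ_k`, with the sign of `A`, is `A + (1 - Tr|A|) e_{n_k n_k}`. -/
theorem weight_mul_sign (k : ℕ) (l : ι) : P.weight k l * (if P.neg l then -1 else 1) =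
    P.ev l + if l = P.reg k then 1 - P.traceAbs else 0 := by
  rw [weight_eq_ev]
  -- If `Tr|A| = 1`, the label `reg k` is arbitrary but its coefficient vanishes; otherwise `ev (reg
  -- k) = 0`, so the sign at that label is `+1`.
  by_cases ht : P.traceAbs = 1
  · simp only [ht, sub_self, ite_self, add_zero, P.neg_iff]
    split_ifs with h
    · rw [abs_of_neg h]; ring
    · rw [abs_of_nonneg (not_lt.1 h), mul_one]
  · simp only [P.neg_iff]
    by_cases hl : l = P.reg k
    · simp [hl, P.ev_reg ht]
    · simp only [if_neg hl, add_zero]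
      split_ifs with h
      · rw [abs_of_neg h]; ring
      · rw [abs_of_nonneg (not_lt.1 h), mul_one]

/-- For each permutation of the tensor factors there is a permutation of the labels that carries the
states of the factors to each other and is compatible with the operators `T(r)`. -/
theorem exists_relabel (s : Equiv.Perm ℕ) : ∃ w : Equiv.Perm ι,
    (∀ j l, P.weight (s j) (w l) = P.weight j l) ∧ (∀ l, P.neg (w l) ↔ P.neg l) ∧
    ∀ l m, ⟪P.basis (w l), P.q (P.basis (w m))⟫_ℂ = ⟪P.basis l, P.q (P.basis m)⟫_ℂ := by
  classical
  by_cases ht : P.traceAbs = 1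
  -- When `Tr|A| = 1` all the states `ψ_k` coincide and nothing has to be moved.
  · exact ⟨1, fun j l => by simp [weight_eq_ev, ht], fun l => by simp, fun l m => by simp⟩
  have hinj := P.reg_injective ht
  let f : ℕ ≃ Set.range P.reg := Equiv.ofInjective P.reg hinj
  -- `w` permutes the regular labels as `s` permutes their indices. This is invisible to `A` and
  -- `q`, which both vanish on those basis vectors.
  let w : Equiv.Perm ι := s.extendDomain f
  have hw1 : ∀ k, w (P.reg k) = P.reg (s k) := fun k => by
    have := Equiv.Perm.extendDomain_apply_image s f k
    simpa [f] using this
  have hw2 : ∀ l, l ∉ Set.range P.reg → w l = l := fun l hl =>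
    Equiv.Perm.extendDomain_apply_not_subtype s f hl
  have hev : ∀ l, P.ev (w l) = P.ev l := fun l => by
    by_cases hl : l ∈ Set.range P.reg
    · obtain ⟨k, rfl⟩ := hl
      rw [hw1, P.ev_reg ht, P.ev_reg ht]
    · rw [hw2 l hl]
  refine ⟨w, fun j l => ?_, fun l => by rw [neg_iff, neg_iff, hev], fun l m => ?_⟩
  · rw [weight_eq_ev, weight_eq_ev, hev, ← hw1]
    simp
  · have hq : ∀ l, P.q (P.basis (w l)) = P.q (P.basis l) := fun l => by
      by_cases hl : l ∈ Set.range P.reg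
      · obtain ⟨k, rfl⟩ := hl
        rw [hw1, P.q_reg ht, P.q_reg ht]
      · rw [hw2 l hl]
    rw [hq, ← q_symm, hq, q_symm]

/-! ### The position of the vector `v` relative to `Ker A`. -/

section vector

variable {P} {v : H}

/-- If `H̃ = (Ker A)^⊥`, then the vector `v` with `q = ⟨v, ·⟩ v` lies in `(Ker A)^⊥`. -/
theorem mem_kerPerp_of_eq (hv : P.q = InnerProductSpace.rankOne ℂ v v)
    (h : kerPerp P.A = Htilde P.A P.q) : v ∈ kerPerp P.A := by
  set p := (kerPerp P.A).starProjection with hp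
  have hpv : p v ∈ kerPerp P.A := Submodule.starProjection_apply_mem _ v
  -- If `p v = 0`, then `v ∈ H_reg`, where `q` vanishes by (f), so `v = 0`. Otherwise `q (p v) = ‖p
  -- v‖² v` lies in `H̃ = (Ker A)^⊥`, because `q` belongs to `{A, q}''`.
  by_cases h0 : p v = 0
  · rw [hp, Submodule.starProjection_apply_eq_zero_iff, h] at h0
    have h1 := P.cond_f v h0
    rw [hv, InnerProductSpace.rankOne_apply, smul_eq_zero] at h1
    have h2 : v = 0 := h1.elim (fun h => inner_self_eq_zero.1 h) id
    rw [h2]; exact zero_mem _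
  · have h1 : P.q (p v) ∈ kerPerp P.A := by
      rw [h]
      exact Submodule.le_topologicalClosure _ <| Submodule.subset_span
        ⟨P.q, fun m hm => (hm P.q (by simp)).symm, p v, hpv, rfl⟩
    rw [hv, InnerProductSpace.rankOne_apply] at h1
    refine (Submodule.smul_mem_iff _ fun hc => h0 ?_).1 h1
    have h2 : p (p v) = p v := Submodule.starProjection_eq_self_iff.2 hpv
    rw [← h2, hp, ← Submodule.inner_starProjection_left_eq_right, ← hp] at hc
    rw [← inner_self_eq_zero (𝕜 := ℂ), ← hc]

theorem inner_eq_zero_of_eq (hv : P.q = InnerProductSpace.rankOne ℂ v v)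
    (h : kerPerp P.A = Htilde P.A P.q) {l : ι} (hl : P.ev l = 0) :
    ⟪P.basis l, v⟫_ℂ = 0 := by
  have h1 : P.A (P.basis l) = 0 := by rw [A_basis, hl]; simp
  exact Submodule.mem_orthogonal _ _ |>.1 (mem_kerPerp_of_eq hv h) _ h1

/-- Were `v` contained in `Ker A` or in its complement, the projection onto `(Ker A)^⊥` would
commute with `q`, and `Htilde_eq_kerPerp` would apply. -/
theorem exists_of_ne (hv : P.q = InnerProductSpace.rankOne ℂ v v)
    (h : kerPerp P.A ≠ Htilde P.A P.q) :
    (∃ l, P.ev l = 0 ∧ ⟪P.basis l, v⟫_ℂ ≠ 0) ∧ ∃ l, P.ev l ≠ 0 ∧ ⟪P.basis l, v⟫_ℂ ≠ 0 := by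
  set p := (kerPerp P.A).starProjection with hp
  have hps : star p = p := (isSelfAdjoint_starProjection (kerPerp P.A)).star_eq
  have hqs : star P.q = P.q := P.q_proj.isSelfAdjoint.star_eq
  -- If `p v = c v` with `c` real, then `p q = c q` is self-adjoint, hence equal to `q p`. The
  -- values used are `c = 1` and `c = 0`.
  have key : ∀ c : ℂ, p v = c • v → star c = c → False := by
    intro c hc hcs
    refine h (Htilde_eq_kerPerp P.selfAdjoint ?_)
    have h1 : p * P.q = c • P.q := by
      ext u
      rw [mul_apply_eq_comp, smul_apply, hv, InnerProductSpace.rankOne_apply, map_smul, hc,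
        smul_comm]
    have h2 := congrArg star h1
    rw [star_mul, star_smul, hps, hqs, hcs] at h2
    exact h1.trans h2.symm
  have hsum : ∀ u, (∀ l, ⟪P.basis l, u⟫_ℂ = 0) → u = 0 := fun u hu => by
    refine P.basis.repr.injective ?_
    ext l
    rw [P.basis.repr_apply_apply, hu, map_zero]
    rfl
  constructor
  · by_contra! hc
    refine key 1 ?_ (by simp)
    rw [one_smul]
    refine Submodule.starProjection_eq_self_iff.2 ?_
    rw [kerPerp, Submodule.mem_orthogonal]
    intro z hz
    have hz' : P.A z = ((0 : ℝ) : ℂ) • z := by simpa using hz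
    rw [← P.basis.tsum_inner_mul_inner]
    refine (tsum_congr fun l => ?_).trans tsum_zero
    by_cases hl : P.ev l = 0
    · rw [hc l hl, mul_zero]
    · rw [P.inner_eigenvector hz' (Ne.symm hl), zero_mul]
  · by_contra! hc
    refine key 0 ?_ (by simp)
    rw [zero_smul, hp, Submodule.starProjection_apply_eq_zero_iff, kerPerp_orthogonal]
    refine hsum _ fun l => ?_
    change ⟪P.basis l, P.A v⟫_ℂ = 0
    rw [← inner_apply_of_isSelfAdjoint P.selfAdjoint, A_basis, inner_smul_left]
    by_cases hl : P.ev l = 0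
    · simp [hl]
    · rw [hc l hl, mul_zero]

end vector

end Params

/-! ### The limits of the transpositions -/

/-- Induction by conjugation: `(0 n+1) = t (0 n) t` with `t = (n n+1)`. The cocycle rule then splits
the sign into three factors. -/
theorem invSign_swap_of_mem {n : ℕ} (hn : 0 < n) {N : Set ℕ} (h0 : 0 ∈ N) (hnN : n ∈ N) :
    invSign (Equiv.swap 0 n) N = -1 := by
  classical
  induction n, hn using Nat.le_induction generalizing N with
  | base =>
    rw [invSign_eq_prod (n := 2) fun i hi => Equiv.swap_apply_of_ne_of_ne (by omega) (by omega)]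
    have : pairs 2 = {(0, 1)} := by decide
    simp [this, h0, hnN]
  | succ n hn ih =>
    set t := Equiv.swap n (n + 1) with ht
    have hft := RInf.finite_swap n (n + 1)
    have hn0 : n ≠ 0 := Nat.one_le_iff_ne_zero.1 hn
    set M : Set ℕ := {i | t i ∈ N} with hM
    have htt : ∀ i, t (t i) = i := fun i => by
      rw [ht, ← Equiv.Perm.mul_apply, Equiv.swap_mul_self, Equiv.Perm.one_apply]
    have h0M : 0 ∈ M := by
      change t 0 ∈ N
      rwa [ht, Equiv.swap_apply_of_ne_of_ne (Ne.symm hn0) (by omega)]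
    have hnM : n ∈ M := by
      change t n ∈ N
      rwa [ht, Equiv.swap_apply_left]
    have hswap : ∀ i, i ∈ M ↔ Equiv.swap 0 n i ∈ M := fun i => by
      by_cases hi0 : i = 0
      · simp [hi0, h0M, hnM]
      by_cases hin : i = n
      · simp [hin, h0M, hnM]
      · rw [Equiv.swap_apply_of_ne_of_ne hi0 hin]
    have hNM : ∀ i, i ∈ N ↔ t i ∈ M := fun i => by
      change _ ↔ t (t i) ∈ N
      rw [htt]
    have hconj : Equiv.swap 0 (n + 1) = t * (Equiv.swap 0 n * t) := by
      rw [ht, ← mul_assoc, Equiv.swap_mul_swap_mul_swap (Ne.symm hn0) (by omega),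
        Equiv.swap_comm]
    have hf2 : {x | (Equiv.swap 0 n * t) x ≠ x}.Finite :=
      ((RInf.finite_swap 0 n).union hft).subset fun x hx => by
        by_contra h
        simp only [Set.mem_union, Set.mem_ofPred_eq, not_or, not_not] at h
        exact hx (by rw [Equiv.Perm.mul_apply, ht, h.2, h.1])
    rw [hconj, invSign_mul hft hf2 (M := M) fun i => by
        rw [Equiv.Perm.mul_apply, ← hswap]; exact hNM i,
      invSign_mul (RInf.finite_swap 0 n) hft (M := M) hNM, ih h0M hnM]
    -- The two outer factors multiply to the sign of `t * t = 1`, so the sign from the induction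
    -- hypothesis remains.
    have h1 := invSign_mul hft hft hNM
    have : t * t = 1 := by ext i; simp [htt]
    rw [this, invSign_of_fixed (by simp)] at h1
    rw [neg_one_mul, mul_neg, ← h1]

open scoped Classical in
theorem invSign_swap_of_iff {n : ℕ} (hn : 0 < n) {N : Set ℕ} (h : 0 ∈ N ↔ n ∈ N) :
    invSign (Equiv.swap 0 n) N = if n ∈ N then -1 else 1 := by
  split_ifs with hnN
  · exact invSign_swap_of_mem hn (h.2 hnN) hnN
  · refine invSign_of_fixed fun i hi => Equiv.swap_apply_of_ne_of_ne ?_ ?_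
    · rintro rfl; exact hnN (h.1 hi)
    · rintro rfl; exact hnN hi

open scoped Classical in
-- Neither `c` nor `a` acts on factor `n`, so an intermediate sequence `z` contributes only if `z n
-- = x n` and, after the swap, `z 0 = x n`. On such `z` the transposition is a sign, and the
-- condition on `z 0` is what `e_{ll}^{(0)}` with `l = x n` imposes.
theorem coeff_mul_swap_mul {ι H : Type*} [NormedAddCommGroup H] [InnerProductSpace ℂ H]
    (b : HilbertBasis ι ℂ H) (neg : ι → Prop) {a c : L2 (ℕ → ι) →L[ℂ] L2 (ℕ → ι)}
    {N n : ℕ} (ha : IsLocal N a) (hc : IsLocal N c)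
    (h0 : 0 < n) (hn : N ≤ n) (x : ℕ → ι) :
    coeff (c * (signedPerm neg (Equiv.swap 0 n) * a)) x x = (if neg (x n) then -1 else 1) *
      coeff (c * (siteOp b 0 (matUnit b (x n) (x n)) * a)) x x := by
  have hu : ∀ m, matUnit b (x n) (x n) (b m) = (if x n = m then (1 : ℂ) else 0) • b m := fun m => by
    rw [matUnit_basis]
    split_ifs with h <;> simp [h]
  rw [coeff_mul, coeff_mul, ← tsum_mul_left]
  refine tsum_congr fun z => ?_
  rw [coeff_siteOp_diagonal_mul b hu, coeff_signedPerm_mul]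
  by_cases hzn : x n = z n
  · by_cases hz0 : x n = z 0
    · have hz : z ∘ Equiv.swap 0 n = z := by
        ext i
        simp only [Function.comp_apply, Equiv.swap_apply_def]
        split_ifs with h1 h2
        · rw [h1, ← hzn, hz0]
        · rw [h2, ← hzn, hz0]
        · rfl
      have hz' : ∀ i, z (Equiv.swap 0 n i) = z i := fun i => congrFun hz i
      simp only [hz, hz']
      rw [invSign_swap_of_iff h0 (by simp [← hz0, ← hzn]), if_pos hz0]
      simp only [Set.mem_ofPred_eq, ← hzn]
      split_ifs <;> simp
    · rw [if_neg hz0, ha.1 (z ∘ Equiv.swap 0 n) x ⟨n, hn, by simpa using Ne.symm hz0⟩]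
      simp
  · rw [hc.1 x z ⟨n, hn, hzn⟩]
    simp

/-! ### Weak convergence of the transpositions to `A^{(0)}`. -/

namespace Params

attribute [local instance] seqMeasurableSpace

variable (P : Params ι H)

theorem T_ofPerm (s : Equiv.Perm ℕ) (hs : {x | s x ≠ x}.Finite) :
    (P.T (RInf.ofPerm s hs) : L2 (ℕ → ι) →L[ℂ] L2 (ℕ → ι)) = signedPerm P.neg s := by
  obtain ⟨v, hv⟩ := P.exists_vec
  change T0 P.basis P.neg P.q (RInf.ofPerm s hs) = _
  rw [T0_eq _ _ hv P.q_idem (P.neg_orthogonal hv) _ s hs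
    (by simp [RInf.ofPerm, Equiv.toPEquiv_apply])]
  have hU : (RInf.ofPerm s hs).undef = ∅ := by
    ext i; simp [RInf.mem_undef, RInf.ofPerm, Equiv.toPEquiv_apply]
  rw [hU, siteProd_empty, mul_one]

theorem T_eps_eq_site (k : ℕ) : P.T (RInf.eps k) = site P.basis k P.q :=
  Subtype.ext (P.T_eps k)

variable [Countable ι]

theorem integral_siteMeasure (k : ℕ) {f : ι → ℂ} {C : ℝ} (hf : ∀ l, ‖f l‖ ≤ C) :
    ∫ l, f l ∂(P.siteMeasure k) = ∑' l, (P.weight k l : ℂ) * f l := by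
  let _ : MeasurableSpace ι := ⊤
  have hint : MeasureTheory.Integrable f (P.siteMeasure k) :=
    MeasureTheory.Integrable.of_bound (measurable_of_countable _).aestronglyMeasurable C
      (Filter.Eventually.of_forall hf)
  rw [siteMeasure, ← (MeasureTheory.hasSum_integral_measure hint).tsum_eq]
  refine tsum_congr fun l => ?_
  rw [MeasureTheory.integral_smul_measure, MeasureTheory.integral_dirac,
    ENNReal.toReal_ofReal (P.weight_nonneg k l)]
  rfl

/-- Integrating coordinate `n` first turns the sign and matrix units of `coeff_mul_swap_mul` into
the weighted sum of the `e_{ll}^{(0)}`. The sign changes the weights from `|ev l|` to `ev l`, which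
rebuilds `A` itself. -/
theorem prodState_swap {a c : localAlg ι} {N n : ℕ} (ha : IsLocal N a.1) (hc : IsLocal N c.1)
    (h0 : 0 < n) (hn : N ≤ n) :
    P.prodState (c * (P.T (RInf.swap 0 n) * a)) = P.prodState (c * (site P.basis 0 P.A * a)) +
      ((1 - P.traceAbs : ℝ) : ℂ) *
        P.prodState (c * (site P.basis 0 (matUnit P.basis (P.reg n) (P.reg n)) * a)) := by
  classical
  let _ : MeasurableSpace ι := ⊤
  set g : ι → (ℕ → ι) → ℂ := fun l x =>
    coeff (c.1 * (siteOp P.basis 0 (matUnit P.basis l l) * a.1)) x x with hg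
  -- None of `c`, `a`, `e_{ll}^{(0)}` acts on factor `n`, so `x n` enters only through the choice of
  -- `l`.
  have hgloc : ∀ l x, g l (Function.update x n l) = g l x := by
    intro l x
    have h1 : IsLocal n (siteOp P.basis 0 (matUnit P.basis l l)) := by
      refine ⟨fun x y ⟨j, hj, hne⟩ => ?_, fun x y x' y' h1 h2 => ?_⟩
      · rw [coeff_siteOp, if_neg fun h => hne (h j (by omega))]
      · rw [coeff_siteOp, coeff_siteOp, (h1 0 h0).1, (h1 0 h0).2]
        refine if_congr (forall_congr' fun j => imp_congr_right fun _ => ?_) rfl rfl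
        rcases lt_or_ge j n with hj | hj
        · rw [(h1 j hj).1, (h1 j hj).2]
        · simp [(h2 j hj).1, (h2 j hj).2]
    refine ((hc.mono hn).mul (h1.mul (ha.mono hn))).2 _ _ _ _ (fun k hk => ?_) fun k _ => by simp
    simp [hk.ne]
  have hgb : ∀ l x, ‖g l x‖ ≤ ‖c.1‖ * ‖a.1‖ := by
    intro l x
    refine (norm_coeff_le _ _ _).trans ((norm_mul_le _ _).trans ?_)
    gcongr
    refine (norm_mul_le _ _).trans (mul_le_of_le_one_left (norm_nonneg _) ?_)
    exact (norm_siteOp_le _ _ _).trans (norm_matUnit_le _ _ _)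
  have hS : (P.T (RInf.swap 0 n) : L2 (ℕ → ι) →L[ℂ] L2 (ℕ → ι)) =
      signedPerm P.neg (Equiv.swap 0 n) := P.T_ofPerm _ _
  have hinner : ∀ x, ∫ l, coeff (c * (P.T (RInf.swap 0 n) * a)).1 (Function.update x n l)
      (Function.update x n l) ∂(P.siteMeasure n) =
      coeff (c * (site P.basis 0 P.A * a)).1 x x + ((1 - P.traceAbs : ℝ) : ℂ) *
        coeff (c * (site P.basis 0 (matUnit P.basis (P.reg n) (P.reg n)) * a)).1 x x := by
    intro x
    have h1 : ∀ l, coeff (c * (P.T (RInf.swap 0 n) * a)).1 (Function.update x n l)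
        (Function.update x n l) = (if P.neg l then -1 else 1) * g l x := by
      intro l
      have := coeff_mul_swap_mul P.basis P.neg ha hc h0 hn (Function.update x n l)
      rw [Function.update_self] at this
      rw [← hgloc, hg, ← this, ← hS]
      rfl
    simp_rw [h1]
    rw [P.integral_siteMeasure n (C := ‖c.1‖ * ‖a.1‖) fun l => by
      rw [norm_mul]
      refine (mul_le_of_le_one_left (norm_nonneg _) ?_).trans (hgb l x)
      split_ifs <;> simp]
    have h2 : ∀ l, (P.weight n l : ℂ) * ((if P.neg l then -1 else 1) * g l x) =
        P.ev l * g l x + if l = P.reg n then ((1 - P.traceAbs : ℝ) : ℂ) * g l x else 0 := by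
      intro l
      have := congrArg (fun r : ℝ => (r : ℂ)) (P.weight_mul_sign n l)
      have h3 : (P.weight n l : ℂ) * (if P.neg l then -1 else 1) =
          P.ev l + if l = P.reg n then ((1 - P.traceAbs : ℝ) : ℂ) else 0 := by
        simpa [apply_ite (fun r : ℝ => (r : ℂ))] using this
      rw [← mul_assoc, h3, add_mul]
      split_ifs <;> simp
    simp_rw [h2]
    have h3 := hasSum_coeff_diagonal P.basis (k := 0) P.A_basis c.1 a.1 x x
    have h4 : HasSum (fun l => if l = P.reg n then ((1 - P.traceAbs : ℝ) : ℂ) * g l x else 0)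
        (((1 - P.traceAbs : ℝ) : ℂ) * g (P.reg n) x) := by
      simpa using hasSum_ite_eq (P.reg n) (((1 - P.traceAbs : ℝ) : ℂ) * g (P.reg n) x) |>.congr_fun
        fun l => by split_ifs with h <;> simp [h]
    exact (h3.add h4).tsum_eq
  rw [prodState, prodState, prodState, ← MeasureTheory.integral_const_mul,
    ← MeasureTheory.integral_add (P.integrable_coeff _) ((P.integrable_coeff _).const_mul _)]
  refine (integral_resample P.siteMeasure n (P.integrable_coeff _)).trans ?_
  exact MeasureTheory.integral_congr_ae (Filter.Eventually.of_forall hinner)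

open Filter Topology

/-- For fixed `x`, the diagonal coefficients of `c e_{ll}^{(0)} a` are summable over `l`, hence tend
to zero along the injective sequence of regular labels; dominated convergence does the rest. -/
theorem tendsto_prodState_reg (ht : P.traceAbs ≠ 1) (a c : localAlg ι) :
    Tendsto (fun n => P.prodState
      (c * (site P.basis 0 (matUnit P.basis (P.reg n) (P.reg n)) * a))) atTop (𝓝 0) := by
  classical
  have h := MeasureTheory.tendsto_integral_of_dominated_convergence (μ := P.prodMeasure)
    (F := fun n x => coeff
      (c * (site P.basis 0 (matUnit P.basis (P.reg n) (P.reg n)) * a)).1 x x)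
    (f := fun _ => 0) (fun _ => ‖c.1‖ * ‖a.1‖)
    (fun n => (P.integrable_coeff _).aestronglyMeasurable) (MeasureTheory.integrable_const _)
    (fun n => Eventually.of_forall fun x => by
      refine (norm_coeff_le _ _ _).trans ((norm_mul_le _ _).trans ?_)
      gcongr
      refine (norm_mul_le _ _).trans (mul_le_of_le_one_left (norm_nonneg _) ?_)
      exact (norm_siteOp_le _ _ _).trans (norm_matUnit_le _ _ _))
    (Eventually.of_forall fun x => by
      have h1 := hasSum_coeff_diagonal P.basis (k := 0) (D := 1) (d := fun _ => 1)
        (fun l => by simp) c.1 a.1 x x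
      simp only [one_mul] at h1
      have h2 := h1.summable.tendsto_cofinite_zero.comp (P.reg_injective ht).tendsto_cofinite
      rw [Nat.cofinite_eq_atTop] at h2
      exact h2)
  simpa [prodState] using h

theorem inner_L (a : localAlg ι) (u w : P.PreSpace) :
    ⟪(w : P.Space), P.L a u⟫_ℂ = P.prodState (star (P.ofPre w) * (a * P.ofPre u)) := by
  change ⟪(w : P.Space), (P.leftMul a).completion u⟫_ℂ = _
  rw [ContinuousLinearMap.completion_apply_coe, UniformSpace.Completion.inner_coe]
  rfl

theorem norm_L_apply_le (a : localAlg ι) (u : P.Space) : ‖P.L a u‖ ≤ ‖a.1‖ * ‖u‖ := by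
  induction u using UniformSpace.Completion.induction_on with
  | hp => apply isClosed_le <;> fun_prop
  | ih u =>
    change ‖(P.leftMul a).completion u‖ ≤ _
    rw [ContinuousLinearMap.completion_apply_coe, UniformSpace.Completion.norm_coe,
      UniformSpace.Completion.norm_coe]
    exact (P.leftMul a).le_of_opNorm_le (LinearMap.mkContinuous_norm_le _ (norm_nonneg _) _) u

/-- The operator `A^{(0)}` is the weak limit of the transpositions `(0 n)`. -/
theorem tendsto_inner_swap (u w : P.Space) :
    Tendsto (fun n => ⟪w, P.Pi (RInf.swap 0 n) u⟫_ℂ) atTop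
      (𝓝 ⟪w, P.L (site P.basis 0 P.A) u⟫_ℂ) := by
  have hC : ∀ n (u : P.Space), ‖(P.Pi (RInf.swap 0 n) - P.L (site P.basis 0 P.A)) u‖ ≤
      (1 + ‖(site P.basis 0 P.A).1‖) * ‖u‖ := by
    intro n u
    rw [sub_apply, add_mul]
    refine (norm_sub_le _ _).trans (add_le_add ?_ (P.norm_L_apply_le _ u))
    refine (P.norm_L_apply_le _ u).trans ?_
    gcongr
    have : (P.T (RInf.swap 0 n) : L2 (ℕ → ι) →L[ℂ] L2 (ℕ → ι)) =
      signedPerm P.neg (Equiv.swap 0 n) := P.T_ofPerm _ _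
    rw [this]
    exact ContinuousLinearMap.opNorm_le_bound _ zero_le_one fun f => by
      rw [norm_signedPerm_apply, one_mul]
  have h := tendsto_inner_zero_of_dense hC
    (UniformSpace.Completion.denseRange_coe (α := P.PreSpace)) (by
      rintro _ ⟨u, rfl⟩ _ ⟨w, rfl⟩
      obtain ⟨N₁, h1⟩ := (P.ofPre u).2
      obtain ⟨N₂, h2⟩ := (star (P.ofPre w)).2
      have hev : (fun n => ((1 - P.traceAbs : ℝ) : ℂ) * P.prodState (star (P.ofPre w) *
          (site P.basis 0 (matUnit P.basis (P.reg n) (P.reg n)) * P.ofPre u))) =ᶠ[atTop]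
          fun n => ⟪(w : P.Space), (P.Pi (RInf.swap 0 n) - P.L (site P.basis 0 P.A)) u⟫_ℂ := by
        -- From here on `n` lies outside the supports of both vectors, and `n ≠ 0`.
        filter_upwards [eventually_ge_atTop (max (max N₁ N₂) 1)] with n hn
        simp only [max_le_iff] at hn
        rw [sub_apply, inner_sub_right]
        change _ = ⟪(w : P.Space), P.L (P.T (RInf.swap 0 n)) u⟫_ℂ - _
        rw [inner_L, inner_L, P.prodState_swap (h1.mono (le_max_left _ _))
          (h2.mono (le_max_right _ _)) (by omega) (by omega)]
        ring
      refine Tendsto.congr' hev ?_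
      by_cases ht : P.traceAbs = 1
      · simp [ht]
      · simpa using (P.tendsto_prodState_reg ht (P.ofPre u) (star (P.ofPre w))).const_mul
          ((1 - P.traceAbs : ℝ) : ℂ)) u w
  have h2 := h.add_const ⟪w, P.L (site P.basis 0 P.A) u⟫_ℂ
  simpa [inner_sub_right] using h2

end Params

/-! ### If `ξ₀` is cyclic for the commutant, then `(Ker A)^⊥ = H̃` -/

namespace Params

open Filter Topology

variable (P : Params ι H)

/-- The operator `1 - A²`, whose powers tend to the projection onto `Ker A`. -/
def oneSubSq : H →L[ℂ] H := 1 - P.A * P.A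

theorem oneSubSq_basis (l : ι) :
    P.oneSubSq (P.basis l) = ((1 - P.ev l ^ 2 : ℝ) : ℂ) • P.basis l := by
  rw [oneSubSq, sub_apply, mul_apply_eq_comp, A_basis, map_smul, A_basis, smul_smul,
    one_apply_eq_self]
  push_cast
  rw [sub_smul, one_smul, sq]

theorem oneSubSq_pow_basis (n : ℕ) (l : ι) :
    (P.oneSubSq ^ n) (P.basis l) = (((1 - P.ev l ^ 2) ^ n : ℝ) : ℂ) • P.basis l := by
  induction n with
  | zero => simp
  | succ n ih =>
    rw [pow_succ, mul_apply_eq_comp, oneSubSq_basis, map_smul, ih, smul_smul, pow_succ, mul_comm]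
    push_cast
    rfl

theorem isSelfAdjoint_oneSubSq_pow (n : ℕ) : IsSelfAdjoint (P.oneSubSq ^ n) := by
  refine IsSelfAdjoint.pow ((IsSelfAdjoint.one _).sub ?_) n
  rw [IsSelfAdjoint, star_mul, P.selfAdjoint.star_eq]

theorem one_sub_ev_sq_mem (l : ι) : 1 - P.ev l ^ 2 ∈ Set.Icc (0 : ℝ) 1 := by
  have := (sq_le_one_iff_abs_le_one _).2 (P.abs_ev_le_one l)
  exact ⟨by linarith, by linarith [sq_nonneg (P.ev l)]⟩

theorem norm_oneSubSq_pow_apply_le (n : ℕ) (u : H) : ‖(P.oneSubSq ^ n) u‖ ≤ ‖u‖ := by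
  rw [← P.basis.repr.norm_map, ← P.basis.repr.norm_map u,
    ← sq_le_sq₀ (norm_nonneg _) (norm_nonneg _), norm_sq_eq_tsum, norm_sq_eq_tsum]
  refine (summable_sq _).tsum_le_tsum (fun l => ?_) (summable_sq _)
  obtain ⟨h0, h1⟩ := P.one_sub_ev_sq_mem l
  rw [P.basis.repr_apply_apply, P.basis.repr_apply_apply,
    ← inner_apply_of_isSelfAdjoint (P.isSelfAdjoint_oneSubSq_pow n), oneSubSq_pow_basis,
    inner_smul_left, norm_mul]
  gcongr
  refine mul_le_of_le_one_left (norm_nonneg _) ?_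
  rw [Complex.conj_ofReal, Complex.norm_real, Real.norm_of_nonneg (pow_nonneg h0 n)]
  exact pow_le_one₀ h0 h1

theorem summable_weight (k : ℕ) : Summable (P.weight k) := by
  have h := ENNReal.summable_toReal (f := fun l => ENNReal.ofReal (P.weight k l))
    (by rw [P.tsum_weight]; simp)
  simpa [ENNReal.toReal_ofReal (P.weight_nonneg k _)] using h

variable [Countable ι]

/-- The squared norm is `ψ_0(c⋆ c)`, and the density operator of `ψ_0` is diagonal in the basis
`b_l`. -/
theorem norm_L_site_xi_sq (c : H →L[ℂ] H) :
    ‖P.L (site P.basis 0 c) P.xi‖ ^ 2 = ∑' l, P.weight 0 l * ‖c (P.basis l)‖ ^ 2 := by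
  refine Complex.ofReal_injective ?_
  have h1 : ((‖P.L (site P.basis 0 c) P.xi‖ ^ 2 : ℝ) : ℂ) =
      P.prodState (site P.basis 0 (star c * c)) := by
    have h2 := inner_self_eq_norm_sq_to_K (𝕜 := ℂ) (P.L (site P.basis 0 c) P.xi)
    rw [← ContinuousLinearMap.adjoint_inner_right, ← ContinuousLinearMap.star_eq_adjoint,
      ← map_star, ← mul_apply_eq_comp, ← map_mul] at h2
    have h3 : star (site P.basis 0 c) = site P.basis 0 (star c) :=
      Subtype.ext (siteOp_star P.basis 0 c).symm
    rw [h3, ← site_mul, xi, inner_L] at h2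
    have h4 : P.ofPre (P.toPre 1) = 1 := rfl
    rw [h4, star_one, one_mul, mul_one] at h2
    rw [h2, xi]
    simp
  have h5 := P.prodState_prod (fun _ => star c * c) 1
  simp only [List.range_one, List.map_cons, List.map_nil, List.prod_cons, List.prod_nil, mul_one,
    Finset.range_one, Finset.prod_singleton] at h5
  rw [h1, Complex.ofReal_tsum]
  refine h5.trans (tsum_congr fun l => ?_)
  rw [density_basis, map_smul, inner_smul_right, mul_apply_eq_comp,
    ContinuousLinearMap.star_eq_adjoint, ContinuousLinearMap.adjoint_inner_right,
    inner_self_eq_norm_sq_to_K]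
  simp

/-! ### Operators that commute with the commutant of `π_A^{(0)}(R_∞)`. -/

instance : CompleteSpace P.cyclicSpace :=
  (Submodule.isClosed_topologicalClosure _).completeSpace_coe

/-- `Z` maps `[Π_A(R_∞) ξ₀]` to itself, and commutes there with the commutant of
`π_A^{(0)}(R_∞)`. -/
def MemBicommutant (Z : P.Space →L[ℂ] P.Space) : Prop :=
  ∀ u : P.cyclicSpace, ∃ w : P.cyclicSpace, (w : P.Space) = Z u ∧
    ∀ B ∈ Set.centralizer (Set.range P.pi0), ((B w : P.cyclicSpace) : P.Space) = Z (B u)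

variable {P} in
theorem MemBicommutant.mul {Y Z : P.Space →L[ℂ] P.Space} (hY : P.MemBicommutant Y)
    (hZ : P.MemBicommutant Z) : P.MemBicommutant (Y * Z) := fun u => by
  obtain ⟨w, hw, hB⟩ := hZ u
  obtain ⟨w', hw', hB'⟩ := hY w
  exact ⟨w', by rw [hw', hw]; rfl, fun B h => by rw [hB' B h, hB B h]; rfl⟩

variable {P} in
theorem MemBicommutant.sub {Y Z : P.Space →L[ℂ] P.Space} (hY : P.MemBicommutant Y)
    (hZ : P.MemBicommutant Z) : P.MemBicommutant (Y - Z) := fun u => by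
  obtain ⟨w, hw, hB⟩ := hZ u
  obtain ⟨w', hw', hB'⟩ := hY u
  exact ⟨w' - w, by simp [hw, hw'], fun B h => by simp [hB' B h, hB B h]⟩

theorem memBicommutant_one : P.MemBicommutant 1 := fun u => ⟨u, rfl, fun _ _ => rfl⟩

theorem memBicommutant_Pi (r : RInf) : P.MemBicommutant (P.Pi r) := fun u =>
  ⟨P.pi0 r u, rfl, fun B hB => by
    have := congrArg (fun c => c u) (hB (P.pi0 r) ⟨r, rfl⟩)
    exact (congrArg Subtype.val this).symm⟩

/-- Both requirements are linear conditions on matrix coefficients, so they pass from the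
transpositions to their weak limit. -/
theorem memBicommutant_A : P.MemBicommutant (P.L (site P.basis 0 P.A)) := by
  have hmem : ∀ u ∈ P.cyclicSpace, P.L (site P.basis 0 P.A) u ∈ P.cyclicSpace := by
    intro u hu
    -- A closed subspace is its own double complement, so it suffices to test against orthogonal
    -- vectors, where the whole sequence is zero.
    rw [← P.cyclicSpace.orthogonal_orthogonal, Submodule.mem_orthogonal]
    intro w hw
    refine tendsto_nhds_unique (P.tendsto_inner_swap u w) ?_
    refine tendsto_const_nhds.congr fun n => ?_
    exact (Submodule.inner_left_of_mem_orthogonal (P.Pi_mem _ hu) hw).symm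
  intro u
  refine ⟨⟨_, hmem u u.2⟩, rfl, fun B hB => ?_⟩
  refine congrArg Subtype.val (a₂ := ⟨_, hmem (B u) (B u).2⟩) ?_
  refine ext_inner_left ℂ fun w => ?_
  -- Moving `B` to the other side leaves a coefficient to which the weak limit applies.
  rw [← ContinuousLinearMap.adjoint_inner_left]
  refine tendsto_nhds_unique (P.tendsto_inner_swap u _) ?_
  refine (P.tendsto_inner_swap (B u) w).congr fun n => ?_
  have h1 := congrArg (fun c => c u) (hB (P.pi0 (RInf.swap 0 n)) ⟨_, rfl⟩)
  have h2 := ContinuousLinearMap.adjoint_inner_left B (P.pi0 (RInf.swap 0 n) u) w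
  refine Eq.trans ?_ h2.symm
  change ⟪w, P.pi0 (RInf.swap 0 n) (B u)⟫_ℂ = _
  exact congrArg (fun z => ⟪w, z⟫_ℂ) h1

/-- Multiplication is not jointly weakly continuous, so powers of `A^{(0)}` are reached through
`MemBicommutant.mul` rather than as limits of products of transpositions. -/
theorem memBicommutant_q_mul_oneSubSq_pow (n : ℕ) :
    P.MemBicommutant (P.L (site P.basis 0 (P.q * P.oneSubSq ^ n))) := by
  rw [site_mul, map_mul, ← T_eps_eq_site]
  refine (P.memBicommutant_Pi (RInf.eps 0)).mul ?_
  induction n with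
  | zero => rw [pow_zero, site_one, map_one]; exact P.memBicommutant_one
  | succ n ih =>
    rw [pow_succ, site_mul, map_mul]
    refine ih.mul ?_
    rw [oneSubSq, map_sub, map_sub, site_one, map_one, site_mul, map_mul]
    exact P.memBicommutant_one.sub (P.memBicommutant_A.mul P.memBicommutant_A)

/-- The squared norm is a sum of terms weighted by `weight 0 l`. Where `ev l ≠ 0`, the power of `1 -
(ev l)²` decays; where `ev l = 0`, the term is identically zero. Dominated convergence applies
because the weights are summable. -/
theorem tendsto_oneSubSq_xi :
    Tendsto (fun n => P.L (site P.basis 0 (P.q * P.oneSubSq ^ n)) P.xi) atTop (𝓝 0) := by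
  classical
  rw [tendsto_zero_iff_norm_tendsto_zero]
  have key : Tendsto (fun n => ‖P.L (site P.basis 0 (P.q * P.oneSubSq ^ n)) P.xi‖ ^ 2) atTop
      (𝓝 (∑' _ : ι, (0 : ℝ))) := by
    simp_rw [norm_L_site_xi_sq]
    have hval : ∀ n l, ‖(P.q * P.oneSubSq ^ n) (P.basis l)‖ =
        (1 - P.ev l ^ 2) ^ n * ‖P.q (P.basis l)‖ := fun n l => by
      rw [mul_apply_eq_comp, oneSubSq_pow_basis, map_smul, norm_smul, Complex.norm_real,
        Real.norm_of_nonneg (pow_nonneg (P.one_sub_ev_sq_mem l).1 n)]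
    refine tendsto_tsum_of_dominated_convergence (bound := fun l => P.weight 0 l * ‖P.q‖ ^ 2)
      ((P.summable_weight 0).mul_right _) (fun l => ?_) (Eventually.of_forall fun n l => ?_)
    · by_cases hl : P.ev l = 0
      · have : P.weight 0 l * ‖P.q (P.basis l)‖ ^ 2 = 0 := by
          rw [weight_eq_ev, hl]
          by_cases ht : P.traceAbs = 1
          · simp [ht]
          · by_cases hr : l = P.reg 0
            · simp [hr, P.q_reg ht]
            · simp [hr]
        refine tendsto_const_nhds.congr fun n => ?_
        rw [hval, hl]
        simpa using this.symm
      · have h1 : Tendsto (fun n => (1 - P.ev l ^ 2) ^ n) atTop (𝓝 0) :=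
          tendsto_pow_atTop_nhds_zero_of_lt_one (P.one_sub_ev_sq_mem l).1 (by
            have : 0 < P.ev l ^ 2 := by positivity
            linarith)
        have h2 := ((h1.mul_const ‖P.q (P.basis l)‖).pow 2).const_mul (P.weight 0 l)
        simp only [zero_mul, ne_eq, OfNat.ofNat_ne_zero, not_false_eq_true, zero_pow,
          mul_zero] at h2
        exact h2.congr fun n => by rw [hval]
    · have h0 := P.weight_nonneg 0 l
      rw [Real.norm_of_nonneg (by positivity), hval]
      obtain ⟨h2, h3⟩ := P.one_sub_ev_sq_mem l
      gcongr
      refine (mul_le_of_le_one_left (norm_nonneg _) (pow_le_one₀ h2 h3)).trans ?_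
      simpa [P.basis.orthonormal.1 l] using P.q.le_opNorm (P.basis l)
  simp only [tsum_zero] at key
  simpa [Real.sqrt_sq] using key.sqrt

theorem eq_of_isCyclicFor (h : IsCyclicFor (Set.centralizer (Set.range P.pi0)) P.xi0) :
    kerPerp P.A = Htilde P.A P.q := by
  by_contra hne
  obtain ⟨v, hv⟩ := P.exists_vec
  obtain ⟨⟨l, hl, hlv⟩, m, hm, hmv⟩ := exists_of_ne hv hne
  -- The even exponent makes `⟨v, (1 - A²)^{2n} v⟩` the square of a norm.
  set Z : ℕ → P.Space →L[ℂ] P.Space := fun n =>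
    P.L (site P.basis 0 (P.q * P.oneSubSq ^ (n + n))) with hZ
  have hbound : ∀ n u, ‖Z n u‖ ≤ ‖P.q‖ * ‖u‖ := fun n u => by
    refine (P.norm_L_apply_le _ u).trans ?_
    gcongr
    refine (norm_siteOp_le _ _ _).trans ((norm_mul_le _ _).trans ?_)
    refine mul_le_of_le_one_right (norm_nonneg _) ?_
    exact ContinuousLinearMap.opNorm_le_bound _ zero_le_one fun u => by
      rw [one_mul]; exact P.norm_oneSubSq_pow_apply_le _ u
  have hxi : Tendsto (fun n => Z n P.xi) atTop (𝓝 0) :=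
    P.tendsto_oneSubSq_xi.comp (tendsto_atTop_mono (fun n => Nat.le_add_left n n) tendsto_id)
  have hcl : IsClosed {u : P.cyclicSpace | Tendsto (fun n => Z n u) atTop (𝓝 0)} :=
    (isClosed_tendsto_zero hbound).preimage continuous_subtype_val
  let S : Submodule ℂ P.cyclicSpace :=
    { carrier := {u | Tendsto (fun n => Z n u) atTop (𝓝 0)}
      add_mem' := fun {u w} hu hw => by simpa using Tendsto.add hu hw
      zero_mem' := by simp
      smul_mem' := fun c u hu => by simpa using Tendsto.const_smul hu c }
  -- For `B` in the commutant, `Z n (B ξ₀) = B (Z n ξ₀)` tends to zero; cyclicity and the uniform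
  -- bound extend this to every vector.
  have hS : ∀ u : P.cyclicSpace, u ∈ S := by
    intro u
    have h1 : (Submodule.span ℂ {w | ∃ B ∈ Set.centralizer (Set.range P.pi0),
        w = B P.xi0}).topologicalClosure ≤ S := by
      refine Submodule.topologicalClosure_minimal _ (Submodule.span_le.2 ?_) hcl
      rintro _ ⟨B, hB, rfl⟩
      have h2 : ∀ n, ∃ w : P.cyclicSpace, (w : P.Space) = Z n P.xi ∧
          ((B w : P.cyclicSpace) : P.Space) = Z n (B P.xi0) := fun n => by
        obtain ⟨w, hw, hBw⟩ := P.memBicommutant_q_mul_oneSubSq_pow (n + n) P.xi0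
        exact ⟨w, hw, hBw B hB⟩
      choose w hw hBw using h2
      have h3 : Tendsto w atTop (𝓝 0) := by
        rw [tendsto_subtype_rng]
        simpa [hw] using hxi
      have h4 := (B.continuous.tendsto 0).comp h3
      rw [map_zero, tendsto_subtype_rng] at h4
      refine (h4.congr fun n => ?_)
      exact hBw n
    exact h1 (h ▸ Submodule.mem_top)
  have hq : Tendsto (fun n => Z n (P.Pi (RInf.eps 0) P.xi)) atTop (𝓝 0) :=
    hS (P.pi0 (RInf.eps 0) P.xi0)
  set η := P.L (site P.basis 0 P.q) P.xi with hη
  have hval : ∀ n, Z n (P.Pi (RInf.eps 0) P.xi) =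
      ((‖(P.oneSubSq ^ n) v‖ ^ 2 : ℝ) : ℂ) • η := by
    intro n
    have h1 : P.q * P.oneSubSq ^ (n + n) * P.q = ((‖(P.oneSubSq ^ n) v‖ ^ 2 : ℝ) : ℂ) • P.q := by
      ext u
      simp only [hv, pow_add, mul_apply_eq_comp, InnerProductSpace.rankOne_apply, smul_apply,
        map_smul]
      rw [← inner_apply_of_isSelfAdjoint (P.isSelfAdjoint_oneSubSq_pow n),
        inner_self_eq_norm_sq_to_K, smul_comm]
      simp
    change Z n (P.L (P.T (RInf.eps 0)) P.xi) = _
    rw [T_eps_eq_site, hZ, ← mul_apply_eq_comp, ← map_mul, ← site_mul, h1, map_smul, map_smul]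
    rfl
  -- The label `m` lies outside `Ker A`, so it has positive weight, and `q b_m ≠ 0` because `⟨b_m,
  -- v⟩ ≠ 0`.
  have hη0 : 0 < ‖η‖ ^ 2 := by
    rw [hη, norm_L_site_xi_sq]
    have hs : Summable fun l => P.weight 0 l * ‖P.q (P.basis l)‖ ^ 2 := by
      refine ((P.summable_weight 0).mul_right (‖P.q‖ ^ 2)).of_nonneg_of_le
        (fun l => mul_nonneg (P.weight_nonneg 0 l) (by positivity)) fun l => ?_
      have h0 := P.weight_nonneg 0 l
      gcongr
      simpa [P.basis.orthonormal.1 l] using P.q.le_opNorm (P.basis l)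
    refine hs.tsum_pos (fun l => mul_nonneg (P.weight_nonneg 0 l) (by positivity)) m ?_
    have h1 : 0 < P.weight 0 m := (abs_pos.2 hm).trans_le (P.abs_ev_le_weight 0 m)
    have h2 : P.q (P.basis m) ≠ 0 := by
      rw [hv, InnerProductSpace.rankOne_apply]
      refine smul_ne_zero (fun hc => hmv ?_) ?_
      · rw [← inner_conj_symm, hc, map_zero]
      · rintro rfl
        simp at hmv
    positivity
  have hlow : ∀ n, ‖⟪P.basis l, v⟫_ℂ‖ ^ 2 * ‖η‖ ≤ ‖Z n (P.Pi (RInf.eps 0) P.xi)‖ := by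
    intro n
    rw [hval, norm_smul, Complex.norm_real, Real.norm_of_nonneg (by positivity)]
    gcongr
    -- As `b_l ∈ Ker A` is fixed by `1 - A²`, the component of `v` along it never decays.
    have h1 : ⟪P.basis l, v⟫_ℂ = ⟪P.basis l, (P.oneSubSq ^ n) v⟫_ℂ := by
      rw [← inner_apply_of_isSelfAdjoint (P.isSelfAdjoint_oneSubSq_pow n), oneSubSq_pow_basis, hl]
      simp
    rw [h1]
    simpa [P.basis.orthonormal.1 l] using
      norm_inner_le_norm (𝕜 := ℂ) (P.basis l) ((P.oneSubSq ^ n) v)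
  have h1 := ge_of_tendsto' hq.norm hlow
  rw [norm_zero] at h1
  have h2 : 0 < ‖η‖ := by
    by_contra hc
    have : ‖η‖ = 0 := le_antisymm (not_lt.1 hc) (norm_nonneg _)
    rw [this] at hη0
    simp at hη0
  have h3 : 0 < ‖⟪P.basis l, v⟫_ℂ‖ := norm_pos_iff.2 hlv
  exact absurd h1 (not_le.2 (by positivity))

end Params

/-! ### If `(Ker A)^⊥ = H̃`, then `ξ₀` is cyclic for the commutant -/

theorem siteOp_commute_siteProd {ι H : Type*} [NormedAddCommGroup H] [InnerProductSpace ℂ H]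
    (b : HilbertBasis ι ℂ H) (a c : H →L[ℂ] H) {F : Finset ℕ} {k : ℕ}
    (hk : k ∉ F) : Commute (siteOp b k a) (siteProd b c F) :=
  Finset.noncommProd_commute _ _ _ _ fun j hj =>
    siteOp_commute b (fun h : k = j => hk (h ▸ hj)) a c

theorem siteProd_star (b : HilbertBasis ι ℂ H) {a : H →L[ℂ] H} (ha : IsSelfAdjoint a)
    (F : Finset ℕ) : star (siteProd b a F) = siteProd b a F := by
  classical
  induction F using Finset.induction_on with
  | empty => rw [siteProd_empty, star_one]
  | insert k F hk ih =>
    rw [siteProd_insert b a hk, star_mul, ih, ← siteOp_star, ha.star_eq]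
    exact (siteOp_commute_siteProd b a a hk).eq.symm

namespace Params

open Filter Topology

attribute [local instance] seqMeasurableSpace

variable (P : Params ι H)

theorem exists_T_eq_siteProd (F : Finset ℕ) :
    ∃ r, (P.T r : L2 (ℕ → ι) →L[ℂ] L2 (ℕ → ι)) = siteProd P.basis P.q F := by
  classical
  induction F using Finset.induction_on with
  | empty => exact ⟨1, by rw [map_one]; rfl⟩
  | insert k F hk ih =>
    obtain ⟨r, hr⟩ := ih
    exact ⟨RInf.eps k * r, by rw [map_mul, MulMemClass.coe_mul, T_eps, hr, siteProd_insert _ _ hk]⟩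

/-- The adjoint of `T(s) ∏ q^{(k)}` is `∏ q^{(k)} T(s⁻¹)`, again a value of `T`. Stability of
`T(R_∞)` under adjoints lets the projection onto the cyclic space intertwine the representations. -/
theorem exists_T_eq_star (r : RInf) : ∃ r', P.T r' = star (P.T r) := by
  obtain ⟨r', hr'⟩ := P.exists_T_eq_siteProd r.undef
  have hs : {x | r.extPerm⁻¹ x ≠ x}.Finite := r.finite_ext.subset fun x hx hc => hx (by
    rw [Equiv.Perm.inv_eq_iff_eq, hc])
  refine ⟨r' * RInf.ofPerm r.extPerm⁻¹ hs, Subtype.ext ?_⟩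
  have h : star (T0 P.basis P.neg P.q r) =
      siteProd P.basis P.q r.undef * signedPerm P.neg r.extPerm⁻¹ := by
    rw [T0, star_mul, siteProd_star _ P.q_proj.isSelfAdjoint, signedPerm_star _ r.finite_ext]
  rw [map_mul, MulMemClass.coe_mul, hr', T_ofPerm, ← h]
  rfl

/-! ### Point masses of the one-factor measures and their relabelling. -/

theorem siteMeasure_singleton (k : ℕ) (i : ι) :
    P.siteMeasure k {i} = ENNReal.ofReal (P.weight k i) := by
  classical
  let _ : MeasurableSpace ι := ⊤
  rw [siteMeasure, MeasureTheory.Measure.sum_apply _ MeasurableSpace.measurableSet_top,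
    tsum_eq_single i]
  · simp
  · intro j hj
    simp [hj]

theorem map_siteMeasure [Countable ι] {s : Equiv.Perm ℕ} {w : Equiv.Perm ι}
    (h : ∀ j l, P.weight (s j) (w l) = P.weight j l) (j : ℕ) :
    @MeasureTheory.Measure.map ι ι ⊤ ⊤ w.symm (P.siteMeasure (s j)) = P.siteMeasure j := by
  let _ : MeasurableSpace ι := ⊤
  refine MeasureTheory.Measure.ext_of_singleton fun l => ?_
  have : w.symm ⁻¹' {l} = {w l} := by
    ext m; simp [Equiv.symm_apply_eq]
  rw [MeasureTheory.Measure.map_apply measurable_from_top MeasurableSpace.measurableSet_top, this,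
    siteMeasure_singleton, siteMeasure_singleton, h]

variable [Countable ι]

/-! ### Operators in the commutant of `Π_A(R_∞)` obtained from right multiplication. -/

theorem L_xi (a : localAlg ι) : P.L a P.xi = (P.toPre a : P.Space) := by
  change (P.leftMul a).completion (P.toPre 1 : P.PreSpace) = _
  rw [ContinuousLinearMap.completion_apply_coe, leftMul_apply]
  exact congrArg (fun c => (P.toPre c : P.Space)) (mul_one a)

/-- A bounded linear map of `B(H)^{⊗ ∞}` that commutes with left multiplication by the operators
`T(r)` extends to an operator in the commutant of `Π_A(R_∞)`. -/
theorem exists_mem_centralizer (Φ : localAlg ι →ₗ[ℂ] localAlg ι) (C : ℝ)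
    (hC : ∀ a, ‖P.toPre (Φ a)‖ ≤ C * ‖P.toPre a‖) (hT : ∀ r a, Φ (P.T r * a) = P.T r * Φ a) :
    ∃ R ∈ Set.centralizer (Set.range P.Pi), R P.xi = P.L (Φ 1) P.xi := by
  let Ψ : P.PreSpace →L[ℂ] P.PreSpace :=
    (P.toPre.toLinearMap ∘ₗ Φ ∘ₗ P.ofPre.toLinearMap).mkContinuous C fun u => hC (P.ofPre u)
  refine ⟨Ψ.completion, ?_, ?_⟩
  · rintro _ ⟨r, rfl⟩
    change (P.leftMul (P.T r)).completion * Ψ.completion =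
      Ψ.completion * (P.leftMul (P.T r)).completion
    ext u
    induction u using UniformSpace.Completion.induction_on with
    | hp => apply isClosed_eq <;> fun_prop
    | ih u =>
      simp only [mul_apply_eq_comp, ContinuousLinearMap.completion_apply_coe]
      congr 1
      exact congrArg P.toPre (hT r (P.ofPre u)).symm
  · rw [L_xi]
    exact ContinuousLinearMap.completion_apply_coe Ψ (P.toPre 1)

/-- `e_{ij}^{(k)}` sends `e_x` to zero or to `e_{x'}`, where `x'` has entry `i` at place `k`. When
coordinate `k` is integrated separately, the contribution of `i` alone to `‖a‖²` already dominates
the left side. -/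
theorem weight_mul_norm_sq_le (k : ℕ) (i j : ι) (a : localAlg ι) :
    P.weight k i * ‖P.toPre (a * site P.basis k (matUnit P.basis i j))‖ ^ 2 ≤ ‖P.toPre a‖ ^ 2 := by
  classical
  let _ : MeasurableSpace ι := ⊤
  rw [pre_norm_sq, pre_norm_sq, ← MeasureTheory.integral_const_mul]
  have hint := P.integrable_norm_sq a
  refine le_trans ?_ (integral_resample P.siteMeasure k hint).ge
  refine MeasureTheory.integral_mono ((P.integrable_norm_sq _).const_mul _)
    (integrable_update P.siteMeasure k hint).integral_prod_left fun x => ?_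
  have h1 : ‖(a.1 * siteOp P.basis k (matUnit P.basis i j)) (e x)‖ ^ 2 ≤
      ‖a.1 (e (Function.update x k i))‖ ^ 2 := by
    rw [mul_apply_eq_comp, siteOp_matUnit_e]
    split_ifs <;> simp
  refine (mul_le_mul_of_nonneg_left h1 (P.weight_nonneg k i)).trans ?_
  have h2 : MeasureTheory.Integrable (fun l => ‖a.1 (e (Function.update x k l))‖ ^ 2)
      (P.siteMeasure k) := by
    refine MeasureTheory.Integrable.of_bound measurable_from_top.aestronglyMeasurable
      (‖a.1‖ ^ 2) (Eventually.of_forall fun l => ?_)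
    rw [Real.norm_of_nonneg (by positivity)]
    gcongr
    simpa [norm_e] using a.1.le_opNorm (e (Function.update x k l))
  have h3 := MeasureTheory.setIntegral_le_integral (s := {i}) h2
    (Eventually.of_forall fun l => by positivity)
  rwa [MeasureTheory.integral_singleton, MeasureTheory.measureReal_def, siteMeasure_singleton,
    ENNReal.toReal_ofReal (P.weight_nonneg k i), smul_eq_mul] at h3

/-- Right multiplication by `e_{ij}^{(k)}`. -/
theorem exists_right_matUnit (k : ℕ) {i : ι} (hi : P.ev i ≠ 0) (j : ι) :
    ∃ R ∈ Set.centralizer (Set.range P.Pi),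
      R P.xi = P.L (site P.basis k (matUnit P.basis i j)) P.xi := by
  have hw : 0 < P.weight k i := (abs_pos.2 hi).trans_le (P.abs_ev_le_weight k i)
  have h := P.exists_mem_centralizer
    (LinearMap.mulRight ℂ (site P.basis k (matUnit P.basis i j))) (√(P.weight k i))⁻¹
    (fun a => by
      rw [LinearMap.mulRight_apply, ← sq_le_sq₀ (norm_nonneg _) (by positivity), mul_pow, inv_pow,
        Real.sq_sqrt hw.le, ← mul_le_mul_iff_right₀ hw, ← mul_assoc, mul_inv_cancel₀ hw.ne',
        one_mul]
      exact P.weight_mul_norm_sq_le k i j a)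
    fun r a => by simp [mul_assoc]
  simpa using h

/-- Right multiplication by `T(s)` for a permutation `s`, combined with the relabelling of the
basis vectors that carries the states of the tensor factors to each other. -/
theorem exists_right_perm (s : Equiv.Perm ℕ) (hs : {x | s x ≠ x}.Finite) :
    ∃ R ∈ Set.centralizer (Set.range P.Pi), R P.xi = P.Pi (RInf.ofPerm s hs) P.xi := by
  let _ : MeasurableSpace ι := ⊤
  obtain ⟨w, hw, hneg, hq⟩ := P.exists_relabel s.symm
  -- Invariance is checked on permutations and on the `ε_k`, out of which every `T r` is a product.
  have hconj : ∀ r, relabelConj w (P.T r) = P.T r := by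
    have h1 : ∀ s hs, relabelConj w (P.T (RInf.ofPerm s hs)) = P.T (RInf.ofPerm s hs) :=
      fun s hs => Subtype.ext <| by
        rw [coe_relabelConj, T_ofPerm, relabelOp_conj_signedPerm hneg]
    have h2 : ∀ k, relabelConj w (P.T (RInf.eps k)) = P.T (RInf.eps k) := fun k =>
      Subtype.ext <| by rw [coe_relabelConj, T_eps, relabelOp_conj_siteOp P.basis hq]
    have h3 : ∀ F, ∃ r, (P.T r).1 = siteProd P.basis P.q F ∧ relabelConj w (P.T r) = P.T r := by
      classical
      intro F
      induction F using Finset.induction_on with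
      | empty => exact ⟨1, by rw [map_one]; rfl, by rw [map_one, relabelConj_one]⟩
      | insert k F hk ih =>
        obtain ⟨r, hr, hr'⟩ := ih
        refine ⟨RInf.eps k * r, ?_, by rw [map_mul, relabelConj_mul, h2, hr']⟩
        rw [map_mul, MulMemClass.coe_mul, T_eps, hr, siteProd_insert _ _ hk]
    intro r
    obtain ⟨r', hr, hr'⟩ := h3 r.undef
    have h4 : P.T r = P.T (RInf.ofPerm r.extPerm r.finite_ext) * P.T r' := by
      refine Subtype.ext ?_
      rw [MulMemClass.coe_mul, T_ofPerm, hr]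
      rfl
    rw [h4, relabelConj_mul, h1, hr']
  let W : ι ≃ᵐ ι := ⟨w.symm, measurable_from_top, measurable_from_top⟩
  have hmap := map_relabel_infinitePi P.siteMeasure s.symm W fun j => P.map_siteMeasure hw j
  have hmeas : Measurable fun (x : ℕ → ι) j => W (x (s.symm j)) :=
    measurable_pi_lambda _ fun j => W.measurable.comp (measurable_pi_apply _)
  have h := P.exists_mem_centralizer
    (LinearMap.mulRight ℂ (P.T (RInf.ofPerm s hs)) ∘ₗ relabelConj w) 1
    (fun a => by
      rw [one_mul, ← sq_le_sq₀ (norm_nonneg _) (norm_nonneg _), pre_norm_sq, pre_norm_sq]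
      have hint := P.integrable_norm_sq a
      -- `T(s)` moves the places and the relabelling changes the values; together they preserve the
      -- product measure, so the map is isometric.
      have h1 : ∫ x, ‖a.1 (e x)‖ ^ 2 ∂P.prodMeasure =
          ∫ x, ‖a.1 (e fun j => W (x (s.symm j)))‖ ^ 2 ∂P.prodMeasure := by
        conv_lhs => rw [prodMeasure, ← hmap]
        rw [prodMeasure, ← hmap] at hint
        exact MeasureTheory.integral_map hmeas.aemeasurable hint.aestronglyMeasurable
      refine le_of_eq (Eq.trans ?_ h1.symm)
      refine MeasureTheory.integral_congr_ae (Eventually.of_forall fun x => ?_)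
      change ‖(relabelOp w * a.1 * relabelOp w.symm * (P.T (RInf.ofPerm s hs)).1) (e x)‖ ^ 2 = _
      rw [T_ofPerm, mul_apply_eq_comp, mul_apply_eq_comp, mul_apply_eq_comp, signedPerm_e, map_smul,
        map_smul, norm_relabelOp_apply, relabelOp_e, norm_smul]
      have h2 : ∀ c : ℤˣ, ‖((c : ℤ) : ℂ)‖ = 1 := fun c => by
        rcases Int.units_eq_one_or c with h | h <;> simp [h]
      rw [h2, one_mul]
      rfl)
    fun r a => by
      simp [relabelConj_mul, hconj, mul_assoc]
  simp only [LinearMap.comp_apply, relabelConj_one, LinearMap.mulRight_apply, one_mul] at h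
  exact h

/-- The closed subspace generated by `ξ₀` under the commutant of `Π_A(R_∞)` on `𝓗_A^q`. -/
def commutantSpace : Submodule ℂ P.Space :=
  (Submodule.span ℂ {u | ∃ R ∈ Set.centralizer (Set.range P.Pi), u = R P.xi}).topologicalClosure

theorem apply_xi_mem_commutantSpace {R : P.Space →L[ℂ] P.Space}
    (hR : R ∈ Set.centralizer (Set.range P.Pi)) : R P.xi ∈ P.commutantSpace :=
  Submodule.le_topologicalClosure _ (Submodule.subset_span ⟨R, hR, rfl⟩)

theorem apply_mem_commutantSpace {R : P.Space →L[ℂ] P.Space}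
    (hR : R ∈ Set.centralizer (Set.range P.Pi)) {u : P.Space} (hu : u ∈ P.commutantSpace) :
    R u ∈ P.commutantSpace := by
  have h : P.commutantSpace ≤ P.commutantSpace.comap (R : P.Space →ₗ[ℂ] P.Space) := by
    refine Submodule.topologicalClosure_minimal _ (Submodule.span_le.2 ?_)
      ((Submodule.isClosed_topologicalClosure _).preimage R.continuous)
    rintro _ ⟨S, hS, rfl⟩
    exact P.apply_xi_mem_commutantSpace (Set.mul_mem_centralizer hR hS)
  exact h hu

theorem centralizer_apply {R : P.Space →L[ℂ] P.Space}
    (hR : R ∈ Set.centralizer (Set.range P.Pi)) (r : RInf) (u : P.Space) :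
    P.Pi r (R u) = R (P.Pi r u) :=
  congrArg (fun c => c u) (hR (P.Pi r) ⟨r, rfl⟩)

variable {P} in
-- Induction on `F`. The new factor `q^{(k)}` is expanded into matrix units, which commute past the
-- remaining product to reach `ξ₀`, where they can be replaced by right multiplications.
theorem siteProd_xi_mem {v : H} (hv : P.q = InnerProductSpace.rankOne ℂ v v)
    (h0 : ∀ l, P.ev l = 0 → ⟪P.basis l, v⟫_ℂ = 0) (F : Finset ℕ) (r : RInf)
    (hr : (P.T r).1 = siteProd P.basis P.q F) : P.Pi r P.xi ∈ P.commutantSpace := by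
  classical
  induction F using Finset.induction_on generalizing r with
  | empty =>
    have : P.T r = 1 := Subtype.ext hr
    change P.L (P.T r) P.xi ∈ _
    rw [this, map_one]
    exact P.apply_xi_mem_commutantSpace (R := 1) Set.one_mem_centralizer
  | insert k F hk ih =>
    obtain ⟨r', hr'⟩ := P.exists_T_eq_siteProd F
    set u := P.Pi r' P.xi with hu
    have hru : P.Pi r P.xi = P.L (site P.basis k P.q) u := by
      have : P.T r = site P.basis k P.q * P.T r' := Subtype.ext <| by
        rw [hr, siteProd_insert _ _ hk, MulMemClass.coe_mul, hr']
        rfl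
      change P.L (P.T r) P.xi = P.L (site P.basis k P.q) (P.L (P.T r') P.xi)
      rw [this, map_mul, mul_apply_eq_comp]
    let Λ : (H →L[ℂ] H) →L[ℂ] P.Space := LinearMap.mkContinuous
      { toFun := fun c => P.L (site P.basis k c) u
        map_add' := fun c d => by rw [map_add, map_add, add_apply]
        map_smul' := fun z c => by rw [map_smul, map_smul, smul_apply]; rfl } ‖u‖ fun c => by
      refine (P.norm_L_apply_le _ u).trans ?_
      rw [mul_comm]
      gcongr
      exact norm_siteOp_le _ _ _
    have hunit : ∀ i j, P.ev i ≠ 0 → Λ (matUnit P.basis i j) ∈ P.commutantSpace := by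
      intro i j hi
      obtain ⟨R, hR, hRx⟩ := P.exists_right_matUnit k hi j
      have hcomm : site P.basis k (matUnit P.basis i j) * P.T r' =
          P.T r' * site P.basis k (matUnit P.basis i j) := Subtype.ext <| by
        rw [MulMemClass.coe_mul, MulMemClass.coe_mul, hr']
        exact (siteOp_commute_siteProd P.basis _ _ hk).eq
      have : Λ (matUnit P.basis i j) = R u := by
        change P.L (site P.basis k (matUnit P.basis i j)) (P.L (P.T r') P.xi) = _
        rw [← mul_apply_eq_comp, ← map_mul, hcomm, map_mul, mul_apply_eq_comp, ← hRx]
        exact P.centralizer_apply hR r' P.xi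
      rw [this]
      exact P.apply_mem_commutantSpace hR (ih r' hr')
    have hsum : HasSum (fun l => ⟪P.basis l, v⟫_ℂ • P.basis l) v := by
      simpa [P.basis.repr_apply_apply] using P.basis.hasSum_repr v
    -- Truncating `v` in both slots approximates `q` in operator norm by finite combinations of
    -- matrix units.
    have hlim : Tendsto (fun s : Finset ι => Λ (InnerProductSpace.rankOne ℂ
        (∑ l ∈ s, ⟪P.basis l, v⟫_ℂ • P.basis l) (∑ l ∈ s, ⟪P.basis l, v⟫_ℂ • P.basis l))) atTop
        (𝓝 (Λ P.q)) := by
      rw [hv]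
      have hr : Continuous fun y : H => (InnerProductSpace.rankOne ℂ y y : H →L[ℂ] H) := by
        have : (fun y : H => (InnerProductSpace.rankOne ℂ y y : H →L[ℂ] H)) =
            fun y => ContinuousLinearMap.smulRightL ℂ H H (innerSL ℂ y) y := by ext; simp
        rw [this]
        fun_prop
      have hc : Continuous fun y : H => Λ (InnerProductSpace.rankOne ℂ y y) :=
        Λ.continuous.comp hr
      exact (hc.tendsto v).comp hsum
    rw [hru]
    refine (Submodule.isClosed_topologicalClosure _).mem_of_tendsto hlim
      (Eventually.of_forall fun s => ?_)
    simp only [map_sum, sum_apply, map_smul, map_smulₛₗ, smul_apply]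
    refine Submodule.sum_mem _ fun j _ => Submodule.smul_mem _ _ <|
      Submodule.sum_mem _ fun i _ => ?_
    -- Only the row index `i` matters for boundedness of right multiplication; rows belonging to
    -- `Ker A` have coefficient zero.
    by_cases hi : P.ev i = 0
    · rw [h0 i hi, zero_smul]
      exact zero_mem _
    · exact Submodule.smul_mem _ _ (hunit i j hi)

variable {P} in
-- Writing `r` with the permutation on the right, `T(r) = T(r') T(s)`, lets `T(s)` be exchanged for
-- an operator `R` of the commutant, which then moves to the front.
theorem Pi_xi_mem_commutantSpace (h : kerPerp P.A = Htilde P.A P.q) (r : RInf) :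
    P.Pi r P.xi ∈ P.commutantSpace := by
  obtain ⟨v, hv⟩ := P.exists_vec
  obtain ⟨R, hR, hRx⟩ := P.exists_right_perm r.extPerm r.finite_ext
  obtain ⟨r', hr'⟩ := P.exists_T_eq_siteProd (r.undef.map r.extPerm.toEmbedding)
  have h1 : P.T r = P.T r' * P.T (RInf.ofPerm r.extPerm r.finite_ext) := Subtype.ext <| by
    rw [MulMemClass.coe_mul, hr', T_ofPerm,
      siteProd_mul_signedPerm P.basis P.neg hv (P.neg_orthogonal hv)]
    rfl
  have h2 : P.Pi r P.xi = R (P.Pi r' P.xi) := by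
    rw [← P.centralizer_apply hR, hRx]
    change P.L (P.T r) P.xi = P.L (P.T r') (P.L (P.T _) P.xi)
    rw [h1, map_mul, mul_apply_eq_comp]
  rw [h2]
  exact P.apply_mem_commutantSpace hR
    (siteProd_xi_mem hv (fun l hl => inner_eq_zero_of_eq hv h hl) _ r' hr')

/-- The cyclic space is invariant under the adjoint of `Π_A(r)` too, so its orthogonal complement is
invariant under `Π_A(r)`. -/
theorem orthogonalProjectionOnto_Pi (r : RInf) (u : P.Space) :
    P.cyclicSpace.orthogonalProjectionOnto (P.Pi r u) =
      P.pi0 r (P.cyclicSpace.orthogonalProjectionOnto u) := by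
  obtain ⟨r', hr'⟩ := P.exists_T_eq_star r
  refine Subtype.ext (Submodule.eq_starProjection_of_mem_of_inner_eq_zero
    (P.pi0 r (P.cyclicSpace.orthogonalProjectionOnto u)).2 fun w hw => ?_)
  change ⟪P.L (P.T r) u - P.L (P.T r) (P.cyclicSpace.orthogonalProjectionOnto u : P.Space), w⟫_ℂ = 0
  rw [← map_sub, ← ContinuousLinearMap.adjoint_inner_right, ← ContinuousLinearMap.star_eq_adjoint,
    ← map_star, ← hr']
  exact Submodule.starProjection_inner_eq_zero u _ (P.Pi_mem r' hw)

theorem isCyclicFor_of_eq (h : kerPerp P.A = Htilde P.A P.q) :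
    IsCyclicFor (Set.centralizer (Set.range P.pi0)) P.xi0 := by
  rw [IsCyclicFor, eq_top_iff]
  set S := (Submodule.span ℂ {w | ∃ B ∈ Set.centralizer (Set.range P.pi0),
    w = B P.xi0}).topologicalClosure with hS
  set Q := P.cyclicSpace.orthogonalProjectionOnto with hQ
  have h1 : P.commutantSpace ≤ S.comap (Q : P.Space →ₗ[ℂ] P.cyclicSpace) := by
    refine Submodule.topologicalClosure_minimal _ (Submodule.span_le.2 ?_)
      ((Submodule.isClosed_topologicalClosure _).preimage Q.continuous)
    rintro _ ⟨R, hR, rfl⟩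
    refine Submodule.le_topologicalClosure _ (Submodule.subset_span
      -- `R` need not preserve the cyclic space; its compression does, and still commutes with
      -- `π_A^{(0)}` because `Q` intertwines.
      ⟨Q.comp (R.comp P.cyclicSpace.subtypeL), ?_, rfl⟩)
    rintro _ ⟨r, rfl⟩
    ext u
    change ((P.pi0 r (Q (R u)) : P.cyclicSpace) : P.Space) = (Q (R (P.Pi r u)) : P.cyclicSpace)
    rw [← P.centralizer_apply hR, hQ, orthogonalProjectionOnto_Pi]
  have h2 : P.cyclicSpace ≤ P.commutantSpace := by
    refine Submodule.topologicalClosure_minimal _ (Submodule.span_le.2 ?_)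
      (Submodule.isClosed_topologicalClosure _)
    rintro _ ⟨r, rfl⟩
    exact Pi_xi_mem_commutantSpace h r
  intro u _
  have h3 : Q (u : P.Space) ∈ S := h1 (h2 u.2)
  rwa [hQ, Submodule.orthogonalProjectionOnto_mem_subspace_eq_self] at h3

end Params

end

end InfTensor

theorem mainTheorem5 {ι H : Type*} [Countable ι] [NormedAddCommGroup H] [InnerProductSpace ℂ H]
    [CompleteSpace H] (P : InfTensor.Params ι H) :
    InfTensor.IsCyclicFor (Set.centralizer (Set.range P.pi0)) P.xi0 ↔
      InfTensor.kerPerp P.A = InfTensor.Htilde P.A P.q :=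
  ⟨P.eq_of_isCyclicFor, P.isCyclicFor_of_eq⟩
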